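/- All of the following notions concern ordinals $\kappa$ and sets $S, C$ of ordinals, and are defined by simultaneous recursion on the ordinal $\gamma$; stationarity is only considered at nonzero limit ordinals $\kappa$. $S$ is $0$-stationary in $\kappa$ if $S$ is unbounded in $\kappa$. $C\subseteq\kappa$ is $\gamma$-club in $\kappa$ if $C$ is $\gamma$-stationary in $\kappa$ and $\alpha\in C$ for every $\alpha<\kappa$ such that $C$ is $\gamma$-stationary in $\alpha$. $\kappa$ is $\gamma$-reflecting if for all $A,B\subseteq\kappa$ that are $\gamma$-stationary in $\kappa$ there is $\alpha<\kappa$ such that $A$ and $B$ are both $\gamma$-stationary in $\alpha$. For $\gamma>0$, $S$ is $\gamma$-stationary in $\kappa$ if for all $\eta<\gamma$, $\kappa$ is $\eta$-reflecting and $S\cap C\neq\emptyset$ for every $C$ that is $\eta$-club in $\kappa$. Let $\mathcal C^\gamma(\kappa)$ be the family of subsets of $\kappa$ that contain a $\gamma$-club of $\kappa$; it is $\kappa$-complete if it is closed under intersections of fewer than $\kappa$ (and at least one) of its members. An uncountable cardinal $\kappa$ is weakly compact if every $f:[\kappa]^2\to 2$ has a homogeneous set of cardinality $\kappa$. For an ordinal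 $\alpha$, a set $A\subseteq V_\alpha$ and a first-order formula $\varphi(\vec X,\vec Y,A)$ over $\langle V_\alpha,\in\rangle$ with predicates for $A$ and for two finite sequences $\vec X,\vec Y$ of subsets of $V_\alpha$, the game $G_\gamma(\alpha,\varphi,A)$ is played as follows by players $\Sigma$ and $\Pi$, with $\gamma_0=\gamma$ (an ordinal is odd if it is a limit ordinal or $0$ plus an odd natural number, and even otherwise). If $\gamma$ is even, then in round $n\ge 1$ player $\Sigma$ plays an odd ordinal $\gamma_n<\gamma_{n-1}$ and $X_n\subseteq V_\alpha$, and then $\Pi$ plays $Y_n\subseteq V_\alpha$ such that $\varphi(\langle X_1,\dots,X_n\rangle,\langle Y_1,\dots,Y_n\rangle,A)$ holds over $V_\alpha$. If $\gamma$ is odd, then in round $n\ge1$ player $\Sigma$ plays $Y_n\subseteq V_\alpha$ such that $\varphi(\langle X_1,\dots,X_{n-1}\rangle,\langle Y_1,\dots,Y_n\rangle,A)$ holds over $V_\alpha$, and then $\Pi$ plays an odd ordinal $\gamma_n<\gamma_{n-1}$ and $X_n\subseteq V_\alpha$. The first player who is unable to move loses; a player wins the game if that player has a winning strategy. A cardinal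 $\kappa$ is $\Pi^1_\gamma$-indescribable if for all $\varphi$ and all $A\subseteq V_\kappa$ such that $\Pi$ wins $G_\gamma(\kappa,\varphi,A)$ there is $\alpha<\kappa$ such that $\Pi$ wins $G_\gamma(\alpha,\varphi,A\cap V_\alpha)$. **Theorem.** Let $\kappa$ be a cardinal. (1) Let $\gamma$ be an ordinal. If $\kappa$ is weakly compact and $\mathcal C^{\gamma}(\kappa)$ is $\kappa$-complete, then every $S\subseteq\kappa$ that is $(\gamma+1)$-stationary in $\kappa$ is the union of $\kappa$ many pairwise disjoint sets that are $(\gamma+1)$-stationary in $\kappa$. (2) Let $\gamma\ge1$ be an ordinal. If $\kappa$ is $\Pi^1_\gamma$-indescribable, then every $S\subseteq\kappa$ that is $(\gamma+1)$-stationary in $\kappa$ is the union of $\kappa$ many pairwise disjoint sets that are $(\gamma+1)$-stationary in $\kappa$. (3) Let $n\ge 1$ be a natural number. If $\kappa$ is $\Pi^1_n$-indescribable in the usual sense ($\kappa$ is uncountable, and for every $R\subseteq V_\kappa$, every $\Pi^1_n$ sentence true in $\langle V_\kappa,\in,R\rangle$ is true in $\langle V_\alpha,\in,R\cap V_\alpha\rangle$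 for some $\alpha<\kappa$), then every $S\subseteq\kappa$ that is $(n+1)$-stationary in $\kappa$ is the union of $\kappa$ many pairwise disjoint sets that are $(n+1)$-stationary in $\kappa$. -/

import Mathlib

universe u

open Set

namespace HigherStat

/-! ### Generalised clubs and stationary sets -/

/-- `S` is unbounded in `κ`. -/
def UnboundedIn (κ : Ordinal.{u}) (S : Set Ordinal.{u}) : Prop :=
  ∀ β < κ, ∃ s ∈ S, β < s ∧ s < κ

/-- For a notion `P κ S` of "`S` is large in `κ`": any two large subsets of `κ` are simultaneously
large in some `α < κ`. -/
def ReflectsFor (P : Ordinal.{u} → Set Ordinal.{u} → Prop) (κ : Ordinal.{u}) : Prop :=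
  ∀ A ⊆ Iio κ, ∀ B ⊆ Iio κ, P κ A → P κ B → ∃ α < κ, P α A ∧ P α B

/-- For a notion `P κ S` of "`S` is large in `κ`": the set `C ⊆ κ` is large in `κ` and contains
every `α < κ` in which it is large. -/
def ClubFor (P : Ordinal.{u} → Set Ordinal.{u} → Prop) (κ : Ordinal.{u})
    (C : Set Ordinal.{u}) : Prop :=
  C ⊆ Iio κ ∧ P κ C ∧ ∀ α < κ, P α C → α ∈ C

/-- `IsStationary γ κ S`: the set of ordinals `S` is `γ`-stationary in `κ`.
A set is `0`-stationary in `κ` if it is unbounded in `κ`; for `γ > 0` it is `γ`-stationary in `κ`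
if for all `η < γ` the ordinal `κ` is `η`-reflecting and `S` meets every `η`-club of `κ`.
As usual these notions are only considered at (nonzero) limit ordinals `κ`, so that the ordinals in
which a set is `0`-stationary are its limit points. -/
def IsStationary (γ : Ordinal.{u}) : Ordinal.{u} → Set Ordinal.{u} → Prop :=
  fun κ S =>
    Order.IsSuccLimit κ ∧ (γ = 0 → UnboundedIn κ S) ∧
      ∀ η, ∀ _h : η < γ, ReflectsFor (IsStationary η) κ ∧
        ∀ C, ClubFor (IsStationary η) κ C → (S ∩ C).Nonempty
termination_by γ

/-- `C` is `γ`-club in `κ`. -/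
def IsGClub (γ κ : Ordinal.{u}) (C : Set Ordinal.{u}) : Prop :=
  ClubFor (IsStationary γ) κ C

/-- `κ` is `γ`-reflecting. -/
def IsReflecting (γ κ : Ordinal.{u}) : Prop :=
  ReflectsFor (IsStationary γ) κ

/-- `𝒞^γ(κ)`: the subsets of `κ` that contain a `γ`-club of `κ` (a filter on `κ` if `κ` is
`γ`-reflecting; any `κ` with a `(γ+1)`-stationary subset is). -/
def clubFilter (γ κ : Ordinal.{u}) : Set (Set Ordinal.{u}) :=
  {X | X ⊆ Iio κ ∧ ∃ C, IsGClub γ κ C ∧ C ⊆ X}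

/-- A family of sets is `κ`-complete: it is closed under (nonempty) intersections of fewer than `κ`
of its members. -/
def IsComplete (κ : Cardinal.{u}) (F : Set (Set Ordinal.{u})) : Prop :=
  ∀ (ι : Type u) [Nonempty ι] (X : ι → Set Ordinal.{u}),
    Cardinal.mk ι < κ → (∀ i, X i ∈ F) → (⋂ i, X i) ∈ F

/-- `S` is the union of `κ` many pairwise disjoint sets that are `γ`-stationary in `κ`. -/
def Splits (γ : Ordinal.{u}) (κ : Cardinal.{u}) (S : Set Ordinal.{u}) : Prop :=
  ∃ P : Iio κ.ord → Set Ordinal.{u},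
    (∀ i, IsStationary γ κ.ord (P i)) ∧ (∀ i j, i ≠ j → Disjoint (P i) (P j)) ∧ ⋃ i, P i = S

/-- `κ` is weakly compact: it is uncountable and every colouring of the pairs from `κ` with two
colours has a homogeneous set of cardinality `κ`. -/
def IsWeaklyCompact (κ : Cardinal.{u}) : Prop :=
  Cardinal.aleph0 < κ ∧
    ∀ f : Ordinal.{u} → Ordinal.{u} → Fin 2, ∃ X ⊆ Iio κ.ord,
      Cardinal.mk X = Cardinal.lift.{u + 1} κ ∧
        ∃ c, ∀ a ∈ X, ∀ b ∈ X, a < b → f a b = c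

/-! ### Indescribability -/

/-- The domain of `V_α`. -/
abbrev VDom (α : Ordinal.{u}) : Type (u + 1) :=
  {x : ZFSet.{u} // x ∈ ZFSet.vonNeumann α}

/-- `A ∩ V_α` as a subset of `V_α`. -/
def restrict (A : Set ZFSet.{u}) (α : Ordinal.{u}) : Set (VDom α) :=
  {x | x.1 ∈ A}

/-- Relation symbols: membership, a unary predicate `R`, and unary predicates `X₀, X₁, …`. -/
inductive SecondOrderRel : ℕ → Type
  | mem : SecondOrderRel 2
  | par : SecondOrderRel 1
  | var (k : ℕ) : SecondOrderRel 1

/-- The language of set theory with predicates `R, X₀, X₁, …`. -/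
def secondOrderLang : FirstOrder.Language.{0, 0} :=
  ⟨fun _ => Empty, SecondOrderRel⟩

/-- The structure `⟨V_α, ∈, R, X₀, …, Xₘ₋₁⟩` (with `X_k = ∅` for `k ≥ m`). -/
@[reducible] def secondOrderStructure (α : Ordinal.{u}) (R : Set (VDom α)) (X : List (Set (VDom α))) :
    secondOrderLang.Structure (VDom α) where
  funMap := fun f => f.elim
  RelMap := fun r v =>
    match r, v with
    | .mem, v => (v 0).1 ∈ (v 1).1
    | .par, v => v 0 ∈ R
    | .var k, v => v 0 ∈ X.getD k ∅

/-- `⟨V_α, ∈, R, X⟩ ⊨ Q X_m … Q X_{m+n-1} ψ`, where `m` is the length of `X`, there are `n`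
alternating second order quantifiers, the first of which is universal if `b = true` and existential
if `b = false`, and `ψ` is first order. -/
def AltHolds (α : Ordinal.{u}) (ψ : secondOrderLang.Sentence) (R : Set (VDom α)) :
    ℕ → Bool → List (Set (VDom α)) → Prop
  | 0, _, X => @FirstOrder.Language.Sentence.Realize secondOrderLang (VDom α)
      (secondOrderStructure α R X) ψ
  | n + 1, true, X => ∀ Z, AltHolds α ψ R n false (X ++ [Z])
  | n + 1, false, X => ∃ Z, AltHolds α ψ R n true (X ++ [Z])

/-- `κ` is `Π¹ₙ`-indescribable for a natural number `n`: every `Π¹ₙ` sentence with a predicate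
`R ⊆ V_κ` that holds in `⟨V_κ, ∈, R⟩` holds in `⟨V_α, ∈, R ∩ V_α⟩` for some `α < κ`. -/
def IsFinIndescribable (n : ℕ) (κ : Cardinal.{u}) : Prop :=
  Cardinal.aleph0 < κ ∧
    ∀ (ψ : secondOrderLang.Sentence) (R : Set ZFSet.{u}),
      (∀ x ∈ R, x ∈ ZFSet.vonNeumann κ.ord) →
      AltHolds κ.ord ψ (restrict R κ.ord) n true [] →
      ∃ α < κ.ord, AltHolds α ψ (restrict R α) n true []

/-- An ordinal is odd if it is of the form `l + n` with `l` zero or a limit ordinal and `n` an odd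
natural number. -/
def IsOddOrdinal (α : Ordinal.{u}) : Prop :=
  ∃ (l : Ordinal.{u}) (n : ℕ), Order.IsSuccPrelimit l ∧ Odd n ∧ α = l + n

/-- Relation symbols for the matrix `φ(X⃗, Y⃗, A)` of a game: membership, the predicate `A`, and, for
the finite sequences `X⃗`, `Y⃗` of sets, the predicates "`i` is in the domain of the sequence" and
"`x` is an element of the `i`-th entry of the sequence". -/
inductive GameRel : ℕ → Type
  | mem : GameRel 2
  | par : GameRel 1
  | domX : GameRel 1
  | entryX : GameRel 2
  | domY : GameRel 1
  | entryY : GameRel 2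

/-- The language of the matrices of games. -/
def gameLang : FirstOrder.Language.{0, 0} :=
  ⟨fun _ => Empty, GameRel⟩

/-- The structure `⟨V_α, ∈, X⃗, Y⃗, A⟩`; the entries of a sequence of length `m` are indexed by the
von Neumann numerals `0, …, m - 1`. -/
@[reducible] def gameStructure (α : Ordinal.{u}) (X Y : List (Set (VDom α))) (A : Set (VDom α)) :
    gameLang.Structure (VDom α) where
  funMap := fun f => f.elim
  RelMap := fun r v =>
    match r, v with
    | .mem, v => (v 0).1 ∈ (v 1).1
    | .par, v => v 0 ∈ A
    | .domX, v => ∃ k < X.length, (v 0).1 = Ordinal.toZFSet (k : Ordinal.{u})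
    | .entryX, v => ∃ k < X.length, (v 0).1 = Ordinal.toZFSet (k : Ordinal.{u}) ∧ v 1 ∈ X.getD k ∅
    | .domY, v => ∃ k < Y.length, (v 0).1 = Ordinal.toZFSet (k : Ordinal.{u})
    | .entryY, v => ∃ k < Y.length, (v 0).1 = Ordinal.toZFSet (k : Ordinal.{u}) ∧ v 1 ∈ Y.getD k ∅

/-- `φ(X⃗, Y⃗, A)` holds over `V_α`, for a first order `φ`. -/
def MatrixHolds (α : Ordinal.{u}) (φ : gameLang.Sentence) (A : Set (VDom α))
    (X Y : List (Set (VDom α))) : Prop :=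
  @FirstOrder.Language.Sentence.Realize gameLang (VDom α) (gameStructure α X Y A) φ

/-- Player `Π` has a winning strategy in the even game over `V_α` from the position in which the
sets `X⃗`, `Y⃗` have been played, the last ordinal played is `δ`, and `Σ` is to move: `Σ` plays an odd
ordinal `ε < δ` and a set `Z`, then `Π` plays a set `W` such that `φ(X⃗⌢Z, Y⃗⌢W, A)` holds; the first
player who is unable to move loses. -/
def PiWinsEven (α : Ordinal.{u}) (φ : gameLang.Sentence) (A : Set (VDom α)) (δ : Ordinal.{u}) :
    List (Set (VDom α)) → List (Set (VDom α)) → Prop :=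
  fun X Y =>
    ∀ ε, ∀ _h : ε < δ, IsOddOrdinal ε → ∀ Z : Set (VDom α), ∃ W : Set (VDom α),
      MatrixHolds α φ A (X ++ [Z]) (Y ++ [W]) ∧ PiWinsEven α φ A ε (X ++ [Z]) (Y ++ [W])
termination_by δ

/-- Player `Π` has a winning strategy in the odd game over `V_α` from the position in which the
sets `X⃗`, `Y⃗` have been played, the last ordinal played is `δ`, and `Σ` is to move: `Σ` plays a set
`W` such that `φ(X⃗, Y⃗⌢W, A)` holds, then `Π` plays an odd ordinal `ε < δ` and a set `Z`; the first
player who is unable to move loses. -/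
def PiWinsOdd (α : Ordinal.{u}) (φ : gameLang.Sentence) (A : Set (VDom α)) (δ : Ordinal.{u}) :
    List (Set (VDom α)) → List (Set (VDom α)) → Prop :=
  fun X Y =>
    ∀ W : Set (VDom α), MatrixHolds α φ A X (Y ++ [W]) →
      ∃ ε, ∃ _h : ε < δ, IsOddOrdinal ε ∧ ∃ Z : Set (VDom α),
        PiWinsOdd α φ A ε (X ++ [Z]) (Y ++ [W])
termination_by δ

/-- Player `Π` wins the game `G_γ(α, φ, A)`. -/
def PiWins (γ α : Ordinal.{u}) (φ : gameLang.Sentence) (A : Set (VDom α)) : Prop :=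
  (IsOddOrdinal γ → PiWinsOdd α φ A γ [] []) ∧ (¬ IsOddOrdinal γ → PiWinsEven α φ A γ [] [])

/-- `κ` is `Π¹_γ`-indescribable for an ordinal `γ`: whenever `Π` wins `G_γ(κ, φ, A)` with
`A ⊆ V_κ`, then `Π` wins `G_γ(α, φ, A ∩ V_α)` for some `α < κ`. -/
def IsIndescribable (γ : Ordinal.{u}) (κ : Cardinal.{u}) : Prop :=
  ∀ (φ : gameLang.Sentence) (A : Set ZFSet.{u}),
    (∀ x ∈ A, x ∈ ZFSet.vonNeumann κ.ord) →
    PiWins γ κ.ord φ (restrict A κ.ord) →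
    ∃ α < κ.ord, PiWins γ α φ (restrict A α)

end HigherStat

/-! All three parts rest on two properties of `κ`: `BranchProperty κ`, a form of weak compactness,
and the `κ`-completeness of the filter generated by the `γ`-clubs. Given both,
`splits_of_branchProperty` performs the splitting.

Halving (`IsStationary.exists_halving`): suppose a `(γ+1)`-stationary `S` is not the union of two
disjoint such sets. Then the `γ`-clubs restricted to `S` generate a `κ`-complete ultrafilter `U`.
Let `f` be least modulo `U` among the functions above all constants below `κ`, so that `f` pushes
`U` to a normal measure `W`. Normality lets `η`-stationarity pass between `κ` and `W`-almost every
`ξ` (`stationary_transfer`); hence `γ`-clubs lie in `W` and are closed under diagonal intersections.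
If `f x < x` almost everywhere, a diagonal intersection gives a Fodor-type contradiction. Otherwise
`f` is the identity almost everywhere, so `S` is `(γ+1)`-stationary in almost all its points. But
the points of `S` where this fails form a `(γ+1)`-stationary set (`IsStationary.nonreflecting`),
which is absurd.

Splitting: iterate the halving along a binary tree of subsets of `S`. A level `α < κ` has at most `2
^ |α| < κ` nodes and they cover `S`, so completeness makes one of them stationary. The branch
property threads these nodes into a branch of length `κ` all of whose nodes are stationary, and the
halves discarded along it are the `κ` disjoint pieces.

Indescribability: `ReflectsGames` isolates what both versions of indescribability provide, namely
downward reflection of games of rank `γ` with first order definable moves. A one-move game about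
branches yields the branch property. That given sets are `γ`-stationary is also expressed by such a
game: the players alternately refute each other's claims, with witnesses claimed to be stationary of
smaller order. Reflecting it makes fewer than `κ` many `γ`-stationary sets reflect at one common
point, which gives completeness. -/

namespace HigherStat

/-! ### Basic theory of higher stationary sets and clubs. -/

theorem isStationary_iff {γ κ : Ordinal.{u}} {S : Set Ordinal.{u}} :
    IsStationary γ κ S ↔ Order.IsSuccLimit κ ∧ (γ = 0 → UnboundedIn κ S) ∧
      ∀ η < γ, IsReflecting η κ ∧ ∀ C, IsGClub η κ C → (S ∩ C).Nonempty := by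
  rw [IsStationary]; rfl

theorem IsStationary.isSuccLimit {γ κ : Ordinal.{u}} {S : Set Ordinal.{u}}
    (h : IsStationary γ κ S) : Order.IsSuccLimit κ :=
  (isStationary_iff.1 h).1

theorem IsStationary.isReflecting {γ η κ : Ordinal.{u}} {S : Set Ordinal.{u}}
    (h : IsStationary γ κ S) (hη : η < γ) : IsReflecting η κ :=
  ((isStationary_iff.1 h).2.2 η hη).1

theorem IsStationary.inter_nonempty {γ η κ : Ordinal.{u}} {S C : Set Ordinal.{u}}
    (h : IsStationary γ κ S) (hη : η < γ) (hC : IsGClub η κ C) : (S ∩ C).Nonempty :=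
  ((isStationary_iff.1 h).2.2 η hη).2 C hC

theorem isStationary_zero {κ : Ordinal.{u}} {S : Set Ordinal.{u}} :
    IsStationary 0 κ S ↔ Order.IsSuccLimit κ ∧ UnboundedIn κ S := by
  rw [isStationary_iff]
  simp

/-- Stationarity in `κ` only depends on the part of the set below `κ`. -/
theorem IsStationary.mono_set {γ κ : Ordinal.{u}} {S T : Set Ordinal.{u}}
    (h : IsStationary γ κ S) (hST : ∀ x ∈ S, x < κ → x ∈ T) : IsStationary γ κ T := by
  rw [isStationary_iff] at h ⊢
  refine ⟨h.1, fun h0 β hβ => ?_, fun η hη => ⟨(h.2.2 η hη).1, fun C hC => ?_⟩⟩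
  · obtain ⟨s, hs, h1, h2⟩ := h.2.1 h0 β hβ
    exact ⟨s, hST s hs h2, h1, h2⟩
  · obtain ⟨x, hx, hxC⟩ := (h.2.2 η hη).2 C hC
    exact ⟨x, hST x hx (hC.1 hxC), hxC⟩

theorem isGClub_zero_Ioo {κ β : Ordinal.{u}} (hκ : Order.IsSuccLimit κ) (hβ : β < κ) :
    IsGClub 0 κ (Ioo β κ) := by
  refine ⟨fun x hx => hx.2, isStationary_zero.2 ⟨hκ, fun δ hδ => ?_⟩, fun α hα h => ?_⟩
  · exact ⟨Order.succ (max β δ), ⟨(le_max_left _ _).trans_lt (Order.lt_succ _),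
      hκ.succ_lt (max_lt hβ hδ)⟩, (le_max_right _ _).trans_lt (Order.lt_succ _),
      hκ.succ_lt (max_lt hβ hδ)⟩
  · obtain ⟨s, hs, -, h2⟩ := (isStationary_zero.1 h).2 0 h.isSuccLimit.bot_lt
    exact ⟨hs.1.trans h2, hα⟩

theorem IsStationary.unboundedIn {γ κ : Ordinal.{u}} {S : Set Ordinal.{u}}
    (h : IsStationary γ κ S) : UnboundedIn κ S := by
  rcases eq_or_ne γ 0 with rfl | h0
  · exact (isStationary_zero.1 h).2
  · intro β hβ
    obtain ⟨x, hx, hx'⟩ := h.inter_nonempty (pos_iff_ne_zero.2 h0)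
      (isGClub_zero_Ioo h.isSuccLimit hβ)
    exact ⟨x, hx, hx'.1, hx'.2⟩

theorem IsStationary.mono {γ η κ : Ordinal.{u}} {S : Set Ordinal.{u}}
    (h : IsStationary γ κ S) (hη : η ≤ γ) : IsStationary η κ S :=
  isStationary_iff.2 ⟨h.isSuccLimit, fun _ => h.unboundedIn, fun _ hη' =>
    ⟨h.isReflecting (hη'.trans_le hη), fun _ hC => h.inter_nonempty (hη'.trans_le hη) hC⟩⟩

theorem IsStationary.nonempty {γ κ : Ordinal.{u}} {S : Set Ordinal.{u}}
    (h : IsStationary γ κ S) : ∃ x ∈ S, x < κ := by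
  obtain ⟨s, hs, -, h2⟩ := h.unboundedIn 0 h.isSuccLimit.bot_lt
  exact ⟨s, hs, h2⟩

theorem IsGClub.restrict {η κ ξ : Ordinal.{u}} {C : Set Ordinal.{u}} (hC : IsGClub η κ C)
    (hξ : ξ ≤ κ) (h : IsStationary η ξ C) : IsGClub η ξ (C ∩ Iio ξ) := by
  refine ⟨fun x hx => hx.2, h.mono_set fun x hx hxξ => ⟨hx, hxξ⟩, fun α hα hs => ⟨?_, hα⟩⟩
  exact hC.2.2 α (hα.trans_le hξ) (hs.mono_set fun x hx _ => hx.1)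

/-- The three claims support each other and are proved by one induction on `γ`. Two clubs of orders
`η, η' < γ` are both clubs of order `max η η'`, so by induction they meet in a club of that order;
this is `key`. -/
theorem isGClub_stationarity_aux {κ : Ordinal.{u}} (hκ : Order.IsSuccLimit κ) (γ : Ordinal.{u}) :
    (∀ η < γ, IsReflecting η κ) →
    (∀ η ≤ γ, ∀ C, IsGClub η κ C → IsGClub γ κ C) ∧
    (∀ η < γ, ∀ C S, IsGClub η κ C → IsStationary γ κ S → IsStationary γ κ (S ∩ C)) ∧
    (IsReflecting γ κ → ∀ C D, IsGClub γ κ C → IsGClub γ κ D → IsGClub γ κ (C ∩ D)) := by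
  induction γ using WellFoundedLT.induction with
  | ind γ ih =>
  intro hr
  have key : ∀ η < γ, ∀ η' < γ, ∀ C D, IsGClub η κ C → IsGClub η' κ D →
      IsGClub (max η η') κ (C ∩ D) := by
    intro η hη η' hη' C D hC hD
    have hm : max η η' < γ := max_lt hη hη'
    have h := ih _ hm fun _ hx => hr _ (hx.trans hm)
    exact h.2.2 (hr _ hm) C D (h.1 _ (le_max_left _ _) C hC) (h.1 _ (le_max_right _ _) D hD)
  have hb : ∀ η < γ, ∀ C S, IsGClub η κ C → IsStationary γ κ S → IsStationary γ κ (S ∩ C) := by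
    intro η hη C S hC hS
    refine isStationary_iff.2 ⟨hκ, fun h0 => ?_, fun η' hη' => ⟨hr _ hη', fun D hD => ?_⟩⟩
    · exact absurd (h0 ▸ hη) not_lt_zero
    · rw [inter_assoc]
      exact hS.inter_nonempty (max_lt hη hη') (key η hη η' hη' C D hC hD)
  refine ⟨fun η hη C hC => ?_, hb, fun hrγ C D hC hD => ?_⟩
  · rcases hη.eq_or_lt with rfl | hη
    · exact hC
    refine ⟨hC.1, isStationary_iff.2 ⟨hκ, fun h0 => ?_, fun η' hη' => ⟨hr _ hη', fun D hD => ?_⟩⟩,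
      fun α hα h => hC.2.2 α hα (h.mono hη.le)⟩
    · exact absurd (h0 ▸ hη) not_lt_zero
    · obtain ⟨x, hx, -⟩ := (key η hη η' hη' C D hC hD).2.1.nonempty
      exact ⟨x, hx⟩
  · refine ⟨fun x hx => hC.1 hx.1, ?_, fun α hα h => ⟨hC.2.2 α hα (h.mono_set fun x hx _ => hx.1),
      hD.2.2 α hα (h.mono_set fun x hx _ => hx.2)⟩⟩
    refine isStationary_iff.2 ⟨hκ, fun h0 β hβ => ?_, fun η hη => ⟨hr _ hη, fun E hE => ?_⟩⟩
    · subst h0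
      have h1 : IsStationary 0 κ (C ∩ Ioo β κ) := by
        refine isStationary_zero.2 ⟨hκ, fun δ hδ => ?_⟩
        obtain ⟨s, hs, h1, h2⟩ := hC.2.1.unboundedIn _ (max_lt hβ hδ)
        exact ⟨s, ⟨hs, (le_max_left _ _).trans_lt h1, h2⟩, (le_max_right _ _).trans_lt h1, h2⟩
      obtain ⟨α, hα, h2, h3⟩ := hrγ _ (fun x hx => hC.1 hx.1) _ hD.1 h1 hD.2.1
      obtain ⟨x, hx, hxα⟩ := IsStationary.nonempty h2
      exact ⟨α, ⟨hC.2.2 α hα (IsStationary.mono_set h2 fun x hx _ => hx.1), hD.2.2 α hα h3⟩,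
        hx.2.1.trans hxα, hα⟩
    -- A point at which `C ∩ E` and `D` reflect simultaneously lies in all three sets by closure.
    · have h1 : IsStationary γ κ (C ∩ E) := hb η hη E C hE hC.2.1
      obtain ⟨α, hα, h2, h3⟩ := hrγ _ (fun x hx => hC.1 hx.1) _ hD.1 h1 hD.2.1
      exact ⟨α, ⟨hC.2.2 α hα (IsStationary.mono_set h2 fun x hx _ => hx.1), hD.2.2 α hα h3⟩,
        hE.2.2 α hα ((IsStationary.mono_set h2 fun x hx _ => hx.2).mono hη.le)⟩

theorem IsGClub.mono {γ η κ : Ordinal.{u}} {C : Set Ordinal.{u}} (hκ : Order.IsSuccLimit κ)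
    (hr : ∀ η < γ, IsReflecting η κ) (hη : η ≤ γ) (hC : IsGClub η κ C) : IsGClub γ κ C :=
  (isGClub_stationarity_aux hκ γ hr).1 η hη C hC

theorem IsStationary.inter_isGClub {γ η κ : Ordinal.{u}} {C S : Set Ordinal.{u}}
    (hS : IsStationary γ κ S) (hη : η < γ) (hC : IsGClub η κ C) : IsStationary γ κ (S ∩ C) :=
  (isGClub_stationarity_aux hS.isSuccLimit γ fun _ h => hS.isReflecting h).2.1 η hη C S hC hS

theorem IsGClub.inter {γ κ : Ordinal.{u}} {C D : Set Ordinal.{u}}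
    (hr : IsReflecting γ κ) (hC : IsGClub γ κ C) (hD : IsGClub γ κ D) : IsGClub γ κ (C ∩ D) :=
  (isGClub_stationarity_aux hC.2.1.isSuccLimit γ fun _ h => hC.2.1.isReflecting h).2.2 hr C D hC hD

theorem isGClub_Ioo {γ κ β : Ordinal.{u}} (hκ : Order.IsSuccLimit κ)
    (hr : ∀ η < γ, IsReflecting η κ) (hβ : β < κ) : IsGClub γ κ (Ioo β κ) :=
  (isGClub_zero_Ioo hκ hβ).mono hκ hr zero_le

/-- Testing against `γ`-clubs suffices, because clubs of smaller order are `γ`-clubs. -/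
theorem isStationary_add_one_iff {γ κ : Ordinal.{u}} {S : Set Ordinal.{u}} :
    IsStationary (γ + 1) κ S ↔ Order.IsSuccLimit κ ∧ (∀ η ≤ γ, IsReflecting η κ) ∧
      ∀ C, IsGClub γ κ C → (S ∩ C).Nonempty := by
  constructor
  · intro h
    exact ⟨h.isSuccLimit, fun η hη => h.isReflecting (Order.lt_add_one_iff.2 hη),
      fun C hC => h.inter_nonempty (Order.lt_add_one_iff.2 le_rfl) hC⟩
  · rintro ⟨h1, h2, h3⟩
    refine isStationary_iff.2 ⟨h1, fun h0 => ?_, fun η hη => ?_⟩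
    · exact absurd h0 (by simp)
    · rw [Order.lt_add_one_iff] at hη
      exact ⟨h2 η hη, fun C hC => h3 C (hC.mono h1 (fun η hη => h2 η hη.le) hη)⟩

/-- The set of points at which a `γ`-stationary set reflects is `γ`-stationary. -/
theorem IsStationary.derived {γ κ : Ordinal.{u}} {S : Set Ordinal.{u}} (hS : IsStationary γ κ S)
    (hr : IsReflecting γ κ) : IsStationary γ κ {α | α < κ ∧ IsStationary γ α S} := by
  refine isStationary_iff.2 ⟨hS.isSuccLimit, fun h0 β hβ => ?_,
    fun η hη => ⟨hS.isReflecting hη, fun C hC => ?_⟩⟩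
  · subst h0
    have h1 : IsStationary 0 κ (S ∩ Ioo β κ) := by
      refine isStationary_zero.2 ⟨hS.isSuccLimit, fun δ hδ => ?_⟩
      obtain ⟨s, hs, h1, h2⟩ := hS.unboundedIn _ (max_lt hβ hδ)
      exact ⟨s, ⟨hs, (le_max_left _ _).trans_lt h1, h2⟩, (le_max_right _ _).trans_lt h1, h2⟩
    obtain ⟨α, hα, h2, -⟩ := hr _ (fun x hx => hx.2.2) _ (fun x hx => hx.2.2) h1 h1
    obtain ⟨x, hx, hxα⟩ := IsStationary.nonempty h2
    exact ⟨α, ⟨hα, IsStationary.mono_set h2 fun x hx _ => hx.1⟩, hx.2.1.trans hxα, hα⟩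
  · have h1 := hS.inter_isGClub hη hC
    obtain ⟨α, hα, h2, -⟩ := hr _ (fun x hx => hC.1 hx.2) _ (fun x hx => hC.1 hx.2) h1 h1
    exact ⟨α, ⟨hα, IsStationary.mono_set h2 fun x hx _ => hx.1⟩,
      hC.2.2 α hα ((IsStationary.mono_set h2 fun x hx _ => hx.2).mono hη.le)⟩

theorem IsGClub.derived {γ κ : Ordinal.{u}} {C : Set Ordinal.{u}} (hC : IsGClub γ κ C)
    (hr : IsReflecting γ κ) : IsGClub γ κ {α | α < κ ∧ IsStationary γ α C} :=
  ⟨fun _ hx => hx.1, hC.2.1.derived hr, fun _ hα h => ⟨hα, h.mono_set fun x hx _ =>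
    hC.2.2 x hx.1 hx.2⟩⟩

theorem _root_.Cardinal.IsRegular.exists_forall_le {κ : Cardinal.{u}} (hκ : κ.IsRegular)
    {α : Ordinal.{u}} (hα : α.card < κ) (f : Iio α → Ordinal.{u}) (hf : ∀ i, f i < κ.ord) :
    ∃ η < κ.ord, ∀ i, f i ≤ η := by
  refine ⟨⨆ i, f i, Ordinal.lift_iSup_lt_of_lt_cof ?_ hf, fun i => ?_⟩
  · rw [← Ordinal.lift_cof, hκ.cof_ord]
    simpa only [Cardinal.mk_Iio_ordinal, Cardinal.lift_lift, Cardinal.lift_lt] using hα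
  · exact le_ciSup Ordinal.bddAbove_of_small i

/-! ### Bounds on the order of stationarity. -/

/-- The order of stationarity of an ordinal is less than its cardinal successor. -/
theorem not_isStationary_succ_card (α : Ordinal.{u}) (S : Set Ordinal.{u}) :
    ¬ IsStationary (Order.succ α.card).ord α S := by
  induction α using WellFoundedLT.induction with
  | ind α ih =>
  intro h
  have hinf : Cardinal.aleph0 ≤ α.card :=
    Ordinal.aleph0_le_card.2 (Ordinal.omega0_le_of_isSuccLimit h.isSuccLimit)
  have hreg : (Order.succ α.card).IsRegular := Cardinal.isRegular_succ hinf
  set μ := (Order.succ α.card).ord with hμ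
  have hμlim : Order.IsSuccLimit μ := Cardinal.isSuccLimit_ord hreg.aleph0_le
  -- Since `μ` is a limit, being stationary in `β` of every order below `μ` would give order `μ`,
  -- which is at least the cardinal successor of `|β|`. Regularity of `μ` then bounds the failing
  -- orders by one `η < μ`, and `η`-reflection of `α` produces a `β` that violates it.
  have hex : ∀ β : Iio α, ∃ η < μ, ¬ IsStationary η β S := by
    rintro ⟨β, hβ⟩
    by_contra! hcon
    have hle : (Order.succ β.card).ord ≤ μ :=
      Cardinal.ord_le_ord.2 (Order.succ_le_succ (Ordinal.card_le_card (le_of_lt hβ)))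
    refine ih β hβ (IsStationary.mono (isStationary_iff.2 ⟨?_, ?_, ?_⟩) hle)
    · exact (hcon 0 hμlim.bot_lt).isSuccLimit
    · intro _; exact (hcon 0 hμlim.bot_lt).unboundedIn
    · intro η hη
      have := hcon _ (hμlim.succ_lt hη)
      exact ⟨this.isReflecting (Order.lt_succ _), fun C hC =>
        this.inter_nonempty (Order.lt_succ _) hC⟩
  choose f hf hf' using hex
  obtain ⟨η, hη, hfη⟩ := hreg.exists_forall_le (Order.lt_succ _) f hf
  have hs : IsStationary η α (S ∩ Iio α) := (h.mono hη.le).mono_set fun x hx h => ⟨hx, h⟩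
  obtain ⟨β, hβ, h1, -⟩ := h.isReflecting hη _ inter_subset_right _ inter_subset_right hs hs
  exact hf' ⟨β, hβ⟩ ((IsStationary.mono_set h1 fun x hx _ => hx.1).mono (hfη ⟨β, hβ⟩))

/-- If `γ ≥ κ`, reflection would give a set `γ`-stationary in some `β < κ`, although the cardinal
successor of `|β|` is at most `κ`. This bound lets `κ`-completeness handle all orders up to `γ` at
once. -/
theorem IsStationary.lt_ord {κ : Cardinal.{u}} {γ : Ordinal.{u}} {S : Set Ordinal.{u}}
    (h : IsStationary (γ + 1) κ.ord S) : γ < κ.ord := by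
  by_contra! hγ
  have hs : IsStationary γ κ.ord (S ∩ Iio κ.ord) :=
    (h.mono le_self_add).mono_set fun x hx h => ⟨hx, h⟩
  obtain ⟨β, hβ, h1, -⟩ := h.isReflecting (Order.lt_add_one_iff.2 le_rfl) _ inter_subset_right _
    inter_subset_right hs hs
  refine not_isStationary_succ_card β _ (IsStationary.mono h1 (le_trans ?_ hγ))
  exact Cardinal.ord_le_ord.2 (Order.succ_le_of_lt (Cardinal.lt_ord.1 hβ))

theorem IsStationary.aleph0_lt {κ : Cardinal.{u}} {γ : Ordinal.{u}} {S : Set Ordinal.{u}}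
    (h : IsStationary (γ + 1) κ.ord S) : Cardinal.aleph0 < κ := by
  have hs : IsStationary γ κ.ord (S ∩ Iio κ.ord) :=
    (h.mono le_self_add).mono_set fun x hx h => ⟨hx, h⟩
  obtain ⟨β, hβ, h1, -⟩ := h.isReflecting (Order.lt_add_one_iff.2 le_rfl) _ inter_subset_right _
    inter_subset_right hs hs
  have := (Ordinal.omega0_le_of_isSuccLimit (IsStationary.isSuccLimit h1)).trans_lt hβ
  rwa [Cardinal.lt_ord, Ordinal.card_omega0] at this

/-! ### Weak compactness and the branch property. -/

/-- Every `κ`-sequence of subsets of `κ` has a cofinal branch: a set all of whose proper initial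
segments are initial segments of arbitrarily late terms of the sequence. -/
def BranchProperty (κ : Cardinal.{u}) : Prop :=
  ∀ t : Ordinal.{u} → Set Ordinal.{u}, ∃ b : Set Ordinal.{u}, ∀ β < κ.ord,
    ∃ α < κ.ord, β ≤ α ∧ t α ∩ Iio β = b ∩ Iio β

theorem exists_mem_ge_of_mk_eq {κ : Cardinal.{u}} {H : Set Ordinal.{u}}
    (hH : Cardinal.mk H = Cardinal.lift.{u + 1} κ) {β : Ordinal.{u}} (hβ : β < κ.ord) :
    ∃ h ∈ H, β ≤ h := by
  by_contra! hcon
  have h1 : Cardinal.mk H ≤ Cardinal.mk (Iio β) := Cardinal.mk_le_mk_of_subset hcon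
  rw [hH, Cardinal.mk_Iio_ordinal, Cardinal.lift_le] at h1
  exact absurd (Cardinal.lt_ord.1 hβ) (not_lt.2 h1)

/-- Map each `a` to an element `g a ≥ a` of a short cofinal set and colour pairs by whether their
values agree. On a homogeneous set `g` is either constant, against `a ≤ g a`, or injective, against
the size of the cofinal set. -/
theorem IsWeaklyCompact.isRegular {κ : Cardinal.{u}} (hκ : IsWeaklyCompact κ) : κ.IsRegular := by
  refine ⟨hκ.1.le, ?_⟩
  by_contra! hcof
  obtain ⟨s, hs, hsc⟩ := Order.exists_cof_eq (α := Iio κ.ord)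
  rw [Ordinal.cof_Iio, ← Ordinal.lift_cof] at hsc
  have hex : ∀ a : Ordinal.{u}, ∃ c : Iio κ.ord, a < κ.ord → c ∈ s ∧ a ≤ c := by
    intro a
    by_cases ha : a < κ.ord
    · obtain ⟨c, hc, hac⟩ := hs ⟨a, ha⟩
      exact ⟨c, fun _ => ⟨hc, hac⟩⟩
    · exact ⟨⟨0, Cardinal.ord_pos.2 (Cardinal.aleph0_pos.trans hκ.1)⟩, fun h => absurd h ha⟩
  choose g hg using hex
  classical
  obtain ⟨H, hH, hcard, c, hc⟩ := hκ.2 fun a b => if g a = g b then 0 else 1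
  by_cases h0 : c = 0
  · subst h0
    obtain ⟨h, hh, -⟩ := exists_mem_ge_of_mk_eq hcard
      (Cardinal.ord_pos.2 (Cardinal.aleph0_pos.trans hκ.1))
    have hlim := Cardinal.isSuccLimit_ord hκ.1.le
    obtain ⟨h', hh', hle⟩ := exists_mem_ge_of_mk_eq hcard
      (hlim.succ_lt (max_lt (hH hh) (g h).2))
    have hlt := Order.succ_le_iff.1 hle
    have := hc h hh h' hh' ((le_max_left _ _).trans_lt hlt)
    simp only [ite_eq_left_iff, one_ne_zero, imp_false, not_not] at this
    have h3 := (hg h' (hH hh')).2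
    rw [← this] at h3
    exact absurd ((le_max_right _ _).trans_lt hlt) (not_lt.2 h3)
  · have hinj : Function.Injective fun x : H => (⟨g x, (hg x (hH x.2)).1⟩ : s) := by
      intro x y hxy
      simp only [Subtype.mk.injEq] at hxy
      by_contra hne
      have hne' : (x : Ordinal) ≠ y := fun h => hne (Subtype.ext h)
      rcases lt_or_gt_of_ne hne' with h | h
      · exact h0 (by rw [← hc x x.2 y y.2 h, if_pos hxy])
      · exact h0 (by rw [← hc y y.2 x x.2 h, if_pos hxy.symm])
    have := Cardinal.mk_le_of_injective hinj
    rw [hcard, hsc, Cardinal.lift_le] at this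
    exact absurd hcof (not_lt.2 this)

/-- The lexicographic order on sets of ordinals. -/
def LexLE (s t : Set Ordinal.{u}) : Prop :=
  s = t ∨ ∃ δ, s ∩ Iio δ = t ∩ Iio δ ∧ δ ∉ s ∧ δ ∈ t

theorem LexLE.compl_of_not {s t : Set Ordinal.{u}} (h : ¬ LexLE s t) : LexLE sᶜ tᶜ := by
  rw [LexLE, not_or] at h
  obtain ⟨hne, h⟩ := h
  push Not at h
  have hex : ∃ δ, ¬ (δ ∈ s ↔ δ ∈ t) := by
    by_contra! hcon
    exact hne (Set.ext hcon)
  have hmin := fun δ => WellFounded.not_lt_min (wellFounded_lt (α := Ordinal.{u}))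
    {δ | ¬ (δ ∈ s ↔ δ ∈ t)} (x := δ)
  have hmem := WellFounded.min_mem (wellFounded_lt (α := Ordinal.{u}))
    {δ | ¬ (δ ∈ s ↔ δ ∈ t)} hex
  set δ := WellFounded.min (wellFounded_lt (α := Ordinal.{u})) {δ | ¬ (δ ∈ s ↔ δ ∈ t)} hex
  have hag : ∀ x < δ, (x ∈ s ↔ x ∈ t) := fun x hx => by
    by_contra hcon
    exact hmin x hcon hx
  right
  refine ⟨δ, ?_, ?_, ?_⟩
  · ext x
    simp only [mem_inter_iff, mem_compl_iff, mem_Iio, and_congr_left_iff]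
    intro hx
    rw [hag x hx]
  all_goals
    have := h δ (by ext x; simp only [mem_inter_iff, mem_Iio, and_congr_left_iff]; exact hag x)
    simp only [mem_ofPred_eq] at hmem
    simp only [mem_compl_iff, not_not]
    tauto

/-- In a lexicographically increasing sequence every coordinate is eventually constant: once the
coordinates below `δ` have settled, membership of `δ` can change only from false to true. Regularity
bounds the settling times below any `β < κ`, and the eventual values form the branch. -/
theorem exists_branch_of_lexLE {κ : Cardinal.{u}} (hκ : κ.IsRegular) {H : Set Ordinal.{u}}
    (hHκ : H ⊆ Iio κ.ord) (hH : ∀ β < κ.ord, ∃ h ∈ H, β ≤ h) (t : Ordinal.{u} → Set Ordinal.{u})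
    (hlex : ∀ a ∈ H, ∀ b ∈ H, a < b → LexLE (t a) (t b)) :
    ∃ b : Set Ordinal.{u}, ∀ β < κ.ord, ∃ α < κ.ord, β ≤ α ∧ t α ∩ Iio β = b ∩ Iio β := by
  have hconst : ∀ δ < κ.ord, ∃ ν < κ.ord, ∀ a ∈ H, ∀ b ∈ H, ν ≤ a → ν ≤ b →
      ∀ x < δ, (x ∈ t a ↔ x ∈ t b) := by
    intro δ
    induction δ using WellFoundedLT.induction with
    | ind δ ih =>
    intro hδ
    have hstep : ∀ δ' : Iio δ, ∃ ν < κ.ord, ∀ a ∈ H, ∀ b ∈ H, ν ≤ a → ν ≤ b →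
        ((δ' : Ordinal) ∈ t a ↔ (δ' : Ordinal) ∈ t b) := by
      rintro ⟨δ', hδ'⟩
      obtain ⟨ν, hν, h⟩ := ih δ' hδ' (lt_trans hδ' hδ)
      by_cases hex : ∃ a ∈ H, ν ≤ a ∧ δ' ∈ t a
      · obtain ⟨a, ha, hνa, hδa⟩ := hex
        have hup : ∀ b ∈ H, a ≤ b → δ' ∈ t b := by
          intro b hb hab
          rcases hab.eq_or_lt with rfl | hab
          · exact hδa
          rcases hlex a ha b hb hab with he | ⟨x, hx, hxa, hxb⟩
          · rwa [← he]
          · rcases lt_trichotomy x δ' with hlt | rfl | hgt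
            · exact absurd ((h a ha b hb hνa (hνa.trans hab.le) x hlt).2 hxb) hxa
            · exact hxb
            · exact (hx.subset ⟨hδa, hgt⟩).1
        exact ⟨a, hHκ ha, fun b hb c hc hab hac => iff_of_true (hup b hb hab) (hup c hc hac)⟩
      · push Not at hex
        exact ⟨ν, hν, fun b hb c hc hb' hc' => iff_of_false (hex b hb hb') (hex c hc hc')⟩
    choose f hf hf' using hstep
    obtain ⟨ν, hν, hle⟩ := hκ.exists_forall_le (Cardinal.lt_ord.1 hδ) f hf
    exact ⟨ν, hν, fun a ha b hb h1 h2 x hx =>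
      hf' ⟨x, hx⟩ a ha b hb ((hle _).trans h1) ((hle _).trans h2)⟩
  refine ⟨{x | ∃ ν < κ.ord, ∀ a ∈ H, ν ≤ a → x ∈ t a}, fun β hβ => ?_⟩
  obtain ⟨ν, hν, h⟩ := hconst β hβ
  obtain ⟨a, ha, hle⟩ := hH _ (max_lt hβ hν)
  refine ⟨a, hHκ ha, (le_max_left _ _).trans hle, ?_⟩
  ext x
  simp only [mem_inter_iff, mem_Iio, mem_ofPred_eq, and_congr_left_iff]
  intro hx
  constructor
  · intro hxa
    exact ⟨ν, hν, fun b hb hνb => (h a ha b hb ((le_max_right _ _).trans hle) hνb x hx).1 hxa⟩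
  · rintro ⟨ν', hν', h'⟩
    obtain ⟨c, hc, hcle⟩ := hH _ (max_lt hν hν')
    exact (h a ha c hc ((le_max_right _ _).trans hle) ((le_max_left _ _).trans hcle) x hx).2
      (h' c hc ((le_max_right _ _).trans hcle))

/-- Colour pairs by lexicographic comparison. A homogeneous set of the second colour becomes
increasing after taking complements. -/
theorem IsWeaklyCompact.branchProperty {κ : Cardinal.{u}} (hκ : IsWeaklyCompact κ) :
    BranchProperty κ := by
  intro t
  classical
  obtain ⟨H, hH, hcard, c, hc⟩ := hκ.2 fun a b => if LexLE (t a) (t b) then 0 else 1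
  have hunb : ∀ β < κ.ord, ∃ h ∈ H, β ≤ h := fun β hβ => exists_mem_ge_of_mk_eq hcard hβ
  by_cases h0 : c = 0
  · subst h0
    refine exists_branch_of_lexLE hκ.isRegular hH hunb t fun a ha b hb hab => ?_
    simpa using hc a ha b hb hab
  · obtain ⟨b, hb⟩ := exists_branch_of_lexLE hκ.isRegular hH hunb (fun a => (t a)ᶜ)
      fun a ha b hb hab => LexLE.compl_of_not fun h => h0 (by rw [← hc a ha b hb hab, if_pos h])
    refine ⟨bᶜ, fun β hβ => ?_⟩
    obtain ⟨α, hα, hle, he⟩ := hb β hβ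
    refine ⟨α, hα, hle, ?_⟩
    ext x
    have := Set.ext_iff.1 he x
    simp only [mem_inter_iff, mem_compl_iff] at this ⊢
    tauto

/-- Otherwise `κ` many distinct subsets of `α` exist, but a branch would make two terms of that
sequence agree below `α`. -/
theorem BranchProperty.two_power_lt {κ : Cardinal.{u}} (hκ : BranchProperty κ)
    (hinf : Cardinal.aleph0 ≤ κ) {α : Ordinal.{u}} (hα : α < κ.ord) :
    (2 : Cardinal.{u}) ^ α.card < κ := by
  by_contra! hle
  have h1 : Cardinal.mk (Iio κ.ord) ≤ Cardinal.mk (Set (Iio α)) := by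
    rw [Cardinal.mk_set, Cardinal.mk_Iio_ordinal, Cardinal.mk_Iio_ordinal, Cardinal.card_ord,
      ← Cardinal.lift_two_power, Cardinal.lift_le]
    exact hle
  obtain ⟨e⟩ := h1
  obtain ⟨b, hb⟩ := hκ fun a => {x | ∃ h : a < κ.ord, ∃ y ∈ e ⟨a, h⟩, (y : Ordinal) = x}
  have hlim := Cardinal.isSuccLimit_ord hinf
  obtain ⟨a, ha, -, hab⟩ := hb α hα
  obtain ⟨a', ha', hle', hab'⟩ := hb _ (max_lt hα (hlim.succ_lt ha))
  have hlt : a < a' := Order.succ_le_iff.1 ((le_max_right _ _).trans hle')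
  have : e ⟨a, ha⟩ = e ⟨a', ha'⟩ := by
    ext ⟨x, hx⟩
    have h2 := Set.ext_iff.1 hab x
    have h3 := Set.ext_iff.1 hab' x
    have hx' : x < max α (Order.succ a) := lt_max_of_lt_left hx
    have hx'' : x < α := hx
    simp only [mem_inter_iff, mem_ofPred_eq, mem_Iio, hx', hx'', and_true, ha, ha',
      exists_true_left, Subtype.exists, exists_and_right, exists_eq_right] at h2 h3
    rw [h2, h3]
  have := e.injective this
  exact hlt.ne (congrArg Subtype.val this)

end HigherStat

/-! ### Normal measures and transfer of stationarity. -/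

namespace HigherStat
open Filter

/-- A `κ`-complete nonprincipal ultrafilter concentrating on `κ`. -/
structure IsMeasure (κ : Cardinal.{u}) (U : Ultrafilter Ordinal.{u}) : Prop where
  complete : ∀ δ < κ.ord, ∀ p : Ordinal.{u} → Ordinal.{u} → Prop,
    (∀ i < δ, ∀ᶠ x in U, p i x) → ∀ᶠ x in U, ∀ i < δ, p i x
  unbounded : ∀ β < κ.ord, ∀ᶠ x in U, β < x
  lt : ∀ᶠ x in U, x < κ.ord

/-- A measure on `κ` that is closed under diagonal intersections. -/
structure IsNormalMeasure (κ : Cardinal.{u}) (U : Ultrafilter Ordinal.{u}) : Prop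
    extends IsMeasure κ U where
  normal : ∀ p : Ordinal.{u} → Ordinal.{u} → Prop,
    (∀ i < κ.ord, ∀ᶠ x in U, p i x) → ∀ᶠ x in U, ∀ i < x, p i x

/-- Countable completeness would turn a decreasing sequence modulo `U` into a genuine one at some
point. -/
theorem IsMeasure.wellFounded {κ : Cardinal.{u}} {U : Ultrafilter Ordinal.{u}}
    (hU : IsMeasure κ U) (hκ : Cardinal.aleph0 < κ) :
    WellFounded fun f g : Ordinal.{u} → Ordinal.{u} => ∀ᶠ x in U, f x < g x := by
  rw [wellFounded_iff_isEmpty_descending_chain]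
  refine ⟨fun ⟨f, hf⟩ => ?_⟩
  have hω : Ordinal.omega0 < κ.ord := by
    rwa [Cardinal.lt_ord, Ordinal.card_omega0]
  have h := hU.complete _ hω (fun i x => ∀ n : ℕ, (n : Ordinal) = i → f (n + 1) x < f n x) (by
    intro i hi
    obtain ⟨n, rfl⟩ := Ordinal.lt_omega0.1 hi
    filter_upwards [hf n] with x hx m hm
    rw [Nat.cast_inj] at hm
    rwa [hm])
  obtain ⟨x, hx⟩ := h.exists
  obtain ⟨n, hn⟩ := (wellFounded_iff_isEmpty_descending_chain.1
    (wellFounded_lt (α := Ordinal.{u}))).false ⟨fun n => f n x, fun n =>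
      hx n (Ordinal.natCast_lt_omega0 n) n rfl⟩

/-- `f` represents the least ordinal of the ultrapower above all constants below `κ`; comparison
with the identity gives `f x ≤ x`. -/
theorem IsMeasure.exists_isNormalMeasure_map {κ : Cardinal.{u}} {U : Ultrafilter Ordinal.{u}}
    (hU : IsMeasure κ U) (hκ : Cardinal.aleph0 < κ) :
    ∃ f : Ordinal.{u} → Ordinal.{u}, IsNormalMeasure κ (U.map f) ∧ ∀ᶠ x in U, f x ≤ x := by
  obtain ⟨f, hf, hmin⟩ := (hU.wellFounded hκ).has_min
    {f | ∀ β < κ.ord, ∀ᶠ x in U, β < f x} ⟨id, hU.unbounded⟩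
  have hle : ∀ᶠ x in U, f x ≤ x := by
    have := hmin id hU.unbounded
    rw [← Ultrafilter.eventually_not] at this
    filter_upwards [this] with x hx
    exact not_lt.1 hx
  have hlim := Cardinal.isSuccLimit_ord hκ.le
  refine ⟨f, ⟨⟨fun δ hδ p hp => hU.complete δ hδ (fun i x => p i (f x)) hp, hf, ?_⟩, ?_⟩, hle⟩
  · change ∀ᶠ x in U, f x < κ.ord
    filter_upwards [hle, hU.lt] with x h1 h2
    exact h1.trans_lt h2
  · intro p hp
    change ∀ᶠ x in U, ∀ i < f x, p i (f x)
    by_contra hcon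
    rw [← Ultrafilter.eventually_not] at hcon
    have hex : ∀ x, ∃ i, ¬ (∀ i < f x, p i (f x)) → i < f x ∧ ¬ p i (f x) := by
      intro x
      by_cases h : ∀ i < f x, p i (f x)
      · exact ⟨0, fun h' => absurd h h'⟩
      · push Not at h
        obtain ⟨i, hi⟩ := h
        exact ⟨i, fun _ => hi⟩
    choose g hg using hex
    have hgf : ∀ᶠ x in U, g x < f x := by
      filter_upwards [hcon] with x hx
      exact (hg x hx).1
    -- `g x` picks a failing index below `f x`. Minimality of `f` bounds `g` by some `β < κ` almost
    -- everywhere, and completeness excludes failures at indices up to `β`.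
    have hgn : ¬ ∀ β < κ.ord, ∀ᶠ x in U, β < g x := fun h => hmin g h hgf
    push Not at hgn
    obtain ⟨β, hβ, hgβ⟩ := hgn
    obtain ⟨x, hx1, hx2, hx3⟩ := (hcon.and ((by simpa using hgβ : ∀ᶠ x in U, g x ≤ β).and
      (hU.complete _ (hlim.succ_lt hβ) (fun i x => p i (f x))
        fun i hi => hp i (hi.trans (hlim.succ_lt hβ))))).exists
    exact (hg x hx1).2 (hx3 _ (Order.lt_succ_iff.2 hx2))

section NormalMeasure

variable {κ : Cardinal.{u}} {W : Ultrafilter Ordinal.{u}}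

theorem IsNormalMeasure.eventually_isSuccLimit (hW : IsNormalMeasure κ W)
    (hκ : Order.IsSuccLimit κ.ord) : ∀ᶠ ξ : Ordinal.{u} in W, Order.IsSuccLimit ξ := by
  have h1 := hW.normal (fun i ξ => Order.succ i < ξ) fun i hi => hW.unbounded _ (hκ.succ_lt hi)
  filter_upwards [h1, hW.unbounded 0 hκ.bot_lt] with ξ h2 h3
  refine ⟨fun h => h3.ne' (by simpa using h), Order.isSuccPrelimit_of_succ_lt h2⟩

/-- Sets chosen in `ξ` for almost all `ξ` are the initial segments of a single set. -/
theorem IsNormalMeasure.eventually_mem_iff (hW : IsNormalMeasure κ W)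
    (A : Ordinal.{u} → Set Ordinal.{u}) :
    ∀ᶠ ξ in W, ∀ i < ξ, (i ∈ {β | ∀ᶠ ξ in W, β ∈ A ξ} ↔ i ∈ A ξ) := by
  refine hW.normal (fun i ξ => i ∈ {β | ∀ᶠ ξ in W, β ∈ A ξ} ↔ i ∈ A ξ) fun i _ => ?_
  by_cases h : ∀ᶠ ξ in W, i ∈ A ξ
  · filter_upwards [h] with ξ hξ
    exact iff_of_true h hξ
  · filter_upwards [Ultrafilter.eventually_not.2 h] with ξ hξ
    exact iff_of_false h hξ

/-- In ultrapower terms, `κ` is represented by the identity and the ultrapower has the same subsets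
of `κ`, so both compute the same stationary sets. Concretely, counterexamples chosen in almost every
`ξ` are glued by `eventually_mem_iff` into a subset of `κ`, whose stationarity of smaller order
comes from the induction hypothesis. Completeness merges the conditions for all `η' < η`, which uses
`η < κ`. -/
theorem IsNormalMeasure.stationary_transfer (hW : IsNormalMeasure κ W)
    (hκ : Order.IsSuccLimit κ.ord) (η : Ordinal.{u}) :
    η < κ.ord → (∀ η' < η, IsReflecting η' κ.ord) → ∀ B,
      IsStationary η κ.ord B ↔ ∀ᶠ ξ in W, IsStationary η ξ B := by
  induction η using WellFoundedLT.induction with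
  | ind η ih =>
  intro hη hr B
  have ih' : ∀ η' < η, ∀ B, IsStationary η' κ.ord B ↔ ∀ᶠ ξ in W, IsStationary η' ξ B :=
    fun η' h => ih η' h (h.trans hη) fun x hx => hr x (hx.trans h)
  have hglue : ∀ η' < η, ∀ A : Ordinal.{u} → Set Ordinal.{u},
      (∀ᶠ ξ in W, IsStationary η' ξ (A ξ)) →
      IsStationary η' κ.ord ({β | ∀ᶠ ξ in W, β ∈ A ξ} ∩ Iio κ.ord) := by
    intro η' hη' A hA
    rw [ih' η' hη']
    filter_upwards [hA, hW.eventually_mem_iff A, hW.lt] with ξ h1 h2 h3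
    exact h1.mono_set fun x hx hxξ => ⟨(h2 x hxξ).2 hx, hxξ.trans h3⟩
  constructor
  · intro hB
    have hlim := hW.eventually_isSuccLimit hκ
    have hunb : ∀ᶠ ξ in W, UnboundedIn ξ B := by
      refine hW.normal (fun i ξ => ∃ s ∈ B, i < s ∧ s < ξ) fun i hi => ?_
      obtain ⟨s, hs, h1, h2⟩ := hB.unboundedIn i hi
      filter_upwards [hW.unbounded s h2] with ξ hξ
      exact ⟨s, hs, h1, hξ⟩
    have hrefl : ∀ᶠ ξ in W, ∀ η' < η, IsReflecting η' ξ := by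
      refine hW.complete η hη _ fun η' hη' => ?_
      by_contra hcon
      rw [← Ultrafilter.eventually_not] at hcon
      have hex : ∀ ξ, ∃ A B, ¬ IsReflecting η' ξ → IsStationary η' ξ A ∧ IsStationary η' ξ B ∧
          ∀ α < ξ, IsStationary η' α A → ¬ IsStationary η' α B := by
        intro ξ
        by_cases h : IsReflecting η' ξ
        · exact ⟨∅, ∅, fun h' => absurd h h'⟩
        · have h' := h
          simp only [IsReflecting, ReflectsFor, not_forall] at h'
          obtain ⟨A, -, B, -, h1, h2, h3⟩ := h'
          exact ⟨A, B, fun _ => ⟨h1, h2, fun α hα h4 h5 => h3 ⟨α, hα, h4, h5⟩⟩⟩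
      choose A D hAD using hex
      have hA := hglue η' hη' A (by filter_upwards [hcon] with ξ hξ using (hAD ξ hξ).1)
      have hD := hglue η' hη' D (by filter_upwards [hcon] with ξ hξ using (hAD ξ hξ).2.1)
      obtain ⟨α, hα, h1, h2⟩ := hr η' hη' _ inter_subset_right _ inter_subset_right hA hD
      obtain ⟨ξ, h3, h4, h5, h6⟩ := (hcon.and ((hW.eventually_mem_iff A).and
        ((hW.eventually_mem_iff D).and (hW.unbounded α hα)))).exists
      exact (hAD ξ h3).2.2 α h6
        (IsStationary.mono_set h1 fun x hx hxα => (h4 x (hxα.trans h6)).1 hx.1)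
        (IsStationary.mono_set h2 fun x hx hxα => (h5 x (hxα.trans h6)).1 hx.1)
    have hclub : ∀ᶠ ξ in W, ∀ η' < η, ∀ C, IsGClub η' ξ C → (B ∩ C).Nonempty := by
      refine hW.complete η hη (fun η' ξ => ∀ C, IsGClub η' ξ C → (B ∩ C).Nonempty)
        fun η' hη' => ?_
      by_contra hcon
      rw [← Ultrafilter.eventually_not] at hcon
      have hex : ∀ ξ, ∃ C, (¬ ∀ C, IsGClub η' ξ C → (B ∩ C).Nonempty) → IsGClub η' ξ C ∧
          ¬ (B ∩ C).Nonempty := by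
        intro ξ
        by_cases h : ∀ C, IsGClub η' ξ C → (B ∩ C).Nonempty
        · exact ⟨∅, fun h' => absurd h h'⟩
        · have h' := h
          simp only [not_forall] at h'
          obtain ⟨C, h1, h2⟩ := h'
          exact ⟨C, fun _ => ⟨h1, h2⟩⟩
      choose C hC using hex
      have hs := hglue η' hη' C (by filter_upwards [hcon] with ξ hξ using (hC ξ hξ).1.2.1)
      -- Closure at `α` is inherited from any `C ξ` with `ξ > α` that agrees with the glued set
      -- below `ξ`.
      have hcl : IsGClub η' κ.ord ({β | ∀ᶠ ξ in W, β ∈ C ξ} ∩ Iio κ.ord) := by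
        refine ⟨inter_subset_right, hs, fun α hα h => ⟨?_, hα⟩⟩
        obtain ⟨ξ, h3, h4, h6⟩ := (hcon.and ((hW.eventually_mem_iff C).and
          (hW.unbounded α hα))).exists
        exact (h4 α h6).2 ((hC ξ h3).1.2.2 α h6
          (IsStationary.mono_set h fun x hx hxα => (h4 x (hxα.trans h6)).1 hx.1))
      obtain ⟨x, hxB, hxC, hxκ⟩ := hB.inter_nonempty hη' hcl
      obtain ⟨ξ, h3, h4, h6⟩ := (hcon.and ((hW.eventually_mem_iff C).and
        (hW.unbounded x hxκ))).exists
      exact (hC ξ h3).2 ⟨x, hxB, (h4 x h6).1 hxC⟩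
    filter_upwards [hlim, hunb, hrefl, hclub] with ξ h1 h2 h3 h4
    exact isStationary_iff.2 ⟨h1, fun _ => h2, fun η' hη' => ⟨h3 η' hη', h4 η' hη'⟩⟩
  · intro hB
    refine isStationary_iff.2 ⟨hκ, fun _ β hβ => ?_, fun η' hη' => ⟨hr η' hη', fun C hC => ?_⟩⟩
    · obtain ⟨ξ, h1, h2, h3⟩ := (hB.and ((hW.unbounded β hβ).and hW.lt)).exists
      obtain ⟨s, hs, h4, h5⟩ := h1.unboundedIn β h2
      exact ⟨s, hs, h4, h5.trans h3⟩
    · obtain ⟨ξ, h1, h2, h3⟩ := (hB.and (((ih' η' hη' C).1 hC.2.1).and hW.lt)).exists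
      obtain ⟨x, hx, hxC, -⟩ := h1.inter_nonempty hη' (hC.restrict h3.le h2)
      exact ⟨x, hx, hxC⟩

/-- A `γ`-club is `γ`-stationary in almost every `ξ` by transfer, hence contains `ξ` by closure. -/
theorem IsNormalMeasure.eventually_mem_isGClub (hW : IsNormalMeasure κ W) {γ : Ordinal.{u}}
    (hγ : γ < κ.ord) {C : Set Ordinal.{u}} (hC : IsGClub γ κ.ord C) : ∀ᶠ ξ in W, ξ ∈ C := by
  filter_upwards [(hW.stationary_transfer hC.2.1.isSuccLimit γ hγ
    (fun η hη => hC.2.1.isReflecting hη) C).1 hC.2.1, hW.lt] with ξ h1 h2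
  exact hC.2.2 ξ h2 h1

theorem IsNormalMeasure.isStationary_of_eventually_mem (hW : IsNormalMeasure κ W)
    (hκ : Order.IsSuccLimit κ.ord) {γ : Ordinal.{u}} (hγ : γ < κ.ord)
    (hr : ∀ η < γ, IsReflecting η κ.ord) {X : Set Ordinal.{u}} (hX : ∀ᶠ ξ in W, ξ ∈ X) :
    IsStationary γ κ.ord X := by
  refine isStationary_iff.2 ⟨hκ, fun _ β hβ => ?_, fun η hη => ⟨hr η hη, fun C hC => ?_⟩⟩
  · obtain ⟨ξ, h1, h2, h3⟩ := (hX.and ((hW.unbounded β hβ).and hW.lt)).exists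
    exact ⟨ξ, h1, h2, h3⟩
  · exact (hX.and (hW.eventually_mem_isGClub (hη.trans hγ) hC)).exists

/-- The diagonal intersection of `γ`-clubs is a `γ`-club if there is a normal measure. -/
theorem IsNormalMeasure.isGClub_diag (hW : IsNormalMeasure κ W) (hκ : Order.IsSuccLimit κ.ord)
    {γ : Ordinal.{u}} (hγ : γ < κ.ord) (hr : ∀ η < γ, IsReflecting η κ.ord)
    {C : Ordinal.{u} → Set Ordinal.{u}} (hC : ∀ i < κ.ord, IsGClub γ κ.ord (C i)) :
    IsGClub γ κ.ord {ξ | ξ < κ.ord ∧ ∀ i < ξ, ξ ∈ C i} := by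
  refine ⟨fun _ h => h.1, hW.isStationary_of_eventually_mem hκ hγ hr ?_, fun α hα h =>
    ⟨hα, fun i hi => (hC i (hi.trans hα)).2.2 α hα ?_⟩⟩
  · exact hW.lt.and (hW.normal (fun i ξ => ξ ∈ C i) fun i hi =>
      hW.eventually_mem_isGClub hγ (hC i hi))
  · have h' : IsStationary γ α ({ξ | ξ < κ.ord ∧ ∀ i < ξ, ξ ∈ C i} ∩ Ioo i α) := by
      rcases eq_or_ne γ 0 with rfl | h0
      · refine isStationary_zero.2 ⟨h.isSuccLimit, fun δ hδ => ?_⟩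
        obtain ⟨s, hs, h1, h2⟩ := h.unboundedIn _ (max_lt hi hδ)
        exact ⟨s, ⟨hs, (le_max_left _ _).trans_lt h1, h2⟩, (le_max_right _ _).trans_lt h1, h2⟩
      · exact h.inter_isGClub (pos_iff_ne_zero.2 h0) (isGClub_zero_Ioo h.isSuccLimit hi)
    exact h'.mono_set fun x hx _ => hx.1.2 i hx.2.1

end NormalMeasure

/-! ### Halving a stationary set. -/

/-- The points of a `(γ+1)`-stationary set at which it does not reflect form a
`(γ+1)`-stationary set. -/
theorem IsStationary.nonreflecting {γ κ : Ordinal.{u}} {S : Set Ordinal.{u}}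
    (hS : IsStationary (γ + 1) κ S) :
    IsStationary (γ + 1) κ {α | α ∈ S ∧ ¬ IsStationary (γ + 1) α S} := by
  have hS' := isStationary_add_one_iff.1 hS
  refine isStationary_add_one_iff.2 ⟨hS'.1, hS'.2.1, fun C hC => ?_⟩
  have hne := hS'.2.2 _ (hC.derived (hS'.2.1 γ le_rfl))
  -- Take the least point of `S` at which `C` is `γ`-stationary. If `S` were `(γ+1)`-stationary
  -- there, it would meet the derived club of `C ∩ α` at a smaller such point.
  obtain ⟨α, ⟨hαS, hακ, hα⟩, hmin⟩ := (wellFounded_lt (α := Ordinal.{u})).has_min _ hne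
  refine ⟨α, ⟨hαS, fun h => ?_⟩, hC.2.2 α hακ hα⟩
  have h' := isStationary_add_one_iff.1 h
  obtain ⟨β, hβS, hβα, hβ⟩ := h'.2.2 _ ((hC.restrict hακ.le hα).derived (h'.2.1 γ le_rfl))
  exact hmin β ⟨hβS, hβα.trans hακ, hβ.mono_set fun x hx _ => hx.1⟩ hβα

section Atom

variable {κ : Cardinal.{u}} {γ : Ordinal.{u}}

theorem IsComplete.exists_isGClub_subset (hcomp : IsComplete κ (clubFilter γ κ.ord))
    {ι : Type u} [Nonempty ι] (hι : Cardinal.mk ι < κ) {C : ι → Set Ordinal.{u}}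
    (hC : ∀ i, IsGClub γ κ.ord (C i)) : ∃ D, IsGClub γ κ.ord D ∧ ∀ i, D ⊆ C i := by
  obtain ⟨-, D, hD, hDC⟩ := hcomp ι C hι fun i => ⟨(hC i).1, C i, hC i, Subset.rfl⟩
  exact ⟨D, hD, fun i => hDC.trans (iInter_subset C i)⟩

/-- The ultrafilter generated by the `γ`-clubs and a `(γ+1)`-stationary set that is not the
union of two disjoint `(γ+1)`-stationary sets. -/
theorem exists_isMeasure_of_atom (hcomp : IsComplete κ (clubFilter γ κ.ord))
    {S : Set Ordinal.{u}} (hS : IsStationary (γ + 1) κ.ord S)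
    (hatom : ∀ X ⊆ S, IsStationary (γ + 1) κ.ord X → ¬ IsStationary (γ + 1) κ.ord (S \ X)) :
    ∃ U : Ultrafilter Ordinal.{u}, IsMeasure κ U ∧
      ∀ X, X ∈ U ↔ ∃ C, IsGClub γ κ.ord C ∧ C ∩ S ⊆ X := by
  have hS' := isStationary_add_one_iff.1 hS
  have hnull : ∀ X ⊆ S, ¬ IsStationary (γ + 1) κ.ord X → ∃ C, IsGClub γ κ.ord C ∧ C ∩ S ⊆ Xᶜ := by
    intro X hX h
    rw [isStationary_add_one_iff] at h
    push Not at h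
    obtain ⟨C, hC, h⟩ := h hS'.1 hS'.2.1
    exact ⟨C, hC, fun x hx hxX => by
      have : x ∈ X ∩ C := ⟨hxX, hx.1⟩
      rw [h] at this
      exact this⟩
  have hr : ∀ η < γ, IsReflecting η κ.ord := fun η hη => hS'.2.1 η hη.le
  let F : Filter Ordinal.{u} :=
    { sets := {X | ∃ C, IsGClub γ κ.ord C ∧ C ∩ S ⊆ X}
      univ_sets := ⟨_, isGClub_Ioo hS'.1 hr hS'.1.bot_lt, subset_univ _⟩
      sets_of_superset := fun ⟨C, hC, h⟩ hXY => ⟨C, hC, h.trans hXY⟩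
      inter_sets := fun ⟨C, hC, h⟩ ⟨D, hD, h'⟩ => ⟨C ∩ D, hC.inter (hS'.2.1 γ le_rfl) hD,
        fun x hx => ⟨h ⟨hx.1.1, hx.2⟩, h' ⟨hx.1.2, hx.2⟩⟩⟩ }
  have hF : ∀ X, X ∈ F ↔ ∃ C, IsGClub γ κ.ord C ∧ C ∩ S ⊆ X := fun X => Iff.rfl
  let U : Ultrafilter Ordinal.{u} := Ultrafilter.ofComplNotMemIff F (by
    intro X
    constructor
    · intro h
      by_contra hX
      have h1 : IsStationary (γ + 1) κ.ord (S \ X) := by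
        by_contra hcon
        obtain ⟨C, hC, h'⟩ := hnull _ sdiff_subset hcon
        refine hX ((hF X).2 ⟨C, hC, fun x hx => ?_⟩)
        by_contra hxX
        exact h' hx ⟨hx.2, hxX⟩
      have h2 : ¬ IsStationary (γ + 1) κ.ord (S ∩ X) := by
        intro h2
        refine hatom _ inter_subset_left h2 ?_
        rwa [sdiff_self_inter]
      obtain ⟨C, hC, h'⟩ := hnull _ inter_subset_left h2
      exact h ((hF _).2 ⟨C, hC, fun x hx hxX => h' hx ⟨hx.2, hxX⟩⟩)
    · rintro h h'
      obtain ⟨C, hC, h''⟩ := (hF _).1 (F.inter_sets h h')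
      obtain ⟨x, hx⟩ := hS'.2.2 C hC
      exact (h'' ⟨hx.2, hx.1⟩).2 (h'' ⟨hx.2, hx.1⟩).1)
  have hUF : ∀ X, X ∈ U ↔ ∃ C, IsGClub γ κ.ord C ∧ C ∩ S ⊆ X := fun X => Iff.rfl
  have hev : ∀ p : Ordinal.{u} → Prop, (∀ᶠ x in U, p x) ↔
      ∃ C, IsGClub γ κ.ord C ∧ ∀ x ∈ C, x ∈ S → p x := by
    intro p
    refine (hUF _).trans (exists_congr fun C => and_congr_right fun _ => ?_)
    exact ⟨fun h x hx hxS => h ⟨hx, hxS⟩, fun h x hx => h x hx.1 hx.2⟩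
  refine ⟨U, ⟨fun δ hδ p hp => ?_, fun β hβ => ?_, ?_⟩, hUF⟩
  · rcases eq_or_ne δ 0 with rfl | h0
    · exact Eventually.of_forall fun x i hi => absurd hi not_lt_zero
    have hp' : ∀ i : δ.ToType, ∃ C, IsGClub γ κ.ord C ∧
        ∀ x ∈ C, x ∈ S → p (Ordinal.ToType.mk.symm i).1 x := fun i =>
      (hev _).1 (hp _ (Ordinal.ToType.mk.symm i).2)
    choose C hC hC' using hp'
    have : Nonempty δ.ToType := Ordinal.nonempty_toType_iff.2 h0
    obtain ⟨D, hD, hDC⟩ := hcomp.exists_isGClub_subset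
      (by rw [Cardinal.mk_toType]; exact Cardinal.lt_ord.1 hδ) hC
    refine (hev _).2 ⟨D, hD, fun x hx hxS i hi => ?_⟩
    have := hC' (Ordinal.ToType.mk ⟨i, hi⟩) x (hDC _ hx) hxS
    simpa using this
  · exact (hev _).2 ⟨_, isGClub_Ioo hS'.1 hr hβ, fun x hx _ => hx.1⟩
  · exact (hev _).2 ⟨_, isGClub_Ioo hS'.1 hr hS'.1.bot_lt, fun x hx _ => hx.2⟩

/-- If `𝒞^γ(κ)` is `κ`-complete, every `(γ+1)`-stationary set can be halved. -/
theorem IsStationary.exists_halving (hcomp : IsComplete κ (clubFilter γ κ.ord))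
    {S : Set Ordinal.{u}} (hS : IsStationary (γ + 1) κ.ord S) :
    ∃ X ⊆ S, IsStationary (γ + 1) κ.ord X ∧ IsStationary (γ + 1) κ.ord (S \ X) := by
  by_contra! hatom
  have hκ := hS.aleph0_lt
  have hlim := hS.isSuccLimit
  have hγ := hS.lt_ord
  have hr : ∀ η < γ + 1, IsReflecting η κ.ord := fun η hη => hS.isReflecting hη
  obtain ⟨U, hU, hUmem⟩ := exists_isMeasure_of_atom hcomp hS hatom
  obtain ⟨f, hW, hle⟩ := hU.exists_isNormalMeasure_map hκ
  have hSU : ∀ C, IsGClub γ κ.ord C → ∀ᶠ x in U, x ∈ C ∧ x ∈ S := fun C hC =>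
    (hUmem _).2 ⟨C, hC, fun x hx => hx⟩
  -- If `f` is regressive, the clubs `C i` on whose intersection with `S` the value `i` is omitted
  -- have a diagonal intersection `D`. A point `x` of `D ∩ S` with `f x < x` would have to omit its
  -- own value `f x`.
  by_cases hlt : ∀ᶠ x in U, f x < x
  · have hC : ∀ i, ∃ C, i < κ.ord → IsGClub γ κ.ord C ∧ ∀ x ∈ C, x ∈ S → f x ≠ i := by
      intro i
      by_cases hi : i < κ.ord
      · have h1 : ∀ᶠ x in U, i < f x := hW.unbounded i hi
        obtain ⟨C, hC, h2⟩ := (hUmem _).1 h1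
        exact ⟨C, fun _ => ⟨hC, fun x hx hxS => (h2 ⟨hx, hxS⟩ : i < f x).ne'⟩⟩
      · exact ⟨∅, fun h => absurd h hi⟩
    choose C hC using hC
    have hD := hW.isGClub_diag hlim hγ (fun η hη => hr η (hη.trans (Order.lt_add_one_iff.2 le_rfl)))
      fun i hi => (hC i hi).1
    obtain ⟨x, hx, hxD, hxS⟩ := (hlt.and (hSU _ hD)).exists
    exact (hC (f x) (hx.trans hxD.1)).2 x (hxD.2 _ hx) hxS rfl
  · rw [← Ultrafilter.eventually_not] at hlt
    have heq : ∀ᶠ x in U, f x = x := by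
      filter_upwards [hlt, hle] with x h1 h2
      exact le_antisymm h2 (not_lt.1 h1)
    -- Here `f` is the identity almost everywhere, so `S` is `(γ+1)`-stationary in all its points
    -- inside some `γ`-club, against `nonreflecting`.
    have hst := (hW.stationary_transfer hlim (γ + 1) (hlim.succ_lt hγ) hr S).1 hS
    have hst' : ∀ᶠ x in U, IsStationary (γ + 1) x S := by
      have hst'' : ∀ᶠ x in U, IsStationary (γ + 1) (f x) S := hst
      filter_upwards [hst'', heq] with x h1 h2
      rwa [h2] at h1
    obtain ⟨C, hC, h⟩ := (hUmem _).1 hst'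
    obtain ⟨x, hx, hxC⟩ := (isStationary_add_one_iff.1 hS.nonreflecting).2.2 C hC
    exact hx.2 (h ⟨hxC, hx.1⟩)

end Atom

end HigherStat

/-! ### The tree of halvings and the splitting theorem. -/

namespace HigherStat

/-- The node at height `α` determined by `b` in the tree of subsets of `S` in which every node `X`
is divided into the part inside and the part outside `h X`. -/
def halvingNode (h : Set Ordinal.{u} → Set Ordinal.{u}) (S b : Set Ordinal.{u})
    (α : Ordinal.{u}) : Set Ordinal.{u} :=
  {ξ | ξ ∈ S ∧ ∀ β, ∀ _hβ : β < α, (ξ ∈ h (halvingNode h S b β) ↔ β ∈ b)}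
termination_by α

/-- The node at height `α` that contains `ξ`. -/
def halvingNodeAt (h : Set Ordinal.{u} → Set Ordinal.{u}) (S : Set Ordinal.{u})
    (ξ α : Ordinal.{u}) : Set Ordinal.{u} :=
  {ζ | ζ ∈ S ∧ ∀ β, ∀ _hβ : β < α, (ζ ∈ h (halvingNodeAt h S ξ β) ↔
    ξ ∈ h (halvingNodeAt h S ξ β))}
termination_by α

section Halving

variable {h : Set Ordinal.{u} → Set Ordinal.{u}} {S b b' : Set Ordinal.{u}} {α β ξ : Ordinal.{u}}

theorem mem_halvingNode :
    ξ ∈ halvingNode h S b α ↔ ξ ∈ S ∧ ∀ β < α, (ξ ∈ h (halvingNode h S b β) ↔ β ∈ b) := by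
  rw [halvingNode]; rfl

theorem halvingNode_anti (hαβ : α ≤ β) : halvingNode h S b β ⊆ halvingNode h S b α := by
  intro ξ hξ
  rw [mem_halvingNode] at hξ ⊢
  exact ⟨hξ.1, fun δ hδ => hξ.2 δ (hδ.trans_le hαβ)⟩

theorem mem_halvingNode_add_one :
    ξ ∈ halvingNode h S b (α + 1) ↔
      ξ ∈ halvingNode h S b α ∧ (ξ ∈ h (halvingNode h S b α) ↔ α ∈ b) := by
  constructor
  · intro hξ
    exact ⟨halvingNode_anti le_self_add hξ,
      (mem_halvingNode.1 hξ).2 α (Order.lt_add_one_iff.2 le_rfl)⟩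
  · rintro ⟨h1, h2⟩
    rw [mem_halvingNode] at h1 ⊢
    refine ⟨h1.1, fun β hβ => ?_⟩
    rcases (Order.lt_add_one_iff.1 hβ).eq_or_lt with rfl | hβ
    · exact h2
    · exact h1.2 β hβ

theorem halvingNode_congr (hb : ∀ β < α, (β ∈ b ↔ β ∈ b')) :
    halvingNode h S b α = halvingNode h S b' α := by
  induction α using WellFoundedLT.induction with
  | ind α ih =>
  ext ξ
  rw [mem_halvingNode, mem_halvingNode]
  refine and_congr_right fun _ => forall_congr' fun β => forall_congr' fun hβ => ?_
  rw [ih β hβ fun δ hδ => hb δ (hδ.trans hβ), hb β hβ]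

theorem halvingNodeAt_eq (h : Set Ordinal.{u} → Set Ordinal.{u}) (S : Set Ordinal.{u})
    (ξ α : Ordinal.{u}) :
    halvingNodeAt h S ξ α = halvingNode h S {β | ξ ∈ h (halvingNodeAt h S ξ β)} α := by
  induction α using WellFoundedLT.induction with
  | ind α ih =>
  ext ζ
  rw [mem_halvingNode, halvingNodeAt]
  refine and_congr_right fun _ => forall_congr' fun β => forall_congr' fun hβ => ?_
  rw [← ih β hβ]
  rfl

/-- The path of `ξ` is read off `halvingNodeAt`, whose recursion mentions only `ξ` and no branch
given beforehand. -/
theorem exists_mem_halvingNode (h : Set Ordinal.{u} → Set Ordinal.{u}) (hξ : ξ ∈ S) :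
    ∃ b, ∀ α, ξ ∈ halvingNode h S b α := by
  refine ⟨{β | ξ ∈ h (halvingNodeAt h S ξ β)}, fun α => ?_⟩
  rw [← halvingNodeAt_eq, halvingNodeAt]
  exact ⟨hξ, fun _ _ => Iff.rfl⟩

end Halving

variable {κ : Cardinal.{u}} {γ : Ordinal.{u}}

/-- The nodes of height `α` cover `S` and are indexed by the fewer than `κ` subsets of `α`. If each
missed a `γ`-club, a `γ`-club inside the intersection of these clubs would miss `S`. -/
theorem exists_isStationary_halvingNode (hbr : BranchProperty κ)
    (hcomp : IsComplete κ (clubFilter γ κ.ord)) {S : Set Ordinal.{u}}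
    (hS : IsStationary (γ + 1) κ.ord S) (h : Set Ordinal.{u} → Set Ordinal.{u})
    {α : Ordinal.{u}} (hα : α < κ.ord) :
    ∃ b, IsStationary (γ + 1) κ.ord (halvingNode h S b α) := by
  by_contra! hcon
  have hS' := isStationary_add_one_iff.1 hS
  let B : Set α.ToType → Set Ordinal.{u} := fun s =>
    {x | ∃ hx : x < α, Ordinal.ToType.mk ⟨x, hx⟩ ∈ s}
  have hC : ∀ s, ∃ C, IsGClub γ κ.ord C ∧ ¬ (halvingNode h S (B s) α ∩ C).Nonempty := by
    intro s
    have := hcon (B s)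
    rw [isStationary_add_one_iff] at this
    by_contra! hcon'
    exact this ⟨hS'.1, hS'.2.1, hcon'⟩
  choose C hC hC' using hC
  obtain ⟨D, hD, hDC⟩ := hcomp.exists_isGClub_subset (by
    rw [Cardinal.mk_set, Cardinal.mk_toType]
    exact hbr.two_power_lt hS.aleph0_lt.le hα) hC
  obtain ⟨ξ, hξS, hξD⟩ := hS'.2.2 D hD
  obtain ⟨b, hb⟩ := exists_mem_halvingNode h hξS
  refine hC' {i | (Ordinal.ToType.mk.symm i).1 ∈ b} ⟨ξ, ?_, hDC _ hξD⟩
  rw [halvingNode_congr (b' := b)]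
  · exact hb α
  · intro β hβ
    simp only [B]
    constructor
    · rintro ⟨hx, hx'⟩
      simpa using hx'
    · intro hβb
      exact ⟨hβ, by simpa using hβb⟩

/-- The points of `S` outside all pieces are added to the piece with index `0`. -/
theorem splits_of_disjoint {S : Set Ordinal.{u}} (hκ : 0 < κ.ord)
    (P : Ordinal.{u} → Set Ordinal.{u}) (hP : ∀ i < κ.ord, IsStationary γ κ.ord (P i))
    (hPS : ∀ i < κ.ord, P i ⊆ S) (hdisj : ∀ i < κ.ord, ∀ j < i, Disjoint (P i) (P j)) :
    Splits γ κ S := by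
  classical
  have hd : ∀ i < κ.ord, ∀ j < κ.ord, i ≠ j → Disjoint (P i) (P j) := by
    intro i hi j hj hij
    rcases lt_or_gt_of_ne hij with h | h
    · exact (hdisj j hj i h).symm
    · exact hdisj i hi j h
  let Q : Set Ordinal.{u} := {x | x ∈ S ∧ ∀ j < κ.ord, j ≠ 0 → x ∉ P j}
  have hQ : ∀ j < κ.ord, j ≠ 0 → Disjoint Q (P j) := fun j hj h0 =>
    Set.disjoint_left.2 fun x hx => hx.2 j hj h0
  refine ⟨fun i => if i.1 = 0 then Q else P i, fun i => ?_, fun i j hij => ?_, ?_⟩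
  · dsimp only
    split_ifs with h0
    · exact (hP 0 hκ).mono_set fun x hx _ => ⟨hPS 0 hκ hx, fun j hj hj0 hxj =>
        Set.disjoint_left.1 (hd 0 hκ j hj hj0.symm) hx hxj⟩
    · exact hP i i.2
  · have hij' : i.1 ≠ j.1 := fun h => hij (Subtype.ext h)
    dsimp only
    split_ifs with h1 h2 h2
    · exact absurd (h1.trans h2.symm) hij'
    · exact hQ j j.2 h2
    · exact (hQ i i.2 h1).symm
    · exact hd i i.2 j j.2 hij'
  · ext x
    simp only [mem_iUnion]
    constructor
    · rintro ⟨i, hi⟩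
      split_ifs at hi with h0
      · exact hi.1
      · exact hPS i i.2 hi
    · intro hx
      by_cases hex : ∃ j < κ.ord, j ≠ 0 ∧ x ∈ P j
      · obtain ⟨j, hj, h0, hxj⟩ := hex
        exact ⟨⟨j, hj⟩, by rw [if_neg h0]; exact hxj⟩
      · push Not at hex
        exact ⟨⟨0, hκ⟩, by rw [if_pos rfl]; exact ⟨hx, hex⟩⟩

/-- Choose a stationary node at each height and let `b` be a branch through the sequence of their
paths. The node of `b` at `β` contains a chosen node of some height `α ≥ β`, so it is stationary.
The piece at `β` is the half of that node which `b` leaves behind. -/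
theorem splits_of_branchProperty (hbr : BranchProperty κ)
    (hcomp : IsComplete κ (clubFilter γ κ.ord)) {S : Set Ordinal.{u}}
    (hS : IsStationary (γ + 1) κ.ord S) : Splits (γ + 1) κ S := by
  have hlim := hS.isSuccLimit
  have hex : ∀ X : Set Ordinal.{u}, ∃ Y ⊆ X, IsStationary (γ + 1) κ.ord X →
      IsStationary (γ + 1) κ.ord Y ∧ IsStationary (γ + 1) κ.ord (X \ Y) := by
    intro X
    by_cases hX : IsStationary (γ + 1) κ.ord X
    · obtain ⟨Y, hY, h⟩ := hX.exists_halving hcomp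
      exact ⟨Y, hY, fun _ => h⟩
    · exact ⟨∅, empty_subset _, fun h => absurd h hX⟩
  choose h hsub hh using hex
  have ht : ∀ α, ∃ b, α < κ.ord → IsStationary (γ + 1) κ.ord (halvingNode h S b α) := by
    intro α
    by_cases hα : α < κ.ord
    · obtain ⟨b, hb⟩ := exists_isStationary_halvingNode hbr hcomp hS h hα
      exact ⟨b, fun _ => hb⟩
    · exact ⟨∅, fun h => absurd h hα⟩
  choose t ht using ht
  obtain ⟨b, hb⟩ := hbr t
  have hbs : ∀ β < κ.ord, IsStationary (γ + 1) κ.ord (halvingNode h S b β) := by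
    intro β hβ
    obtain ⟨α, hα, hle, he⟩ := hb β hβ
    rw [← halvingNode_congr (b := t α) fun δ hδ => by
      simpa [show δ < β from hδ] using Set.ext_iff.1 he δ]
    exact (ht α hα).mono_set fun x hx _ => halvingNode_anti hle hx
  refine splits_of_disjoint hlim.bot_lt
    (fun β => halvingNode h S b β \ halvingNode h S b (β + 1)) (fun β hβ => ?_)
    (fun β hβ x hx => (mem_halvingNode.1 hx.1).1) fun i hi j hj => ?_
  · obtain ⟨h1, h2⟩ := hh _ (hbs β hβ)
    by_cases hβb : β ∈ b
    · refine h2.mono_set fun x hx _ => ⟨hx.1, fun hx' => hx.2 ?_⟩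
      exact (mem_halvingNode_add_one.1 hx').2.2 hβb
    · refine h1.mono_set fun x hx _ => ⟨hsub _ hx, fun hx' => hβb ?_⟩
      exact (mem_halvingNode_add_one.1 hx').2.1 hx
  · exact Set.disjoint_left.2 fun x hx hx' =>
      hx'.2 (halvingNode_anti (Order.add_one_le_iff.2 hj) hx.1)

end HigherStat

/-! ### Uniform definability over the sets `V_α`. -/

namespace HigherStat
open FirstOrder

/-- A family of structures on sets `V_α`, `α` a limit ordinal, for a language with a symbol for
membership. -/
structure SetModels : Type (u + 2) where
  L : FirstOrder.Language.{0, 0}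
  J : Type (u + 1)
  ord : J → Ordinal.{u}
  isSuccLimit : ∀ j, Order.IsSuccLimit (ord j)
  str : ∀ j, L.Structure (VDom (ord j))
  memRel : L.Relations 2
  memRel_iff : ∀ j x y, (str j).RelMap memRel ![x, y] ↔ x.1 ∈ y.1

namespace SetModels

variable {I : SetModels.{u}} {n m : ℕ}

/-- The domain of the structure with index `j`. -/
abbrev Dom (I : SetModels.{u}) (j : I.J) : Type (u + 1) := VDom (I.ord j)

/-- Uniformly definable predicates. -/
def Def (I : SetModels.{u}) (n : ℕ) (P : ∀ j, (Fin n → I.Dom j) → Prop) : Prop :=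
  ∃ φ : I.L.BoundedFormula Empty n, ∀ j v,
    @Language.BoundedFormula.Realize I.L (I.Dom j) (I.str j) Empty n φ default v ↔ P j v

/-- A function of the variables that is one of the variables. -/
class IsVar (e : ∀ j, (Fin n → I.Dom j) → I.Dom j) : Prop where
  exists_eq : ∃ i, ∀ j v, e j v = v i

instance (i : Fin n) : IsVar (I := I) (n := n) (fun _ v => v i) := ⟨⟨i, fun _ _ => rfl⟩⟩

instance (s : Fin n → Fin m) (e : ∀ j, (Fin n → I.Dom j) → I.Dom j) [he : IsVar e] :
    IsVar (I := I) (n := m) (fun j w => e j (fun i => w (s i))) := by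
  obtain ⟨i, hi⟩ := he.exists_eq
  exact ⟨⟨s i, fun j w => hi j _⟩⟩

theorem Def.congr {P Q : ∀ j, (Fin n → I.Dom j) → Prop} (h : I.Def n P)
    (hPQ : ∀ j v, Q j v ↔ P j v) : I.Def n Q := by
  obtain ⟨φ, hφ⟩ := h
  exact ⟨φ, fun j v => (hφ j v).trans (hPQ j v).symm⟩

section Connectives

variable {P Q : ∀ j, (Fin n → I.Dom j) → Prop}

theorem Def.not (h : I.Def n P) : I.Def n fun j v => ¬ P j v := by
  obtain ⟨φ, hφ⟩ := h
  exact ⟨φ.not, fun j v => by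
    let _ := I.str j
    rw [Language.BoundedFormula.realize_not, hφ]⟩

theorem Def.imp (h : I.Def n P) (h' : I.Def n Q) : I.Def n fun j v => P j v → Q j v := by
  obtain ⟨φ, hφ⟩ := h
  obtain ⟨ψ, hψ⟩ := h'
  exact ⟨φ.imp ψ, fun j v => by
    let _ := I.str j
    rw [Language.BoundedFormula.realize_imp, hφ, hψ]⟩

theorem Def.and (h : I.Def n P) (h' : I.Def n Q) : I.Def n fun j v => P j v ∧ Q j v :=
  (h.imp h'.not).not.congr fun _ _ => by tauto

theorem Def.or (h : I.Def n P) (h' : I.Def n Q) : I.Def n fun j v => P j v ∨ Q j v :=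
  (h.not.imp h').congr fun _ _ => by tauto

theorem Def.iff (h : I.Def n P) (h' : I.Def n Q) : I.Def n fun j v => (P j v ↔ Q j v) :=
  ((h.imp h').and (h'.imp h)).congr fun _ _ => by tauto

theorem Def.const (p : Prop) : I.Def n fun _ _ => p := by
  by_cases hp : p
  · exact ⟨⊤, fun j v => by
      let _ := I.str j
      simp [hp]⟩
  · exact ⟨⊥, fun j v => by
      let _ := I.str j
      simp [hp]⟩

theorem Def.all {P : ∀ j, (Fin n → I.Dom j) → I.Dom j → Prop}
    (h : I.Def (n + 1) fun j w => P j (fun i => w i.castSucc) (w (Fin.last n))) :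
    I.Def n fun j v => ∀ x, P j v x := by
  obtain ⟨φ, hφ⟩ := h
  exact ⟨φ.all, fun j v => by
    let _ := I.str j
    rw [Language.BoundedFormula.realize_all]
    refine forall_congr' fun x => ?_
    rw [hφ]
    simp only [Fin.snoc_castSucc, Fin.snoc_last]⟩

theorem Def.ex {P : ∀ j, (Fin n → I.Dom j) → I.Dom j → Prop}
    (h : I.Def (n + 1) fun j w => P j (fun i => w i.castSucc) (w (Fin.last n))) :
    I.Def n fun j v => ∃ x, P j v x :=
  (Def.all (P := fun j v x => ¬ P j v x) h.not).not.congr fun _ _ => by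
    simp only [not_forall, not_not]

end Connectives

theorem Def.rel₁ (r : I.L.Relations 1) (e : ∀ j, (Fin n → I.Dom j) → I.Dom j) [he : IsVar e] :
    I.Def n fun j v => (I.str j).RelMap r ![e j v] := by
  obtain ⟨i, hi⟩ := he.exists_eq
  refine ⟨r.boundedFormula₁ (Language.Term.var (Sum.inr i)), fun j v => ?_⟩
  let _ := I.str j
  rw [Language.BoundedFormula.realize_rel₁]
  beta_reduce
  rw [hi]
  rfl

theorem Def.rel₂ (r : I.L.Relations 2) (e e' : ∀ j, (Fin n → I.Dom j) → I.Dom j)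
    [he : IsVar e] [he' : IsVar e'] :
    I.Def n fun j v => (I.str j).RelMap r ![e j v, e' j v] := by
  obtain ⟨i, hi⟩ := he.exists_eq
  obtain ⟨i', hi'⟩ := he'.exists_eq
  refine ⟨r.boundedFormula₂ (Language.Term.var (Sum.inr i)) (Language.Term.var (Sum.inr i')),
    fun j v => ?_⟩
  let _ := I.str j
  rw [Language.BoundedFormula.realize_rel₂]
  beta_reduce
  rw [hi, hi']
  rfl

variable (e e' e'' : ∀ j, (Fin n → I.Dom j) → I.Dom j) [he : IsVar e] [he' : IsVar e']
  [he'' : IsVar e'']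

theorem Def.mem : I.Def n fun j v => (e j v).1 ∈ (e' j v).1 :=
  (Def.rel₂ I.memRel e e').congr fun j _ => (I.memRel_iff j _ _).symm

theorem Def.eq : I.Def n fun j v => e j v = e' j v := by
  obtain ⟨i, hi⟩ := he.exists_eq
  obtain ⟨i', hi'⟩ := he'.exists_eq
  refine ⟨Language.Term.bdEqual (Language.Term.var (Sum.inr i)) (Language.Term.var (Sum.inr i')),
    fun j v => ?_⟩
  let _ := I.str j
  rw [Language.BoundedFormula.realize_bdEqual]
  beta_reduce
  rw [hi, hi']
  rfl

end SetModels

section Absoluteness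

variable {α : Ordinal.{u}}

theorem VDom.mem_trans (x : VDom α) {y : ZFSet.{u}} (hy : y ∈ x.1) : y ∈ ZFSet.vonNeumann α :=
  (ZFSet.isTransitive_vonNeumann α).mem_trans hy x.2

theorem VDom.ext_iff (x y : VDom α) : x = y ↔ ∀ z : VDom α, z.1 ∈ x.1 ↔ z.1 ∈ y.1 := by
  constructor
  · rintro rfl z; rfl
  · intro h
    refine Subtype.ext (ZFSet.ext fun z => ⟨fun hz => ?_, fun hz => ?_⟩)
    · exact (h ⟨z, x.mem_trans hz⟩).1 hz
    · exact (h ⟨z, y.mem_trans hz⟩).2 hz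

theorem rank_pair_lt (hα : Order.IsSuccLimit α) {x y : ZFSet.{u}} (hx : x.rank < α)
    (hy : y.rank < α) : (ZFSet.pair x y).rank < α := by
  have h : (ZFSet.pair x y).rank = Order.succ (Order.succ (max x.rank y.rank)) := by
    simp only [ZFSet.pair, ZFSet.rank_pair, ZFSet.rank_singleton, ← Order.succ_max]
    simp
  rw [h]
  exact hα.succ_lt (hα.succ_lt (max_lt hx hy))

/-- The ordered pair as an element of `V_α`. -/
def VDom.pair (hα : Order.IsSuccLimit α) (x y : VDom α) : VDom α :=
  ⟨ZFSet.pair x.1 y.1, ZFSet.mem_vonNeumann.2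
    (rank_pair_lt hα (ZFSet.mem_vonNeumann.1 x.2) (ZFSet.mem_vonNeumann.1 y.2))⟩

theorem VDom.singleton_mem (hα : Order.IsSuccLimit α) (x : VDom α) :
    ({x.1} : ZFSet.{u}) ∈ ZFSet.vonNeumann α := by
  rw [ZFSet.mem_vonNeumann, ZFSet.rank_singleton]
  exact hα.succ_lt (ZFSet.mem_vonNeumann.1 x.2)

theorem VDom.insert_mem (hα : Order.IsSuccLimit α) (x y : VDom α) :
    ({x.1, y.1} : ZFSet.{u}) ∈ ZFSet.vonNeumann α := by
  rw [ZFSet.mem_vonNeumann, ZFSet.rank_pair]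
  exact max_lt (hα.succ_lt (ZFSet.mem_vonNeumann.1 x.2)) (hα.succ_lt (ZFSet.mem_vonNeumann.1 y.2))

/-- For limit `α`, the singletons and unordered pairs involved lie in `V_α`, so quantifiers bounded
by `V_α` suffice. -/
theorem VDom.eq_pair_iff (hα : Order.IsSuccLimit α) (p x y : VDom α) :
    p.1 = ZFSet.pair x.1 y.1 ↔ ∀ z : VDom α, z.1 ∈ p.1 ↔
      (∀ w : VDom α, w.1 ∈ z.1 ↔ w = x) ∨ (∀ w : VDom α, w.1 ∈ z.1 ↔ w = x ∨ w = y) := by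
  have hS : ∀ w z : VDom α, w = z ↔ w.1 = z.1 := fun _ _ => Subtype.ext_iff
  have h1 : ∀ z : VDom α, (∀ w : VDom α, w.1 ∈ z.1 ↔ w = x) ↔ z.1 = {x.1} := by
    intro z
    have := VDom.ext_iff z ⟨_, x.singleton_mem hα⟩
    rw [hS] at this
    rw [this]
    simp only [hS, ZFSet.mem_singleton]
  have h2 : ∀ z : VDom α, (∀ w : VDom α, w.1 ∈ z.1 ↔ w = x ∨ w = y) ↔ z.1 = {x.1, y.1} := by
    intro z
    have := VDom.ext_iff z ⟨_, x.insert_mem hα y⟩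
    rw [hS] at this
    rw [this]
    simp only [hS, ZFSet.mem_insert_iff, ZFSet.mem_singleton]
  have h3 : p.1 = ZFSet.pair x.1 y.1 ↔ p = VDom.pair hα x y := by
    rw [Subtype.ext_iff]; rfl
  rw [h3, VDom.ext_iff]
  refine forall_congr' fun z => ?_
  rw [h1, h2]
  simp [VDom.pair, ZFSet.pair]

theorem VDom.isOrdinal_iff (x : VDom α) : x.1.IsOrdinal ↔
    (∀ y z : VDom α, z.1 ∈ y.1 → y.1 ∈ x.1 → z.1 ∈ x.1) ∧
    ∀ w y z : VDom α, w.1 ∈ x.1 → z.1 ∈ y.1 → y.1 ∈ w.1 → z.1 ∈ w.1 := by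
  rw [ZFSet.isOrdinal_iff_forall_mem_isTransitive]
  simp only [ZFSet.isTransitive_iff_mem_trans]
  constructor
  · rintro ⟨h1, h2⟩
    exact ⟨fun y z hz hy => h1 hz hy, fun w y z hw hz hy => h2 w.1 hw hz hy⟩
  · rintro ⟨h1, h2⟩
    refine ⟨fun {z y} hz hy => ?_, fun w hw {z y} hz hy => ?_⟩
    · have hy' := x.mem_trans hy
      exact h1 ⟨y, hy'⟩ ⟨z, VDom.mem_trans ⟨y, hy'⟩ hz⟩ hz hy
    · have hw' := x.mem_trans hw
      have hy' := VDom.mem_trans ⟨w, hw'⟩ hy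
      exact h2 ⟨w, hw'⟩ ⟨y, hy'⟩ ⟨z, VDom.mem_trans ⟨y, hy'⟩ hz⟩ hw hz hy

end Absoluteness

/-- `⟨i, x⟩ ∈ U`. -/
def InSec {α : Ordinal.{u}} (U : Set (VDom α)) (i x : VDom α) : Prop :=
  ∃ p ∈ U, p.1 = ZFSet.pair i.1 x.1

/-- `⟨h, ⟨b, s⟩⟩ ∈ U`. -/
def InTriple {α : Ordinal.{u}} (U : Set (VDom α)) (h b s : VDom α) : Prop :=
  ∃ q : VDom α, q.1 = ZFSet.pair b.1 s.1 ∧ InSec U h q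

namespace SetModels

variable {I : SetModels.{u}} {n : ℕ}

/-- A uniformly definable family of sets. -/
def DefSet (I : SetModels.{u}) (U : ∀ j, Set (I.Dom j)) : Prop :=
  ∀ (n : ℕ) (e : ∀ j, (Fin n → I.Dom j) → I.Dom j) [IsVar e], I.Def n fun j v => e j v ∈ U j

variable (e e' e'' : ∀ j, (Fin n → I.Dom j) → I.Dom j) [he : IsVar e] [he' : IsVar e']
  [he'' : IsVar e'']

theorem Def.eq_pair : I.Def n fun j v => (e j v).1 = ZFSet.pair (e' j v).1 (e'' j v).1 := by
  refine Def.congr (P := fun j v => ∀ z : I.Dom j, z.1 ∈ (e j v).1 ↔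
    (∀ w : I.Dom j, w.1 ∈ z.1 ↔ w = e' j v) ∨
    (∀ w : I.Dom j, w.1 ∈ z.1 ↔ w = e' j v ∨ w = e'' j v)) ?_
    fun j v => VDom.eq_pair_iff (I.isSuccLimit j) _ _ _
  refine Def.all (Def.iff (Def.mem _ _) (Def.or (Def.all (Def.iff (Def.mem _ _) (Def.eq _ _)))
    (Def.all (Def.iff (Def.mem _ _) (Def.or (Def.eq _ _) (Def.eq _ _))))))

theorem Def.isOrdinal : I.Def n fun j v => (e j v).1.IsOrdinal := by
  refine Def.congr ?_ fun j v => VDom.isOrdinal_iff (e j v)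
  refine Def.and
    (Def.all (Def.all (Def.imp (Def.mem _ _) (Def.imp (Def.mem _ _) (Def.mem _ _)))))
    (Def.all (Def.all (Def.all (Def.imp (Def.mem _ _) (Def.imp (Def.mem _ _)
      (Def.imp (Def.mem _ _) (Def.mem _ _)))))))

theorem Def.inSec {U : ∀ j, Set (I.Dom j)} (hU : I.DefSet U) :
    I.Def n fun j v => InSec (U j) (e j v) (e' j v) :=
  Def.ex (Def.and (hU _ _) (Def.eq_pair _ _ _))

theorem Def.inTriple {U : ∀ j, Set (I.Dom j)} (hU : I.DefSet U) :
    I.Def n fun j v => InTriple (U j) (e j v) (e' j v) (e'' j v) :=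
  Def.ex (Def.and (Def.eq_pair _ _ _) (Def.inSec _ _ hU))

end SetModels

/-! ### Definable games, and their translation into the games of `IsIndescribable`. -/

/-- Two players alternately move between subsets of `V_α`, starting from `R ∩ V_α`; the first player
who is unable to move loses. The moves and a side condition are uniformly first order definable over
all `V_α`, the rank of a position is at most `γ` and decreases with every move, and `good` is the set
of positions in which the player to move loses. -/
structure SetGame (κ γ : Ordinal.{u}) where
  R : Set ZFSet.{u}
  R_mem : ∀ x ∈ R, x ∈ ZFSet.vonNeumann κ
  side : ∀ α : Ordinal.{u}, Set (VDom α) → Prop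
  move : ∀ α : Ordinal.{u}, Set (VDom α) → Set (VDom α) → Set (VDom α) → Prop
  side_def : ∀ (I : SetModels.{u}) (A : ∀ j, Set (I.Dom j)), I.DefSet A →
    I.Def 0 fun j _ => side (I.ord j) (A j)
  move_def : ∀ (I : SetModels.{u}) (A U W : ∀ j, Set (I.Dom j)), I.DefSet A → I.DefSet U →
    I.DefSet W → I.Def 0 fun j _ => move (I.ord j) (A j) (U j) (W j)
  good : ∀ α : Ordinal.{u}, Set (VDom α) → Prop
  rank : ∀ α : Ordinal.{u}, Set (VDom α) → Ordinal.{u}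
  not_move_empty : ∀ α W, ¬ move α (restrict R α) ∅ W
  rank_empty : ∀ α, rank α ∅ = 0
  rank_lt : ∀ α U W, move α (restrict R α) U W → rank α W < rank α U
  rank_le : ∀ α ≤ κ, Order.IsSuccLimit α → side α (restrict R α) → rank α (restrict R α) ≤ γ
  good_iff : ∀ α ≤ κ, Order.IsSuccLimit α → side α (restrict R α) → ∀ U, rank α U ≤ γ →
    (good α U ↔ ∀ W, move α (restrict R α) U W → ¬ good α W)

/-- `Π` wins the game over `V_α`, and the side condition holds. -/
def SetGame.Holds {κ γ : Ordinal.{u}} (g : SetGame κ γ) (α : Ordinal.{u}) : Prop :=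
  Order.IsSuccLimit α ∧ g.side α (restrict g.R α) ∧ g.good α (restrict g.R α)

/-- Every set game of rank `γ` that `Π` wins over `V_κ` is won by `Π` over some `V_α`, `α < κ`. -/
def ReflectsGames (γ κ : Ordinal.{u}) : Prop :=
  ∀ g : SetGame κ γ, g.Holds κ → ∃ α < κ, g.Holds α

/-- The sentence stating that `α` is a limit ordinal. -/
def limSentence {L : FirstOrder.Language.{0, 0}} (r : L.Relations 2) : L.Sentence :=
  FirstOrder.Language.BoundedFormula.ex
    (Language.Term.bdEqual (Language.Term.var (Sum.inr 0)) (Language.Term.var (Sum.inr 0))) ⊓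
    (r.boundedFormula₂ (Language.Term.var (Sum.inr 0)) (Language.Term.var (Sum.inr 1))).ex.all

theorem isSuccLimit_iff_vDom {α : Ordinal.{u}} :
    Order.IsSuccLimit α ↔ Nonempty (VDom α) ∧ ∀ x : VDom α, ∃ y : VDom α, x.1 ∈ y.1 := by
  constructor
  · intro h
    exact ⟨⟨⟨∅, by rw [ZFSet.mem_vonNeumann, ZFSet.rank_empty]; exact h.bot_lt⟩⟩,
      fun x => ⟨⟨_, x.singleton_mem h⟩, by simp⟩⟩
  · rintro ⟨⟨x⟩, h⟩
    refine ⟨fun h0 => ?_, Order.isSuccPrelimit_of_succ_lt fun β hβ => ?_⟩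
    · exact h0.not_lt (ZFSet.mem_vonNeumann.1 x.2)
    · obtain ⟨y, hy⟩ := h ⟨β.toZFSet, by simpa [ZFSet.mem_vonNeumann] using hβ⟩
      have h1 := ZFSet.rank_lt_of_mem hy
      rw [Ordinal.rank_toZFSet] at h1
      exact (Order.succ_le_of_lt h1).trans_lt (ZFSet.mem_vonNeumann.1 y.2)

theorem realize_limSentence {L : FirstOrder.Language.{0, 0}} (r : L.Relations 2) {α : Ordinal.{u}}
    (str : L.Structure (VDom α)) (hr : ∀ x y : VDom α, str.RelMap r ![x, y] ↔ x.1 ∈ y.1) :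
    @Language.Sentence.Realize L (VDom α) str (limSentence r) ↔ Order.IsSuccLimit α := by
  rw [isSuccLimit_iff_vDom, limSentence, Language.Sentence.Realize, Language.Formula.Realize,
    Language.BoundedFormula.realize_inf, Language.BoundedFormula.realize_ex,
    Language.BoundedFormula.realize_all]
  refine and_congr ⟨fun ⟨x, _⟩ => ⟨x⟩, fun ⟨x⟩ => ⟨x, ?_⟩⟩ (forall_congr' fun x => ?_)
  · rw [Language.BoundedFormula.realize_bdEqual]
  · rw [Language.BoundedFormula.realize_ex]
    refine exists_congr fun y => ?_
    rw [Language.BoundedFormula.realize_rel₂]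
    exact hr _ _

theorem SetModels.Def.exists_sentence {I : SetModels.{u}} {P : I.J → Prop}
    (h : I.Def 0 fun j _ => P j) : ∃ φ : I.L.Sentence, ∀ j,
      @Language.Sentence.Realize I.L (I.Dom j) (I.str j) φ ↔ P j := by
  obtain ⟨φ, hφ⟩ := h
  exact ⟨φ, fun j => hφ j default⟩

/-- Ranks can thus be rounded up to odd ordinals at a cost of at most one. A round consists of two
moves and lowers the rank twice, so there is room for this. -/
theorem isOddOrdinal_or (η : Ordinal.{u}) : IsOddOrdinal η ∨ IsOddOrdinal (η + 1) := by
  induction η using Ordinal.limitRecOn with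
  | zero => exact Or.inr ⟨0, 1, Order.isSuccPrelimit_bot, odd_one, by simp⟩
  | add_one η ih =>
    rcases ih with ⟨l, n, hl, hn, rfl⟩ | h
    · refine Or.inr ⟨l, n + 2, hl, by simpa [parity_simps] using hn, ?_⟩
      push_cast
      rw [add_assoc, add_assoc, one_add_one_eq_two]
    · exact Or.inl h
  | limit η hη _ => exact Or.inr ⟨η, 1, hη.isSuccPrelimit, odd_one, by simp⟩

theorem exists_isOddOrdinal (η : Ordinal.{u}) : ∃ ε, IsOddOrdinal ε ∧ η ≤ ε ∧ ε ≤ η + 1 := by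
  rcases isOddOrdinal_or η with h | h
  · exact ⟨η, h, le_rfl, le_self_add⟩
  · exact ⟨η + 1, h, le_self_add, le_rfl⟩

/-- An index of a structure for the matrices of games. -/
structure GameIndex : Type (u + 1) where
  ord : Ordinal.{u}
  isSuccLimit : Order.IsSuccLimit ord
  X : List (Set (VDom ord))
  Y : List (Set (VDom ord))
  A : Set (VDom ord)

/-- The structures in which the matrices of games are evaluated. -/
def gameModels : SetModels.{u} where
  L := gameLang
  J := GameIndex.{u}
  ord := GameIndex.ord
  isSuccLimit := GameIndex.isSuccLimit
  str j := gameStructure j.ord j.X j.Y j.A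
  memRel := GameRel.mem
  memRel_iff _ _ _ := Iff.rfl

section Sequences

variable {α : Ordinal.{u}}

/-- `x` is the numeral of an index of an entry of the sequence `X`. -/
def SeqDom (X : List (Set (VDom α))) (x : VDom α) : Prop :=
  ∃ k < X.length, x.1 = Ordinal.toZFSet (k : Ordinal.{u})

/-- `x` is the numeral of an index of an entry of the sequence `X` that contains `y`. -/
def SeqEntry (X : List (Set (VDom α))) (x y : VDom α) : Prop :=
  ∃ k < X.length, x.1 = Ordinal.toZFSet (k : Ordinal.{u}) ∧ y ∈ X.getD k ∅

/-- The natural number `k` as an element of `V_α`. -/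
noncomputable def VDom.nat (hα : Order.IsSuccLimit α) (k : ℕ) : VDom α :=
  ⟨Ordinal.toZFSet (k : Ordinal.{u}), by
    rw [ZFSet.mem_vonNeumann, Ordinal.rank_toZFSet]
    exact (Ordinal.natCast_lt_omega0 k).trans_le (Ordinal.omega0_le_of_isSuccLimit hα)⟩

theorem natCast_toZFSet_mem_iff {k l : ℕ} :
    Ordinal.toZFSet (k : Ordinal.{u}) ∈ Ordinal.toZFSet (l : Ordinal.{u}) ↔ k < l := by
  rw [Ordinal.toZFSet_mem_toZFSet_iff, Nat.cast_lt]

theorem natCast_toZFSet_inj {k l : ℕ}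
    (h : Ordinal.toZFSet (k : Ordinal.{u}) = Ordinal.toZFSet (l : Ordinal.{u})) : k = l := by
  exact_mod_cast Ordinal.toZFSet_injective h

theorem not_seqDom_nil (x : VDom α) : ¬ SeqDom [] x := fun ⟨_, hk, _⟩ => by simp at hk

theorem forall_not_seqDom_iff (hα : Order.IsSuccLimit α) (X : List (Set (VDom α))) :
    (∀ x, ¬ SeqDom X x) ↔ X = [] := by
  constructor
  · intro h
    by_contra hX
    exact h (VDom.nat hα 0) ⟨0, List.length_pos_iff.2 hX, rfl⟩
  · rintro rfl
    exact not_seqDom_nil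

/-- `x` is the numeral of the last index of `X`. -/
def SeqLast (X : List (Set (VDom α))) (x : VDom α) : Prop :=
  SeqDom X x ∧ ∀ z, SeqDom X z → ¬ x.1 ∈ z.1

theorem seqLast_iff (hα : Order.IsSuccLimit α) (X : List (Set (VDom α))) (Z : Set (VDom α))
    (x : VDom α) :
    SeqLast (X ++ [Z]) x ↔ x = VDom.nat hα X.length := by
  constructor
  · rintro ⟨⟨k, hk, hx⟩, h⟩
    have h' := h (VDom.nat hα X.length) ⟨X.length, by simp, rfl⟩
    rw [hx] at h'
    have : ¬ k < X.length := fun hlt => h' (natCast_toZFSet_mem_iff.2 hlt)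
    rw [List.length_append, List.length_singleton] at hk
    obtain rfl : k = X.length := by omega
    exact Subtype.ext hx
  · rintro rfl
    refine ⟨⟨X.length, by simp, rfl⟩, ?_⟩
    rintro z ⟨k, hk, hz⟩ h
    rw [hz] at h
    have := natCast_toZFSet_mem_iff.1 h
    rw [List.length_append, List.length_singleton] at hk
    omega

/-- The current position is the last entry played, or the parameter `A` if there is none. The
right-hand side expresses this by a first order formula. -/
theorem mem_getLastD_iff (hα : Order.IsSuccLimit α) (X : List (Set (VDom α))) (A : Set (VDom α))
    (y : VDom α) : y ∈ X.getLastD A ↔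
      (∃ x, SeqLast X x ∧ SeqEntry X x y) ∨ ((∀ x, ¬ SeqDom X x) ∧ y ∈ A) := by
  rw [forall_not_seqDom_iff hα]
  rcases List.eq_nil_or_concat' X with rfl | ⟨X, Z, rfl⟩
  · simp [SeqLast, not_seqDom_nil]
  · simp only [seqLast_iff hα, exists_eq_left, SeqEntry]
    simp only [List.append_eq_nil_iff, List.cons_ne_self, and_false, false_and, or_false,
      List.getLastD_concat]
    constructor
    · intro hy
      exact ⟨X.length, by simp, rfl, by simpa using hy⟩
    · rintro ⟨k, hk, hx, hy⟩
      obtain rfl : X.length = k := natCast_toZFSet_inj hx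
      simpa using hy

theorem mem_getLastD_dropLast_iff (hα : Order.IsSuccLimit α) (X : List (Set (VDom α)))
    (A : Set (VDom α)) (y : VDom α) : y ∈ X.dropLast.getLastD A ↔
      (∃ x, SeqLast X x ∧ ((∃ z, (z.1 ∈ x.1 ∧ ∀ w : VDom α, w.1 ∈ x.1 → ¬ z.1 ∈ w.1) ∧
        SeqEntry X z y) ∨ ((∀ z : VDom α, ¬ z.1 ∈ x.1) ∧ y ∈ A))) ∨
      ((∀ x, ¬ SeqDom X x) ∧ y ∈ A) := by
  rw [forall_not_seqDom_iff hα]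
  rcases List.eq_nil_or_concat' X with rfl | ⟨X, Z, rfl⟩
  · simp [SeqLast, not_seqDom_nil]
  · simp only [seqLast_iff hα, exists_eq_left, SeqEntry]
    simp only [List.append_eq_nil_iff, List.cons_ne_self, and_false, false_and, or_false,
      List.dropLast_concat]
    rcases List.eq_nil_or_concat' X with rfl | ⟨X, W, rfl⟩
    · simp [VDom.nat]
    · rw [List.getLastD_concat]
      have hne : ¬ ∀ z : VDom α, ¬ z.1 ∈ (VDom.nat hα (X ++ [W]).length).1 := by
        intro h
        exact h (VDom.nat hα 0) (natCast_toZFSet_mem_iff.2 (by simp))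
      simp only [hne, false_and, or_false]
      constructor
      · intro hy
        refine ⟨VDom.nat hα X.length, ⟨natCast_toZFSet_mem_iff.2 (by simp), ?_⟩,
          X.length, by simp, rfl, by simpa using hy⟩
        intro w hw hw'
        obtain ⟨a, ha, haw⟩ := Ordinal.mem_toZFSet_iff.1 hw
        rw [← haw] at hw'
        have h1 := Ordinal.toZFSet_mem_toZFSet_iff.1 hw'
        rw [List.length_append, List.length_singleton, Nat.cast_add, Nat.cast_one,
          Order.lt_add_one_iff] at ha
        exact absurd h1 (not_lt.2 ha)
      · rintro ⟨z, ⟨hz, hmax⟩, k, hk, hzk, hy⟩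
        rw [hzk] at hz hmax
        have hk' := natCast_toZFSet_mem_iff.1 hz
        have h1 := hmax (VDom.nat hα X.length) (natCast_toZFSet_mem_iff.2 (by simp))
        have h2 : ¬ k < X.length := fun h => h1 (natCast_toZFSet_mem_iff.2 h)
        rw [List.length_append, List.length_singleton] at hk'
        obtain rfl : k = X.length := by omega
        simpa using hy

end Sequences

namespace SetModels

variable {n : ℕ} (e e' : ∀ j, (Fin n → gameModels.{u}.Dom j) → gameModels.{u}.Dom j) [IsVar e]
  [IsVar e']

theorem Def.seqDom_X : gameModels.{u}.Def n fun (j : GameIndex.{u}) v => SeqDom j.X (e j v) :=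
  Def.rel₁ (I := gameModels.{u}) GameRel.domX e

theorem Def.seqDom_Y : gameModels.{u}.Def n fun (j : GameIndex.{u}) v => SeqDom j.Y (e j v) :=
  Def.rel₁ (I := gameModels.{u}) GameRel.domY e

theorem Def.seqEntry_X :
    gameModels.{u}.Def n fun (j : GameIndex.{u}) v => SeqEntry j.X (e j v) (e' j v) :=
  Def.rel₂ (I := gameModels.{u}) GameRel.entryX e e'

theorem Def.seqEntry_Y :
    gameModels.{u}.Def n fun (j : GameIndex.{u}) v => SeqEntry j.Y (e j v) (e' j v) :=
  Def.rel₂ (I := gameModels.{u}) GameRel.entryY e e'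

theorem defSet_A : gameModels.{u}.DefSet fun j : GameIndex.{u} => j.A := fun _ e _ =>
  Def.rel₁ (I := gameModels.{u}) GameRel.par e

theorem Def.seqLast_X : gameModels.{u}.Def n fun (j : GameIndex.{u}) v => SeqLast j.X (e j v) :=
  Def.and (Def.seqDom_X _) (Def.all (Def.imp (Def.seqDom_X _) (Def.not (Def.mem _ _))))

theorem Def.seqLast_Y : gameModels.{u}.Def n fun (j : GameIndex.{u}) v => SeqLast j.Y (e j v) :=
  Def.and (Def.seqDom_Y _) (Def.all (Def.imp (Def.seqDom_Y _) (Def.not (Def.mem _ _))))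

theorem defSet_last_X : gameModels.{u}.DefSet fun j : GameIndex.{u} => j.X.getLastD j.A := by
  intro n e _
  refine Def.congr ?_ fun (j : GameIndex.{u}) v => mem_getLastD_iff j.isSuccLimit j.X j.A (e j v)
  exact Def.or (Def.ex (Def.and (Def.seqLast_X _) (Def.seqEntry_X _ _)))
    (Def.and (Def.all (Def.not (Def.seqDom_X _))) (defSet_A _ _))

theorem defSet_last_Y : gameModels.{u}.DefSet fun j : GameIndex.{u} => j.Y.getLastD j.A := by
  intro n e _
  refine Def.congr ?_ fun (j : GameIndex.{u}) v => mem_getLastD_iff j.isSuccLimit j.Y j.A (e j v)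
  exact Def.or (Def.ex (Def.and (Def.seqLast_Y _) (Def.seqEntry_Y _ _)))
    (Def.and (Def.all (Def.not (Def.seqDom_Y _))) (defSet_A _ _))

theorem defSet_prev_Y :
    gameModels.{u}.DefSet fun j : GameIndex.{u} => j.Y.dropLast.getLastD j.A := by
  intro n e _
  refine Def.congr ?_ fun (j : GameIndex.{u}) v =>
    mem_getLastD_dropLast_iff j.isSuccLimit j.Y j.A (e j v)
  exact Def.or (Def.ex (Def.and (Def.seqLast_Y _) (Def.or
    (Def.ex (Def.and (Def.and (Def.mem _ _) (Def.all (Def.imp (Def.mem _ _)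
      (Def.not (Def.mem _ _))))) (Def.seqEntry_Y _ _)))
    (Def.and (Def.all (Def.not (Def.mem _ _))) (defSet_A _ _)))))
    (Def.and (Def.all (Def.not (Def.seqDom_Y _))) (defSet_A _ _))

theorem Def.X_eq_nil : gameModels.{u}.Def n fun (j : GameIndex.{u}) _ => j.X = [] :=
  Def.congr (Def.all (Def.not (Def.seqDom_X _))) fun (j : GameIndex.{u}) _ =>
    (forall_not_seqDom_iff j.isSuccLimit j.X).symm

end SetModels

theorem exists_matrix_and {P : GameIndex.{u} → Prop} (h : gameModels.{u}.Def 0 fun j _ => P j) :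
    ∃ φ : gameLang.Sentence, ∀ α A X Y, MatrixHolds α φ A X Y ↔
      ∃ hα : Order.IsSuccLimit α, P ⟨α, hα, X, Y, A⟩ := by
  obtain ⟨φ, hφ⟩ := h.exists_sentence
  refine ⟨limSentence (L := gameLang) GameRel.mem ⊓ φ, fun α A X Y => ?_⟩
  let _ := gameStructure α X Y A
  have hlim := realize_limSentence (L := gameLang) GameRel.mem (gameStructure α X Y A)
    fun _ _ => Iff.rfl
  have hinf : MatrixHolds α (limSentence (L := gameLang) GameRel.mem ⊓ φ) A X Y ↔ _ :=
    Language.Formula.realize_inf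
  rw [hinf]
  constructor
  · rintro ⟨h1, h2⟩
    exact ⟨hlim.1 h1, (hφ ⟨α, hlim.1 h1, X, Y, A⟩).1 h2⟩
  · rintro ⟨h1, h2⟩
    exact ⟨hlim.2 h1, (hφ ⟨α, h1, X, Y, A⟩).2 h2⟩

theorem exists_matrix_imp {P : GameIndex.{u} → Prop} (h : gameModels.{u}.Def 0 fun j _ => P j) :
    ∃ φ : gameLang.Sentence, ∀ α A X Y, MatrixHolds α φ A X Y ↔
      ∀ hα : Order.IsSuccLimit α, P ⟨α, hα, X, Y, A⟩ := by
  obtain ⟨φ, hφ⟩ := exists_matrix_and h.not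
  refine ⟨φ.not, fun α A X Y => ?_⟩
  let _ := gameStructure α X Y A
  have h1 : MatrixHolds α φ.not A X Y ↔ ¬ MatrixHolds α φ A X Y :=
    Language.Formula.realize_not
  rw [h1, hφ]
  push Not
  rfl

section Strategies

variable {κ γ : Ordinal.{u}} (g : SetGame κ γ) {α : Ordinal.{u}}

theorem SetGame.good_empty (hακ : α ≤ κ) (hα : Order.IsSuccLimit α)
    (hs : g.side α (restrict g.R α)) : g.good α ∅ :=
  (g.good_iff α hακ hα hs ∅ (by simp [g.rank_empty])).2 fun W hW =>
    absurd hW (g.not_move_empty α W)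

theorem SetGame.exists_move_good (hακ : α ≤ κ) (hα : Order.IsSuccLimit α)
    (hs : g.side α (restrict g.R α)) {U : Set (VDom α)} (hU : g.rank α U ≤ γ)
    (h : ¬ g.good α U) : ∃ W, g.move α (restrict g.R α) U W ∧ g.good α W := by
  rw [g.good_iff α hακ hα hs U hU] at h
  push Not at h
  exact h

theorem SetGame.not_good_of_move (hακ : α ≤ κ) (hα : Order.IsSuccLimit α)
    (hs : g.side α (restrict g.R α)) {U W : Set (VDom α)} (hU : g.rank α U ≤ γ)
    (h : g.good α U) (hW : g.move α (restrict g.R α) U W) : ¬ g.good α W :=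
  (g.good_iff α hακ hα hs U hU).1 h W hW

theorem SetGame.piWinsEven_of_good {φ : gameLang.Sentence} (hακ : α ≤ κ)
    (hα : Order.IsSuccLimit α) (hs : g.side α (restrict g.R α))
    (hφ : ∀ X Y, (g.move α (restrict g.R α) (Y.dropLast.getLastD (restrict g.R α))
        (X.getLastD (restrict g.R α)) →
      g.move α (restrict g.R α) (X.getLastD (restrict g.R α)) (Y.getLastD (restrict g.R α))) →
      MatrixHolds α φ (restrict g.R α) X Y) (δ : Ordinal.{u}) :
    ∀ X Y, g.rank α (Y.getLastD (restrict g.R α)) ≤ γ →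
      g.good α (Y.getLastD (restrict g.R α)) → PiWinsEven α φ (restrict g.R α) δ X Y := by
  induction δ using WellFoundedLT.induction with
  | ind δ ih =>
  intro X Y hrk hg
  rw [PiWinsEven]
  intro ε hε _ Z
  -- A legal move is answered by a legal move to a good position. An illegal one frees `Π` from the
  -- matrix, and the answer `∅` makes every later move of `Σ` illegal too.
  by_cases hZ : g.move α (restrict g.R α) (Y.getLastD (restrict g.R α)) Z
  · have hrZ := ((g.rank_lt _ _ _ hZ).trans_le hrk).le
    obtain ⟨W, hW, hgW⟩ := g.exists_move_good hακ hα hs hrZ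
      (g.not_good_of_move hακ hα hs hrk hg hZ)
    refine ⟨W, hφ _ _ ?_, ih ε hε _ _ ?_ ?_⟩
    · simpa only [List.getLastD_concat] using fun _ => hW
    · simpa only [List.getLastD_concat] using ((g.rank_lt _ _ _ hW).trans_le hrZ).le
    · simpa only [List.getLastD_concat] using hgW
  · refine ⟨∅, hφ _ _ ?_, ih ε hε _ _ ?_ ?_⟩
    · simpa only [List.getLastD_concat, List.dropLast_concat] using fun h => absurd h hZ
    · simp only [List.getLastD_concat, g.rank_empty, zero_le]
    · simpa only [List.getLastD_concat] using g.good_empty hακ hα hs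

/-- `Σ` follows the winning strategy of the set game. The hypothesis on `δ` says that enough odd
ordinals remain to dominate the ranks still to come, so `Σ` does not run out of ordinals first. -/
theorem SetGame.not_piWinsEven_of_not_good {φ : gameLang.Sentence} (hακ : α ≤ κ)
    (hα : Order.IsSuccLimit α) (hs : g.side α (restrict g.R α))
    (hφ : ∀ X Y, MatrixHolds α φ (restrict g.R α) X Y →
      g.move α (restrict g.R α) (Y.dropLast.getLastD (restrict g.R α))
        (X.getLastD (restrict g.R α)) →
      g.move α (restrict g.R α) (X.getLastD (restrict g.R α)) (Y.getLastD (restrict g.R α)))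
    (δ : Ordinal.{u}) :
    ∀ X Y, g.rank α (Y.getLastD (restrict g.R α)) ≤ γ →
      (∀ η < g.rank α (Y.getLastD (restrict g.R α)), ∃ ε, IsOddOrdinal ε ∧ η ≤ ε ∧ ε < δ) →
      ¬ g.good α (Y.getLastD (restrict g.R α)) → ¬ PiWinsEven α φ (restrict g.R α) δ X Y := by
  induction δ using WellFoundedLT.induction with
  | ind δ ih =>
  intro X Y hrk hδ hg hwin
  obtain ⟨Z, hZ, hgZ⟩ := g.exists_move_good hακ hα hs hrk hg
  have hrZ := g.rank_lt _ _ _ hZ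
  obtain ⟨ε, hodd, hle, hlt⟩ := hδ _ hrZ
  rw [PiWinsEven] at hwin
  obtain ⟨W, hW, hwin'⟩ := hwin ε hlt hodd Z
  have hW' := hφ _ _ hW
  simp only [List.getLastD_concat, List.dropLast_concat] at hW'
  have hW'' := hW' hZ
  have hrW := g.rank_lt _ _ _ hW''
  refine ih ε hlt _ _ ?_ ?_ ?_ hwin'
  · simpa only [List.getLastD_concat] using (hrW.trans (hrZ.trans_le hrk)).le
  · simp only [List.getLastD_concat]
    intro η hη
    obtain ⟨ε', h1, h2, h3⟩ := exists_isOddOrdinal η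
    exact ⟨ε', h1, h2, (h3.trans (Order.add_one_le_iff.2 hη)).trans_lt (hrW.trans_le hle)⟩
  · simpa only [List.getLastD_concat] using
      g.not_good_of_move hακ hα hs (hrZ.le.trans hrk) hgZ hW''

/-- In the odd game it is `Π` who must supply ordinals; the rank of the new position, rounded up to
an odd ordinal, serves. -/
theorem SetGame.piWinsOdd_of_good {φ : gameLang.Sentence} (hακ : α ≤ κ)
    (hα : Order.IsSuccLimit α) (hs : g.side α (restrict g.R α))
    (hφ : ∀ X Y, MatrixHolds α φ (restrict g.R α) X Y →
      (X = [] ∨ g.move α (restrict g.R α) (Y.dropLast.getLastD (restrict g.R α))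
        (X.getLastD (restrict g.R α))) →
      g.move α (restrict g.R α) (X.getLastD (restrict g.R α)) (Y.getLastD (restrict g.R α)))
    (δ : Ordinal.{u}) :
    ∀ X Y, g.rank α (X.getLastD (restrict g.R α)) ≤ γ →
      g.rank α (X.getLastD (restrict g.R α)) ≤ δ →
      (X = [] ∨ g.move α (restrict g.R α) (Y.getLastD (restrict g.R α))
        (X.getLastD (restrict g.R α))) →
      g.good α (X.getLastD (restrict g.R α)) → PiWinsOdd α φ (restrict g.R α) δ X Y := by
  induction δ using WellFoundedLT.induction with
  | ind δ ih =>
  intro X Y hrk hδ hleg hg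
  rw [PiWinsOdd]
  intro W hW
  have hW' := hφ _ _ hW
  simp only [List.getLastD_concat, List.dropLast_concat] at hW'
  have hW'' := hW' hleg
  have hrW := g.rank_lt _ _ _ hW''
  obtain ⟨Z, hZ, hgZ⟩ := g.exists_move_good hακ hα hs (hrW.le.trans hrk)
    (g.not_good_of_move hακ hα hs hrk hg hW'')
  have hrZ := g.rank_lt _ _ _ hZ
  obtain ⟨ε, hodd, h1, h2⟩ := exists_isOddOrdinal (g.rank α Z)
  have hε : ε < δ := (h2.trans (Order.add_one_le_iff.2 hrZ)).trans_lt (hrW.trans_le hδ)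
  refine ⟨ε, hε, hodd, Z, ih ε hε _ _ ?_ ?_ ?_ ?_⟩
  · simpa only [List.getLastD_concat] using (hrZ.trans (hrW.trans_le hrk)).le
  · simpa only [List.getLastD_concat] using h1
  · simpa only [List.getLastD_concat] using Or.inr hZ
  · simpa only [List.getLastD_concat] using hgZ

/-- After an illegal move of `Π` the matrix no longer restrains `Σ`, who plays `∅`; every reply is
illegal again, and `Π` eventually runs out of ordinals. -/
theorem SetGame.not_piWinsOdd_of_not_good {φ : gameLang.Sentence} (hακ : α ≤ κ)
    (hα : Order.IsSuccLimit α) (hs : g.side α (restrict g.R α))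
    (hφ : ∀ X Y, ((X = [] ∨ g.move α (restrict g.R α) (Y.dropLast.getLastD (restrict g.R α))
        (X.getLastD (restrict g.R α))) →
      g.move α (restrict g.R α) (X.getLastD (restrict g.R α)) (Y.getLastD (restrict g.R α))) →
      MatrixHolds α φ (restrict g.R α) X Y) (δ : Ordinal.{u}) :
    ∀ X Y, ((X ≠ [] ∧ ¬ g.move α (restrict g.R α) (Y.getLastD (restrict g.R α))
        (X.getLastD (restrict g.R α))) ∨
      (g.rank α (X.getLastD (restrict g.R α)) ≤ γ ∧
        ¬ g.good α (X.getLastD (restrict g.R α)))) →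
      ¬ PiWinsOdd α φ (restrict g.R α) δ X Y := by
  induction δ using WellFoundedLT.induction with
  | ind δ ih =>
  intro X Y hbad hwin
  rw [PiWinsOdd] at hwin
  rcases hbad with ⟨hX, hill⟩ | ⟨hrk, hg⟩
  · obtain ⟨ε, hε, -, Z, hwin'⟩ := hwin ∅ (hφ _ _ (by
      simp only [List.dropLast_concat]
      rintro (h | h)
      · exact absurd h hX
      · exact absurd h hill))
    refine ih ε hε _ _ (Or.inl ⟨by simp, ?_⟩) hwin'
    simpa only [List.getLastD_concat] using g.not_move_empty α Z
  · obtain ⟨W, hW, hgW⟩ := g.exists_move_good hακ hα hs hrk hg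
    obtain ⟨ε, hε, -, Z, hwin'⟩ := hwin W (hφ _ _ (by
      simpa only [List.getLastD_concat] using fun _ => hW))
    have hrW := (g.rank_lt _ _ _ hW).le.trans hrk
    refine ih ε hε _ _ ?_ hwin'
    simp only [List.getLastD_concat]
    by_cases hZ : g.move α (restrict g.R α) W Z
    · exact Or.inr ⟨(g.rank_lt _ _ _ hZ).le.trans hrW, g.not_good_of_move hακ hα hs hrW hgW hZ⟩
    · exact Or.inl ⟨by simp, hZ⟩

theorem not_piWinsOdd_of_forall {φ : gameLang.Sentence} {A : Set (VDom α)}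
    (hφ : ∀ X Y, MatrixHolds α φ A X Y) (δ : Ordinal.{u}) : ∀ X Y, ¬ PiWinsOdd α φ A δ X Y := by
  induction δ using WellFoundedLT.induction with
  | ind δ ih =>
  intro X Y hwin
  rw [PiWinsOdd] at hwin
  obtain ⟨ε, hε, -, Z, hwin'⟩ := hwin ∅ (hφ _ _)
  exact ih ε hε _ _ hwin'

/-- The limit and side conditions are premises of the matrix in the odd game, where it binds `Σ`,
and conjuncts in the even game, where it binds `Π`. The even game needs at least one possible round
to enforce them, hence `1 ≤ γ`. -/
theorem SetGame.exists_piWins_iff (hγ : 1 ≤ γ) :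
    ∃ φ, ∀ α ≤ κ, PiWins γ α φ (restrict g.R α) ↔ g.Holds α := by
  by_cases hodd : IsOddOrdinal γ
  · obtain ⟨φ, hφ⟩ := exists_matrix_imp (P := fun j => g.side j.ord j.A →
      (j.X = [] ∨ g.move j.ord j.A (j.Y.dropLast.getLastD j.A) (j.X.getLastD j.A)) →
      g.move j.ord j.A (j.X.getLastD j.A) (j.Y.getLastD j.A))
      (SetModels.Def.imp (g.side_def _ _ SetModels.defSet_A)
      (SetModels.Def.imp (SetModels.Def.or SetModels.Def.X_eq_nil
        (g.move_def _ _ _ _ SetModels.defSet_A SetModels.defSet_prev_Y SetModels.defSet_last_X))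
        (g.move_def _ _ _ _ SetModels.defSet_A SetModels.defSet_last_X SetModels.defSet_last_Y)))
    refine ⟨φ, fun α hακ => ?_⟩
    simp only [PiWins, hodd, true_imp_iff, not_true_eq_false, false_imp_iff, and_true]
    constructor
    · intro hwin
      have hα : Order.IsSuccLimit α := by
        by_contra hα
        exact not_piWinsOdd_of_forall (fun X Y => (hφ _ _ _ _).2 fun h => absurd h hα) _ _ _ hwin
      have hs : g.side α (restrict g.R α) := by
        by_contra hs
        exact not_piWinsOdd_of_forall (fun X Y => (hφ _ _ _ _).2 fun _ h => absurd h hs) _ _ _ hwin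
      refine ⟨hα, hs, ?_⟩
      by_contra hg
      refine g.not_piWinsOdd_of_not_good hακ hα hs (fun X Y h => (hφ _ _ _ _).2 fun _ _ => h)
        γ [] [] (Or.inr ⟨g.rank_le α hακ hα hs, hg⟩) hwin
    · rintro ⟨hα, hs, hg⟩
      exact g.piWinsOdd_of_good hακ hα hs (fun X Y h => (hφ _ _ _ _).1 h hα hs) γ [] []
        (g.rank_le α hακ hα hs) (g.rank_le α hακ hα hs) (Or.inl rfl) hg
  · obtain ⟨φ, hφ⟩ := exists_matrix_and (P := fun j => g.side j.ord j.A ∧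
      (g.move j.ord j.A (j.Y.dropLast.getLastD j.A) (j.X.getLastD j.A) →
      g.move j.ord j.A (j.X.getLastD j.A) (j.Y.getLastD j.A))) (SetModels.Def.and (g.side_def _ _ SetModels.defSet_A)
      (SetModels.Def.imp
        (g.move_def _ _ _ _ SetModels.defSet_A SetModels.defSet_prev_Y SetModels.defSet_last_X)
        (g.move_def _ _ _ _ SetModels.defSet_A SetModels.defSet_last_X SetModels.defSet_last_Y)))
    refine ⟨φ, fun α hακ => ?_⟩
    simp only [PiWins, hodd, false_imp_iff, not_false_eq_true, true_imp_iff, true_and]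
    have h1odd : IsOddOrdinal (1 : Ordinal.{u}) :=
      ⟨0, 1, Order.isSuccPrelimit_bot, odd_one, by simp⟩
    constructor
    · intro hwin
      obtain ⟨hα, hs⟩ : ∃ _ : Order.IsSuccLimit α, g.side α (restrict g.R α) := by
        have hwin' := hwin
        rw [PiWinsEven] at hwin'
        obtain ⟨W, hW, -⟩ := hwin' 1 (lt_of_le_of_ne hγ fun h => hodd (h ▸ h1odd)) h1odd ∅
        obtain ⟨hα, hs, -⟩ := (hφ _ _ _ _).1 hW
        exact ⟨hα, hs⟩
      refine ⟨hα, hs, ?_⟩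
      by_contra hg
      refine g.not_piWinsEven_of_not_good hακ hα hs
        (fun X Y h => ((hφ _ _ _ _).1 h).elim fun _ h => h.2) γ [] [] (g.rank_le α hακ hα hs)
        (fun η hη => ?_) hg hwin
      obtain ⟨ε, h1, h2, h3⟩ := exists_isOddOrdinal η
      refine ⟨ε, h1, h2, lt_of_le_of_ne (h3.trans ?_) fun h => hodd (h ▸ h1)⟩
      exact Order.add_one_le_iff.2 (lt_of_lt_of_le hη (g.rank_le α hακ hα hs))
    · rintro ⟨hα, hs, hg⟩
      exact g.piWinsEven_of_good hακ hα hs (fun X Y h => (hφ _ _ _ _).2 ⟨hα, hs, h⟩) γ [] []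
        (g.rank_le α hακ hα hs) hg

end Strategies

theorem IsIndescribable.reflectsGames {γ : Ordinal.{u}} {κ : Cardinal.{u}} (hγ : 1 ≤ γ)
    (h : IsIndescribable γ κ) : ReflectsGames γ κ.ord := by
  intro g hg
  obtain ⟨φ, hφ⟩ := g.exists_piWins_iff hγ
  obtain ⟨α, hα, hwin⟩ := h φ g.R g.R_mem ((hφ _ le_rfl).2 hg)
  exact ⟨α, hα, (hφ α hα.le).1 hwin⟩

/-! ### Translation of games of finite rank into second order sentences. -/

/-- An index of a structure with finitely many set variables. -/
structure SecondOrderIndex : Type (u + 1) where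
  ord : Ordinal.{u}
  isSuccLimit : Order.IsSuccLimit ord
  R : Set (VDom ord)
  X : List (Set (VDom ord))

/-- The structures in which the matrices of second order sentences are evaluated. -/
def secondOrderModels : SetModels.{u} where
  L := secondOrderLang
  J := SecondOrderIndex.{u}
  ord := SecondOrderIndex.ord
  isSuccLimit := SecondOrderIndex.isSuccLimit
  str j := secondOrderStructure j.ord j.R j.X
  memRel := SecondOrderRel.mem
  memRel_iff _ _ _ := Iff.rfl

section Positions

variable {α : Ordinal.{u}}

/-- The position after `k` moves. -/
def position (R : Set (VDom α)) (X : List (Set (VDom α))) : ℕ → Set (VDom α)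
  | 0 => R
  | k + 1 => X.getD k ∅

/-- `Π` wins the play `X` at one of the first `k` moves, or nobody lost it there and `p` holds;
the moves with even number are those of `Σ`. -/
def PlayWon (M : Set (VDom α) → Set (VDom α) → Prop) (R : Set (VDom α))
    (X : List (Set (VDom α))) : ℕ → Prop → Prop
  | 0, p => p
  | k + 1, p => PlayWon M R X k
      ((Even k → M (position R X k) (position R X (k + 1)) → p) ∧
        (¬ Even k → M (position R X k) (position R X (k + 1)) ∧ p))

variable {M : Set (VDom α) → Set (VDom α) → Prop} {R : Set (VDom α)} {X : List (Set (VDom α))}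

theorem position_append (Z : Set (VDom α)) {k : ℕ} (hk : k ≤ X.length) :
    position R (X ++ [Z]) k = position R X k := by
  cases k with
  | zero => rfl
  | succ k => simp [position, List.getElem?_append_left (show k < X.length by omega)]

theorem position_append_length (Z : Set (VDom α)) :
    position R (X ++ [Z]) (X.length + 1) = Z := by
  simp [position]

theorem playWon_append (Z : Set (VDom α)) {k : ℕ} (hk : k ≤ X.length) (p : Prop) :
    PlayWon M R (X ++ [Z]) k p ↔ PlayWon M R X k p := by
  induction k generalizing p with
  | zero => rfl
  | succ k ih =>
    rw [PlayWon, PlayWon, ih (by omega), position_append Z hk, position_append Z (by omega)]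

theorem playWon_congr {k : ℕ} {p q : Prop}
    (h : (∀ i < k, M (position R X i) (position R X (i + 1))) → (p ↔ q)) :
    PlayWon M R X k p ↔ PlayWon M R X k q := by
  induction k generalizing p q with
  | zero => exact h (by simp)
  | succ k ih =>
    rw [PlayWon, PlayWon]
    refine ih fun hk => ?_
    by_cases hM : M (position R X k) (position R X (k + 1))
    · rw [h fun i hi => ?_]
      rcases Nat.lt_succ_iff_lt_or_eq.1 hi with hi | rfl
      · exact hk i hi
      · exact hM
    · simp [hM]

/-- Legality of earlier moves does not involve the new variable, so set quantifiers move out of the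
guards; this brings the game into prenex form. -/
theorem playWon_forall {ι : Type*} [Nonempty ι] {k : ℕ} {p : ι → Prop} :
    (∀ z, PlayWon M R X k (p z)) ↔ PlayWon M R X k (∀ z, p z) := by
  induction k generalizing p with
  | zero => rfl
  | succ k ih =>
    simp only [PlayWon]
    rw [ih]
    refine playWon_congr fun _ => ?_
    by_cases hk : Even k <;> simp [hk, forall_and, forall_const]
    exact ⟨fun h hM z => h z hM, fun h z hM => h hM z⟩

theorem playWon_exists {ι : Type*} [Nonempty ι] {k : ℕ} {p : ι → Prop} :
    (∃ z, PlayWon M R X k (p z)) ↔ PlayWon M R X k (∃ z, p z) := by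
  induction k generalizing p with
  | zero => rfl
  | succ k ih =>
    simp only [PlayWon]
    rw [ih]
    refine playWon_congr fun _ => ?_
    by_cases hk : Even k <;> by_cases hM : M (position R X k) (position R X (k + 1)) <;>
      simp [hk, hM]

end Positions

namespace SetModels

theorem defSet_R : secondOrderModels.{u}.DefSet fun j : SecondOrderIndex.{u} => j.R :=
  fun _ e _ => Def.rel₁ (I := secondOrderModels.{u}) SecondOrderRel.par e

theorem defSet_position (k : ℕ) :
    secondOrderModels.{u}.DefSet fun j : SecondOrderIndex.{u} => position j.R j.X k := by
  cases k with
  | zero => exact defSet_R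
  | succ k => exact fun _ e _ => Def.rel₁ (I := secondOrderModels.{u}) (SecondOrderRel.var k) e

theorem Def.playWon {κ γ : Ordinal.{u}} (g : SetGame κ γ) (k : ℕ)
    {p : SecondOrderIndex.{u} → Prop} (hp : secondOrderModels.{u}.Def 0 fun j _ => p j) :
    secondOrderModels.{u}.Def 0 fun (j : SecondOrderIndex.{u}) _ =>
      PlayWon (g.move j.ord j.R) j.R j.X k (p j) := by
  induction k generalizing p with
  | zero => exact hp
  | succ k ih =>
    have hm : secondOrderModels.{u}.Def 0 fun (j : SecondOrderIndex.{u}) _ =>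
        g.move j.ord j.R (position j.R j.X k) (position j.R j.X (k + 1)) :=
      g.move_def _ _ _ _ defSet_R (defSet_position k) (defSet_position (k + 1))
    exact ih (Def.and (Def.imp (Def.const _) (Def.imp hm hp))
      (Def.imp (Def.const _) (Def.and hm hp)))

end SetModels

theorem exists_secondOrder_matrix {P : SecondOrderIndex.{u} → Prop}
    (h : secondOrderModels.{u}.Def 0 fun j _ => P j) :
    ∃ ψ : secondOrderLang.Sentence, ∀ α R X b, AltHolds α ψ R 0 b X ↔
      ∃ hα : Order.IsSuccLimit α, P ⟨α, hα, R, X⟩ := by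
  obtain ⟨φ, hφ⟩ := h.exists_sentence
  refine ⟨limSentence (L := secondOrderLang) SecondOrderRel.mem ⊓ φ, fun α R X b => ?_⟩
  let _ := secondOrderStructure α R X
  have hlim := realize_limSentence (L := secondOrderLang) SecondOrderRel.mem
    (secondOrderStructure α R X) fun _ _ => Iff.rfl
  have hinf : AltHolds α (limSentence (L := secondOrderLang) SecondOrderRel.mem ⊓ φ) R 0 b X ↔ _ :=
    Language.Formula.realize_inf
  rw [hinf]
  constructor
  · rintro ⟨h1, h2⟩
    exact ⟨hlim.1 h1, (hφ ⟨α, hlim.1 h1, R, X⟩).1 h2⟩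
  · rintro ⟨h1, h2⟩
    exact ⟨hlim.2 h1, (hφ ⟨α, h1, R, X⟩).2 h2⟩

theorem AltHolds.exists_matrix {α : Ordinal.{u}} {ψ : secondOrderLang.Sentence} {R : Set (VDom α)}
    {n : ℕ} {b : Bool} {X : List (Set (VDom α))} (h : AltHolds α ψ R n b X) :
    ∃ X' b', AltHolds α ψ R 0 b' X' := by
  induction n generalizing b X with
  | zero => exact ⟨X, b, h⟩
  | succ n ih =>
    cases b with
    | true => exact ih (h ∅)
    | false =>
      obtain ⟨Z, hZ⟩ := h
      exact ih hZ

section Strategies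

variable {κ : Ordinal.{u}} {n : ℕ} (g : SetGame κ n) {α : Ordinal.{u}}

theorem SetGame.rank_position_le (hακ : α ≤ κ) (hα : Order.IsSuccLimit α)
    (hs : g.side α (restrict g.R α)) {X : List (Set (VDom α))} {k m : ℕ} (hkm : k + m = n)
    (h : ∀ i < k, g.move α (restrict g.R α) (position (restrict g.R α) X i)
      (position (restrict g.R α) X (i + 1))) :
    g.rank α (position (restrict g.R α) X k) ≤ m := by
  induction k generalizing m with
  | zero =>
    obtain rfl : m = n := by omega
    exact g.rank_le α hακ hα hs
  | succ k ih =>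
    have h1 := ih (m := m + 1) (by omega) fun i hi => h i (by omega)
    have h2 := (g.rank_lt _ _ _ (h k (by omega))).trans_le h1
    rwa [Nat.cast_add, Nat.cast_one, Order.lt_add_one_iff] at h2

/-- Induction on the number `m` of remaining quantifiers. After `n` legal moves the rank is `0` and
the player to move is stuck, so `Π` has won exactly when `n` is even. This explains the end
condition `Even n` in the matrix. -/
theorem SetGame.altHolds_iff {ψ : secondOrderLang.Sentence} (hακ : α ≤ κ)
    (hα : Order.IsSuccLimit α) (hs : g.side α (restrict g.R α))
    (hψ : ∀ X b, AltHolds α ψ (restrict g.R α) 0 b X ↔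
      PlayWon (g.move α (restrict g.R α)) (restrict g.R α) X n (Even n))
    (m : ℕ) : ∀ (b : Bool) (X : List (Set (VDom α))), X.length + m = n →
      (b = true ↔ Even X.length) →
      (AltHolds α ψ (restrict g.R α) m b X ↔
        PlayWon (g.move α (restrict g.R α)) (restrict g.R α) X X.length
          (Even X.length ↔ g.good α (position (restrict g.R α) X X.length))) := by
  induction m with
  | zero =>
    intro b X hX _
    rw [add_zero] at hX
    rw [hψ, hX]
    refine playWon_congr fun h => ?_
    have hrk := g.rank_position_le hακ hα hs (m := 0) (add_zero n) h
    have hg : g.good α (position (restrict g.R α) X n) := by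
      refine (g.good_iff α hακ hα hs _ (hrk.trans (by simp))).2 fun W hW => ?_
      exact absurd ((g.rank_lt _ _ _ hW).trans_le hrk) (by simp)
    simp [hg]
  | succ m ih =>
    intro b X hX hb
    have hstep : ∀ b' Z, (b' = true ↔ ¬ Even X.length) →
        (AltHolds α ψ (restrict g.R α) m b' (X ++ [Z]) ↔
        PlayWon (g.move α (restrict g.R α)) (restrict g.R α) X X.length
          ((Even X.length → g.move α (restrict g.R α) (position (restrict g.R α) X X.length) Z →
              ¬ g.good α Z) ∧
            (¬ Even X.length →
              g.move α (restrict g.R α) (position (restrict g.R α) X X.length) Z ∧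
              g.good α Z))) := by
      intro b' Z hb'
      rw [ih b' (X ++ [Z]) (by simp; omega) (by simpa [parity_simps] using hb'),
        List.length_append, List.length_singleton, PlayWon, playWon_append Z le_rfl,
        position_append_length, position_append Z le_rfl]
      refine playWon_congr fun _ => ?_
      by_cases hev : Even X.length <;> simp [hev, parity_simps]
    have hgood : (∀ i < X.length, g.move α (restrict g.R α) (position (restrict g.R α) X i)
        (position (restrict g.R α) X (i + 1))) →
        (g.good α (position (restrict g.R α) X X.length) ↔
          ∀ W, g.move α (restrict g.R α) (position (restrict g.R α) X X.length) W →
            ¬ g.good α W) := fun h =>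
      g.good_iff α hακ hα hs _ ((g.rank_position_le hακ hα hs hX h).trans (by
        rw [Nat.cast_le]; omega))
    by_cases hev : Even X.length
    · obtain rfl : b = true := hb.2 hev
      simp only [AltHolds]
      rw [forall_congr' fun Z => hstep false Z (by simp [hev]), playWon_forall]
      refine playWon_congr fun h => ?_
      rw [hgood h]
      simp [hev]
    · obtain rfl : b = false := by
        cases b with
        | true => exact absurd (hb.1 rfl) hev
        | false => rfl
      simp only [AltHolds]
      rw [exists_congr fun Z => hstep true Z (by simp [hev]), playWon_exists]
      refine playWon_congr fun h => ?_
      rw [hgood h]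
      simp [hev]

theorem SetGame.exists_altHolds_iff :
    ∃ ψ, ∀ α ≤ κ, AltHolds α ψ (restrict g.R α) n true [] ↔ g.Holds α := by
  obtain ⟨ψ, hψ⟩ := exists_secondOrder_matrix (P := fun j => g.side j.ord j.R ∧
      PlayWon (g.move j.ord j.R) j.R j.X n (Even n))
    (SetModels.Def.and (g.side_def _ _ SetModels.defSet_R)
      (SetModels.Def.playWon g n (SetModels.Def.const _)))
  refine ⟨ψ, fun α hακ => ?_⟩
  have key : ∀ (hα : Order.IsSuccLimit α) (hs : g.side α (restrict g.R α)),
      (AltHolds α ψ (restrict g.R α) n true [] ↔ g.good α (restrict g.R α)) := by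
    intro hα hs
    refine (g.altHolds_iff hακ hα hs (fun X b => ?_) n true [] (by simp) (by simp)).trans ?_
    · rw [hψ]
      exact ⟨fun ⟨_, _, h⟩ => h, fun h => ⟨hα, hs, h⟩⟩
    · simp [PlayWon, position]
  constructor
  · intro h
    obtain ⟨X, b, h'⟩ := h.exists_matrix
    obtain ⟨hα, hs, -⟩ := (hψ _ _ _ _).1 h'
    exact ⟨hα, hs, (key hα hs).1 h⟩
  · rintro ⟨hα, hs, hg⟩
    exact (key hα hs).2 hg

end Strategies

theorem IsFinIndescribable.reflectsGames {n : ℕ} {κ : Cardinal.{u}}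
    (h : IsFinIndescribable n κ) : ReflectsGames n κ.ord := by
  intro g hg
  obtain ⟨ψ, hψ⟩ := g.exists_altHolds_iff
  obtain ⟨α, hα, hwin⟩ := h.2 ψ g.R g.R_mem ((hψ _ le_rfl).2 hg)
  exact ⟨α, hα, (hψ α hα.le).1 hwin⟩

/-! ### Coding ordinals and sets of ordinals in `V_α`. -/

section Coding

/-- The set of the elements of `S` below `β`, as a set of von Neumann ordinals. -/
noncomputable def segment (S : Set Ordinal.{u}) (β : Ordinal.{u}) : ZFSet.{u} :=
  ZFSet.sep (fun x => ∃ ξ ∈ S, x = ξ.toZFSet) β.toZFSet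

theorem toZFSet_mem_segment {S : Set Ordinal.{u}} {β ξ : Ordinal.{u}} :
    ξ.toZFSet ∈ segment S β ↔ ξ < β ∧ ξ ∈ S := by
  rw [segment, ZFSet.mem_sep, Ordinal.toZFSet_mem_toZFSet_iff]
  refine and_congr_right fun _ => ⟨?_, fun h => ⟨ξ, h, rfl⟩⟩
  rintro ⟨ζ, hζ, h⟩
  rwa [Ordinal.toZFSet_injective h]

theorem segment_subset (S : Set Ordinal.{u}) (β : Ordinal.{u}) : segment S β ⊆ β.toZFSet :=
  fun _ hx => (ZFSet.mem_sep.1 hx).1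

theorem rank_segment_le (S : Set Ordinal.{u}) (β : Ordinal.{u}) : (segment S β).rank ≤ β := by
  simpa using ZFSet.rank_mono (segment_subset S β)

/-- This lets one subset of `V_α` store ordinals and pairs without confusion. -/
theorem not_isOrdinal_pair (x y : ZFSet.{u}) : ¬ (ZFSet.pair x y).IsOrdinal := by
  intro h
  have h1 : ({x} : ZFSet.{u}) ∈ ZFSet.pair x y := by simp [ZFSet.pair]
  have hx : x ∈ ZFSet.pair x y := h.mem_trans (ZFSet.mem_singleton.2 rfl) h1
  have hirr : ∀ z : ZFSet.{u}, x ∈ z → z ≠ x := fun z hz hzx => ZFSet.mem_irrefl x (hzx ▸ hz)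
  have hx' : x = {x} ∨ x = {x, y} := by simpa [ZFSet.pair] using hx
  rcases hx' with h | h
  · exact hirr {x} (by simp) h.symm
  · exact hirr {x, y} (by simp) h.symm

variable {α : Ordinal.{u}}

/-- The ordinal `ξ` as an element of `V_α`. -/
noncomputable def VDom.ofOrd {ξ : Ordinal.{u}} (h : ξ < α) : VDom α :=
  ⟨ξ.toZFSet, by rwa [ZFSet.mem_vonNeumann, Ordinal.rank_toZFSet]⟩

theorem VDom.exists_eq_ofOrd {x : VDom α} (hx : x.1.IsOrdinal) :
    ∃ ξ, ∃ h : ξ < α, x = VDom.ofOrd h :=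
  ⟨x.1.rank, ZFSet.mem_vonNeumann.1 x.2, Subtype.ext hx.toZFSet_rank_eq.symm⟩

theorem VDom.isOrdinal_ofOrd {ξ : Ordinal.{u}} (h : ξ < α) : (VDom.ofOrd h).1.IsOrdinal :=
  ZFSet.isOrdinal_toZFSet ξ

theorem VDom.forall_isOrdinal {P : VDom α → Prop} :
    (∀ x : VDom α, x.1.IsOrdinal → P x) ↔ ∀ ξ, ∀ h : ξ < α, P (VDom.ofOrd h) := by
  constructor
  · exact fun H ξ h => H _ (VDom.isOrdinal_ofOrd h)
  · intro H x hx
    obtain ⟨ξ, h, rfl⟩ := VDom.exists_eq_ofOrd hx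
    exact H ξ h

theorem VDom.exists_isOrdinal {P : VDom α → Prop} :
    (∃ x : VDom α, x.1.IsOrdinal ∧ P x) ↔ ∃ ξ, ∃ h : ξ < α, P (VDom.ofOrd h) := by
  constructor
  · rintro ⟨x, hx, H⟩
    obtain ⟨ξ, h, rfl⟩ := VDom.exists_eq_ofOrd hx
    exact ⟨ξ, h, H⟩
  · rintro ⟨ξ, h, H⟩
    exact ⟨_, VDom.isOrdinal_ofOrd h, H⟩

theorem VDom.mem_ofOrd_iff {β : Ordinal.{u}} {h : β < α} {x : VDom α} :
    x.1 ∈ (VDom.ofOrd h).1 ↔ ∃ ξ, ∃ hξ : ξ < β, x = VDom.ofOrd (hξ.trans h) := by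
  constructor
  · intro hx
    obtain ⟨ξ, hξ, he⟩ := Ordinal.mem_toZFSet_iff.1 hx
    exact ⟨ξ, hξ, Subtype.ext he.symm⟩
  · rintro ⟨ξ, hξ, rfl⟩
    exact Ordinal.toZFSet_mem_toZFSet_iff.2 hξ

/-- The initial segment of `S` below `β < α` as an element of `V_α`. -/
noncomputable def VDom.segment (S : Set Ordinal.{u}) {β : Ordinal.{u}} (h : β < α) : VDom α :=
  ⟨HigherStat.segment S β, ZFSet.mem_vonNeumann.2 ((rank_segment_le S β).trans_lt h)⟩

theorem VDom.mem_segment_iff (S : Set Ordinal.{u}) {β : Ordinal.{u}} (h : β < α) (x : VDom α) :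
    x.1 ∈ (VDom.segment S h).1 ↔ x.1 ∈ (VDom.ofOrd h).1 ∧ x.1.rank ∈ S := by
  constructor
  · intro hx
    have h1 : x.1 ∈ (VDom.ofOrd h).1 := segment_subset S β hx
    refine ⟨h1, ?_⟩
    obtain ⟨ξ, hξ, rfl⟩ := VDom.mem_ofOrd_iff.1 h1
    have := (toZFSet_mem_segment.1 hx).2
    simpa [VDom.ofOrd] using this
  · rintro ⟨h1, h2⟩
    obtain ⟨ξ, hξ, rfl⟩ := VDom.mem_ofOrd_iff.1 h1
    exact toZFSet_mem_segment.2 ⟨hξ, by simpa [VDom.ofOrd] using h2⟩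

end Coding

/-- If the values were unbounded, a branch through the increasing sets `{i | f i ≤ a}` would contain
every `i < l`, yet below `l` it agrees with one of these sets, which omits some `i`. -/
theorem BranchProperty.exists_bound {κ : Cardinal.{u}} (hκ : BranchProperty κ) {l : Ordinal.{u}}
    (hl : l < κ.ord) (f : Ordinal.{u} → Ordinal.{u}) (hf : ∀ i < l, f i < κ.ord) :
    ∃ δ < κ.ord, ∀ i < l, f i ≤ δ := by
  by_contra! hcon
  obtain ⟨b, hb⟩ := hκ fun a => {i | f i ≤ a}
  obtain ⟨a, ha, -, he⟩ := hb l hl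
  obtain ⟨i, hi, hai⟩ := hcon a ha
  obtain ⟨a', ha', hle, he'⟩ := hb _ (max_lt hl (hf i hi))
  have h1 : i ∈ {i | f i ≤ a'} ∩ Iio (max l (f i)) :=
    ⟨(le_max_right _ _).trans hle, lt_max_of_lt_left hi⟩
  rw [he'] at h1
  have h2 : i ∈ b ∩ Iio l := ⟨h1.1, hi⟩
  rw [← he] at h2
  exact absurd hai (not_lt.2 h2.1)

/-! ### The branch property from reflection of games. -/

section Tree

variable {α : Ordinal.{u}}

/-- The empty set is an element of `U`. -/
def HasEmpty (U : Set (VDom α)) : Prop := ∃ z ∈ U, ∀ y : VDom α, ¬ y.1 ∈ z.1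

/-- The set coded by `W` is a branch of the tree `A`. -/
def IsBranch (A W : Set (VDom α)) : Prop :=
  ∀ b : VDom α, b.1.IsOrdinal → ∃ s : VDom α,
    (∀ x : VDom α, x.1 ∈ s.1 ↔ x.1 ∈ b.1 ∧ InSec W x x) ∧ InSec A b s

/-- The tree of the initial segments of the terms of `t`, with an additional mark `∅`. -/
def treeParam (κ : Ordinal.{u}) (t : Ordinal.{u} → Set Ordinal.{u}) : Set ZFSet.{u} :=
  {x | x = ∅ ∨ ∃ a < κ, ∃ β ≤ a, x = ZFSet.pair β.toZFSet (segment (t a) β)}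

open Classical in
/-- The game in which the first player has to play a branch of a tree. -/
noncomputable def treeGame {κ γ : Ordinal.{u}} (hκ : Order.IsSuccLimit κ) (hγ : 1 ≤ γ)
    (t : Ordinal.{u} → Set Ordinal.{u}) : SetGame κ γ where
  R := treeParam κ t
  R_mem := by
    rintro x (rfl | ⟨a, ha, β, hβ, rfl⟩)
    · rw [ZFSet.mem_vonNeumann, ZFSet.rank_empty]
      exact hκ.bot_lt
    · rw [ZFSet.mem_vonNeumann]
      exact rank_pair_lt hκ (by simpa using hβ.trans_lt ha)
        ((rank_segment_le _ _).trans_lt (hβ.trans_lt ha))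
  side _ _ := True
  move _ A U W := HasEmpty U ∧ ¬ HasEmpty W ∧ IsBranch A W
  side_def _ _ _ := SetModels.Def.const _
  move_def I A U W hA hU hW := by
    have hE : ∀ U : ∀ j, Set (I.Dom j), I.DefSet U → I.Def 0 fun j _ => HasEmpty (U j) :=
      fun U hU => SetModels.Def.ex (SetModels.Def.and (hU _ _)
        (SetModels.Def.all (SetModels.Def.not (SetModels.Def.mem _ _))))
    refine SetModels.Def.and (hE U hU) (SetModels.Def.and (SetModels.Def.not (hE W hW)) ?_)
    exact SetModels.Def.all (SetModels.Def.imp (SetModels.Def.isOrdinal _) (SetModels.Def.ex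
      (SetModels.Def.and (SetModels.Def.all (SetModels.Def.iff (SetModels.Def.mem _ _)
        (SetModels.Def.and (SetModels.Def.mem _ _) (SetModels.Def.inSec _ _ hW))))
        (SetModels.Def.inSec _ _ hA))))
  good α U := ∀ W, ¬ (HasEmpty U ∧ ¬ HasEmpty W ∧ IsBranch (restrict (treeParam κ t) α) W)
  -- The mark `∅` belongs to the initial position and is forbidden after a move, so only one move is
  -- possible.
  rank _ U := if HasEmpty U then 1 else 0
  not_move_empty := by
    rintro α W ⟨⟨z, hz, -⟩, -⟩
    exact hz
  rank_empty α := if_neg fun ⟨z, hz, _⟩ => hz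
  rank_lt := by
    rintro α U W ⟨h1, h2, -⟩
    rw [if_pos h1, if_neg h2]
    exact zero_lt_one
  rank_le := by
    intro α _ _ _
    split_ifs
    · exact hγ
    · exact zero_le
  good_iff := by
    intro α _ _ _ U _
    constructor
    · exact fun h W hW => absurd hW (h W)
    · exact fun h W hW => h W hW fun W' hW' => hW.2.1 hW'.1

/-- Without a branch, `Π` wins the tree game over `V_κ` and hence over some `V_α`. But there the
term `t α` itself is a branch, since the parameter includes its initial segments below every `β ≤
α`. -/
theorem ReflectsGames.branchProperty {κ : Cardinal.{u}} {γ : Ordinal.{u}}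
    (hκ : Order.IsSuccLimit κ.ord) (hγ : 1 ≤ γ) (h : ReflectsGames γ κ.ord) :
    BranchProperty κ := by
  intro t
  by_contra hcon
  have hne : ∀ x y : ZFSet.{u}, ZFSet.pair x y ≠ ∅ := fun x y h0 =>
    not_isOrdinal_pair x y (h0 ▸ ZFSet.isOrdinal_empty)
  obtain ⟨α, hακ, hα, -, hg⟩ := h (treeGame hκ hγ t) ⟨hκ, trivial, by
    rintro W ⟨-, -, hW⟩
    refine hcon ⟨{ξ | ∃ h : ξ < κ.ord, InSec W (VDom.ofOrd h) (VDom.ofOrd h)}, fun β hβ => ?_⟩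
    obtain ⟨s, hs, p, hp, hps⟩ := hW (VDom.ofOrd hβ) (VDom.isOrdinal_ofOrd hβ)
    rcases hp with hp | ⟨a, ha, β', hβ', hp⟩
    · exact absurd (hps.symm.trans hp) (hne _ _)
    · obtain ⟨h1, h2⟩ := ZFSet.pair_inj.1 (hps.symm.trans hp)
      obtain rfl : β = β' := Ordinal.toZFSet_injective h1
      refine ⟨a, ha, hβ', ?_⟩
      ext ξ
      simp only [mem_inter_iff, mem_Iio, and_congr_left_iff]
      intro hξ
      have h3 := hs (VDom.ofOrd (hξ.trans hβ))
      rw [h2] at h3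
      have h4 : ξ ∈ t a ↔ ξ.toZFSet ∈ segment (t a) β := by simp [toZFSet_mem_segment, hξ]
      rw [h4]
      refine h3.trans ⟨fun h => ⟨_, h.2⟩, fun ⟨_, h⟩ => ⟨?_, h⟩⟩
      exact Ordinal.toZFSet_mem_toZFSet_iff.2 hξ⟩
  refine hg {p | ∃ ξ ∈ t α, p.1 = ZFSet.pair ξ.toZFSet ξ.toZFSet} ⟨?_, ?_, ?_⟩
  · refine ⟨⟨∅, ?_⟩, Or.inl rfl, fun y => ZFSet.notMem_empty _⟩
    rw [ZFSet.mem_vonNeumann, ZFSet.rank_empty]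
    exact hα.bot_lt
  · rintro ⟨p, ⟨ξ, -, hp⟩, hemp⟩
    have hmem : ({ξ.toZFSet} : ZFSet.{u}) ∈ p.1 := by rw [hp]; simp [ZFSet.pair]
    exact hemp ⟨_, p.mem_trans hmem⟩ hmem
  · intro b hb
    obtain ⟨β, hβ, rfl⟩ := VDom.exists_eq_ofOrd hb
    refine ⟨VDom.segment (t α) hβ, fun x => ?_,
      VDom.pair hα (VDom.ofOrd hβ) (VDom.segment (t α) hβ), Or.inr ⟨α, hακ, β, hβ.le, rfl⟩, rfl⟩
    rw [VDom.mem_segment_iff]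
    refine and_congr_right fun hx => ?_
    obtain ⟨ξ, hξ, rfl⟩ := VDom.mem_ofOrd_iff.1 hx
    have hr : (VDom.ofOrd (hξ.trans hβ)).1.rank = ξ := by simp [VDom.ofOrd]
    rw [hr]
    constructor
    · intro h
      exact ⟨VDom.pair hα (VDom.ofOrd (hξ.trans hβ)) (VDom.ofOrd (hξ.trans hβ)),
        ⟨ξ, h, rfl⟩, rfl⟩
    · rintro ⟨p, ⟨ζ, hζ, hp⟩, hp'⟩
      obtain ⟨h1, -⟩ := ZFSet.pair_inj.1 (hp.symm.trans hp')
      rwa [← Ordinal.toZFSet_injective h1]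

end Tree

/-! ### The stationarity game. -/

section Formulas

variable {α : Ordinal.{u}}

/-- `x` is the only ordinal that is an element of `U`. -/
def HasRank (U : Set (VDom α)) (x : VDom α) : Prop :=
  (x ∈ U ∧ x.1.IsOrdinal) ∧ ∀ y ∈ U, y.1.IsOrdinal → y = x

/-- The section of `U` at `i` contains an ordinal. -/
def SecNonempty (U : Set (VDom α)) (i : VDom α) : Prop :=
  ∃ x : VDom α, x.1.IsOrdinal ∧ InSec U i x

/-- All nonempty sections of `U` are unbounded. -/
def SecsUnbounded (U : Set (VDom α)) : Prop :=
  ∀ i : VDom α, SecNonempty U i → ∀ b : VDom α, b.1.IsOrdinal →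
    ∃ x : VDom α, x.1.IsOrdinal ∧ b.1 ∈ x.1 ∧ InSec U i x

/-- According to `A`, the section of `U` at `i` is `h`-stationary in `b`. -/
def SecStationaryAt (A U : Set (VDom α)) (h i b : VDom α) : Prop :=
  ∃ s : VDom α, (∀ x : VDom α, x.1 ∈ s.1 ↔ x.1 ∈ b.1 ∧ InSec U i x) ∧ InTriple A h b s

/-- The sections of `W` witness that the sections of `U` are not all stationary: a section of `W` is
closed and disjoint from a section of `U`, or two sections of `W` do not reflect simultaneously. -/
def SecsRefute (A U W : Set (VDom α)) (h : VDom α) : Prop :=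
  ∃ j k : VDom α, SecNonempty W j ∧ SecNonempty W k ∧
    (((∀ b : VDom α, b.1.IsOrdinal → SecStationaryAt A W h j b → InSec W j b) ∧
      ∃ i, SecNonempty U i ∧ ∀ x : VDom α, x.1.IsOrdinal → ¬ (InSec U i x ∧ InSec W j x)) ∨
    ∀ b : VDom α, b.1.IsOrdinal → ¬ (SecStationaryAt A W h j b ∧ SecStationaryAt A W h k b))

/-- The moves of the stationarity game. -/
def StatMove (A U W : Set (VDom α)) : Prop :=
  SecsUnbounded U ∧ SecsUnbounded W ∧
    ∃ h h' : VDom α, HasRank U h ∧ HasRank W h' ∧ h'.1 ∈ h.1 ∧ SecsRefute A U W h'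

/-- The side condition of the stationarity game. -/
def StatSide (A : Set (VDom α)) : Prop :=
  SecsUnbounded A ∧ ∃ d e : VDom α, (∀ y : VDom α, ¬ y.1 ∈ e.1) ∧ InTriple A d e e

end Formulas

namespace SetModels

variable {I : SetModels.{u}} {n : ℕ} {A U W : ∀ j, Set (I.Dom j)}

section

variable (e e' e'' : ∀ j, (Fin n → I.Dom j) → I.Dom j) [IsVar e] [IsVar e'] [IsVar e'']

theorem Def.hasRank (hU : I.DefSet U) : I.Def n fun j v => HasRank (U j) (e j v) :=
  Def.and (Def.and (hU _ _) (Def.isOrdinal _))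
    (Def.all (Def.imp (hU _ _) (Def.imp (Def.isOrdinal _) (Def.eq _ _))))

theorem Def.secNonempty (hU : I.DefSet U) : I.Def n fun j v => SecNonempty (U j) (e j v) :=
  Def.ex (Def.and (Def.isOrdinal _) (Def.inSec _ _ hU))

theorem Def.secStationaryAt (hA : I.DefSet A) (hU : I.DefSet U) :
    I.Def n fun j v => SecStationaryAt (A j) (U j) (e j v) (e' j v) (e'' j v) :=
  Def.ex (Def.and (Def.all (Def.iff (Def.mem _ _) (Def.and (Def.mem _ _) (Def.inSec _ _ hU))))
    (Def.inTriple _ _ _ hA))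

theorem Def.secsRefute (hA : I.DefSet A) (hU : I.DefSet U) (hW : I.DefSet W) :
    I.Def n fun j v => SecsRefute (A j) (U j) (W j) (e j v) :=
  Def.ex (Def.ex (Def.and (Def.secNonempty _ hW) (Def.and (Def.secNonempty _ hW) (Def.or
    (Def.and (Def.all (Def.imp (Def.isOrdinal _) (Def.imp (Def.secStationaryAt _ _ _ hA hW)
        (Def.inSec _ _ hW))))
      (Def.ex (Def.and (Def.secNonempty _ hU) (Def.all (Def.imp (Def.isOrdinal _)
        (Def.not (Def.and (Def.inSec _ _ hU) (Def.inSec _ _ hW))))))))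
    (Def.all (Def.imp (Def.isOrdinal _) (Def.not (Def.and (Def.secStationaryAt _ _ _ hA hW)
      (Def.secStationaryAt _ _ _ hA hW)))))))))

end

theorem Def.secsUnbounded (hU : I.DefSet U) : I.Def n fun j _ => SecsUnbounded (U j) :=
  Def.all (Def.imp (Def.secNonempty _ hU) (Def.all (Def.imp (Def.isOrdinal _) (Def.ex
    (Def.and (Def.isOrdinal _) (Def.and (Def.mem _ _) (Def.inSec _ _ hU)))))))

theorem Def.statMove (hA : I.DefSet A) (hU : I.DefSet U) (hW : I.DefSet W) :
    I.Def n fun j _ => StatMove (A j) (U j) (W j) :=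
  Def.and (Def.secsUnbounded hU) (Def.and (Def.secsUnbounded hW) (Def.ex (Def.ex
    (Def.and (Def.hasRank _ hU) (Def.and (Def.hasRank _ hW) (Def.and (Def.mem _ _)
      (Def.secsRefute _ hA hU hW)))))))

theorem Def.statSide (hA : I.DefSet A) : I.Def n fun j _ => StatSide (A j) :=
  Def.and (Def.secsUnbounded hA) (Def.ex (Def.ex (Def.and
    (Def.all (Def.not (Def.mem _ _))) (Def.inTriple _ _ _ hA))))

end SetModels

section Semantics

variable {α : Ordinal.{u}}

/-- The section of `U` at `i`, as a set of ordinals. -/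
def sec (U : Set (VDom α)) (i : VDom α) : Set Ordinal.{u} :=
  {ξ | ∃ h : ξ < α, InSec U i (VDom.ofOrd h)}

theorem sec_subset (U : Set (VDom α)) (i : VDom α) : sec U i ⊆ Iio α := fun _ h => h.1

theorem inSec_ofOrd_iff {U : Set (VDom α)} {i : VDom α} {ξ : Ordinal.{u}} (h : ξ < α) :
    InSec U i (VDom.ofOrd h) ↔ ξ ∈ sec U i :=
  ⟨fun h' => ⟨h, h'⟩, fun ⟨_, h'⟩ => h'⟩

theorem secNonempty_iff {U : Set (VDom α)} {i : VDom α} :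
    SecNonempty U i ↔ (sec U i).Nonempty :=
  VDom.exists_isOrdinal

theorem secsUnbounded_iff {U : Set (VDom α)} :
    SecsUnbounded U ↔ ∀ i, (sec U i).Nonempty → UnboundedIn α (sec U i) := by
  refine forall_congr' fun i => ?_
  rw [secNonempty_iff, VDom.forall_isOrdinal]
  refine imp_congr_right fun _ => forall_congr' fun β => forall_congr' fun hβ => ?_
  rw [VDom.exists_isOrdinal]
  constructor
  · rintro ⟨ξ, hξ, h1, h2⟩
    exact ⟨ξ, ⟨hξ, h2⟩, Ordinal.toZFSet_mem_toZFSet_iff.1 h1, hξ⟩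
  · rintro ⟨ξ, ⟨hξ, h2⟩, h1, -⟩
    exact ⟨ξ, hξ, Ordinal.toZFSet_mem_toZFSet_iff.2 h1, h2⟩

open Classical in
/-- The rank of a position of the stationarity game. -/
noncomputable def statRank (U : Set (VDom α)) : Ordinal.{u} :=
  if h : ∃ x, HasRank U x then h.choose.1.rank else 0

theorem HasRank.statRank_eq {U : Set (VDom α)} {η : Ordinal.{u}} {hη : η < α}
    (h : HasRank U (VDom.ofOrd hη)) : statRank U = η := by
  have hex : ∃ x, HasRank U x := ⟨_, h⟩
  have h1 := h.2 _ hex.choose_spec.1.1 hex.choose_spec.1.2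
  rw [statRank, dif_pos hex, h1]
  simp [VDom.ofOrd]

theorem HasRank.exists_ofOrd {U : Set (VDom α)} {x : VDom α} (h : HasRank U x) :
    ∃ η, ∃ hη : η < α, x = VDom.ofOrd hη :=
  VDom.exists_eq_ofOrd h.1.2

/-- The position with rank `η` and the two sections `A` and `B`. -/
def statPosition (α η : Ordinal.{u}) (A B : Set Ordinal.{u}) : Set (VDom α) :=
  {x | x.1 = η.toZFSet ∨ (∃ ξ ∈ A, x.1 = ZFSet.pair (Ordinal.toZFSet 0) ξ.toZFSet) ∨
    ∃ ξ ∈ B, x.1 = ZFSet.pair (Ordinal.toZFSet 1) ξ.toZFSet}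

theorem hasRank_statPosition {η : Ordinal.{u}} (hη : η < α) (A B : Set Ordinal.{u}) :
    HasRank (statPosition α η A B) (VDom.ofOrd hη) := by
  refine ⟨⟨Or.inl rfl, VDom.isOrdinal_ofOrd hη⟩, ?_⟩
  rintro y (hy | ⟨ξ, -, hy⟩ | ⟨ξ, -, hy⟩) ho
  · exact Subtype.ext hy
  all_goals
    rw [hy] at ho
    exact absurd ho (not_isOrdinal_pair _ _)

theorem mem_sec_statPosition (hα : Order.IsSuccLimit α) {η ξ : Ordinal.{u}}
    {A B : Set Ordinal.{u}} {i : VDom α} : ξ ∈ sec (statPosition α η A B) i ↔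
      ξ < α ∧ ((i.1 = Ordinal.toZFSet 0 ∧ ξ ∈ A) ∨ (i.1 = Ordinal.toZFSet 1 ∧ ξ ∈ B)) := by
  constructor
  · rintro ⟨h, p, hp | ⟨ζ, hζ, hp⟩ | ⟨ζ, hζ, hp⟩, hp'⟩
    · refine absurd (ZFSet.isOrdinal_toZFSet η) ?_
      rw [← hp, hp']
      exact not_isOrdinal_pair _ _
    all_goals
      obtain ⟨h1, h2⟩ := ZFSet.pair_inj.1 (hp'.symm.trans hp)
      obtain rfl := Ordinal.toZFSet_injective h2
    · exact ⟨h, Or.inl ⟨h1, hζ⟩⟩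
    · exact ⟨h, Or.inr ⟨h1, hζ⟩⟩
  · rintro ⟨h, ⟨h1, h2⟩ | ⟨h1, h2⟩⟩
    · exact ⟨h, VDom.pair hα i (VDom.ofOrd h), Or.inr (Or.inl ⟨ξ, h2, by rw [← h1]; rfl⟩), rfl⟩
    · exact ⟨h, VDom.pair hα i (VDom.ofOrd h), Or.inr (Or.inr ⟨ξ, h2, by rw [← h1]; rfl⟩), rfl⟩

theorem sec_statPosition_zero (hα : Order.IsSuccLimit α) (η : Ordinal.{u}) {A : Set Ordinal.{u}}
    (B : Set Ordinal.{u}) (hA : A ⊆ Iio α) :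
    sec (statPosition α η A B) (VDom.ofOrd hα.bot_lt) = A := by
  ext ξ
  rw [mem_sec_statPosition hα]
  have h01 : (Ordinal.toZFSet 0 : ZFSet.{u}) ≠ Ordinal.toZFSet 1 :=
    fun h => zero_ne_one (Ordinal.toZFSet_injective h)
  constructor
  · rintro ⟨_, ⟨_, h⟩ | ⟨h, _⟩⟩
    · exact h
    · exact absurd h h01
  · exact fun h => ⟨hA h, Or.inl ⟨rfl, h⟩⟩

theorem sec_statPosition_one (hα : Order.IsSuccLimit α) (η : Ordinal.{u}) (A : Set Ordinal.{u})
    {B : Set Ordinal.{u}} (hB : B ⊆ Iio α) :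
    sec (statPosition α η A B) (VDom.ofOrd (Ordinal.one_lt_of_isSuccLimit hα)) = B := by
  ext ξ
  rw [mem_sec_statPosition hα]
  have h01 : (Ordinal.toZFSet 1 : ZFSet.{u}) ≠ Ordinal.toZFSet 0 :=
    fun h => one_ne_zero (Ordinal.toZFSet_injective h)
  constructor
  · rintro ⟨_, ⟨h, _⟩ | ⟨_, h⟩⟩
    · exact absurd h h01
    · exact h
  · exact fun h => ⟨hB h, Or.inr ⟨rfl, h⟩⟩

theorem sec_statPosition_eq (hα : Order.IsSuccLimit α) {η : Ordinal.{u}} {A B : Set Ordinal.{u}}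
    (hA : A ⊆ Iio α) (hB : B ⊆ Iio α) {i : VDom α}
    (hi : (sec (statPosition α η A B) i).Nonempty) :
    sec (statPosition α η A B) i = A ∨ sec (statPosition α η A B) i = B := by
  obtain ⟨ξ, hξ⟩ := hi
  rcases ((mem_sec_statPosition hα).1 hξ).2 with ⟨h, -⟩ | ⟨h, -⟩
  · left
    obtain rfl : i = VDom.ofOrd hα.bot_lt := Subtype.ext h
    exact sec_statPosition_zero hα η B hA
  · right
    obtain rfl : i = VDom.ofOrd (Ordinal.one_lt_of_isSuccLimit hα) := Subtype.ext h
    exact sec_statPosition_one hα η A hB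

/-- The positions of the stationarity game in which the player to move loses. -/
def StatGood (α : Ordinal.{u}) (U : Set (VDom α)) : Prop :=
  ∀ η, ∀ hη : η < α, HasRank U (VDom.ofOrd hη) → SecsUnbounded U →
    (∀ η' < η, IsReflecting η' α) ∧ ∀ i, (sec U i).Nonempty → IsStationary η α (sec U i)

/-- `A` decides correctly which sets are `η`-stationary in `β < α`, for `η < γ`. -/
def DecidesStationary (γ : Ordinal.{u}) (A : Set (VDom α)) : Prop :=
  ∀ η, ∀ hη : η < α, η < γ → ∀ β, ∀ hβ : β < α, ∀ s : VDom α,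
    InTriple A (VDom.ofOrd hη) (VDom.ofOrd hβ) s ↔
      ∃ S, IsStationary η β S ∧ s.1 = segment S β

theorem DecidesStationary.secStationaryAt_iff {γ : Ordinal.{u}} {A : Set (VDom α)}
    (hA : DecidesStationary γ A) {U : Set (VDom α)} {i : VDom α} {η β : Ordinal.{u}}
    (hη : η < α) (hηγ : η < γ) (hβ : β < α) :
    SecStationaryAt A U (VDom.ofOrd hη) i (VDom.ofOrd hβ) ↔ IsStationary η β (sec U i) := by
  constructor
  · rintro ⟨s, hs, h⟩
    obtain ⟨S, hS, hsS⟩ := (hA η hη hηγ β hβ s).1 h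
    refine hS.mono_set fun ξ hξ hξβ => ⟨hξβ.trans hβ, ((hs _).1 ?_).2⟩
    rw [hsS]
    exact toZFSet_mem_segment.2 ⟨hξβ, hξ⟩
  · intro h
    refine ⟨VDom.segment (sec U i) hβ, fun x => ?_, (hA η hη hηγ β hβ _).2 ⟨_, h, rfl⟩⟩
    rw [VDom.mem_segment_iff]
    refine and_congr_right fun hx => ?_
    obtain ⟨ξ, hξ, rfl⟩ := VDom.mem_ofOrd_iff.1 hx
    rw [inSec_ofOrd_iff, VDom.ofOrd, Ordinal.rank_toZFSet]

theorem DecidesStationary.secsRefute_iff {γ : Ordinal.{u}} {A : Set (VDom α)}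
    (hA : DecidesStationary γ A) {U W : Set (VDom α)} {η : Ordinal.{u}}
    (hη : η < α) (hηγ : η < γ) :
    SecsRefute A U W (VDom.ofOrd hη) ↔ ∃ j k, (sec W j).Nonempty ∧ (sec W k).Nonempty ∧
      (((∀ β < α, IsStationary η β (sec W j) → β ∈ sec W j) ∧
        ∃ i, (sec U i).Nonempty ∧ ¬ (sec U i ∩ sec W j).Nonempty) ∨
      ∀ β < α, ¬ (IsStationary η β (sec W j) ∧ IsStationary η β (sec W k))) := by
  refine exists_congr fun j => exists_congr fun k => ?_
  simp only [secNonempty_iff, VDom.forall_isOrdinal, hA.secStationaryAt_iff hη hηγ]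
  refine and_congr_right fun _ => and_congr_right fun _ => or_congr (and_congr ?_ ?_) Iff.rfl
  · exact forall_congr' fun β => forall_congr' fun hβ => imp_congr_right fun _ =>
      inSec_ofOrd_iff hβ
  · refine exists_congr fun i => and_congr_right fun _ => ?_
    constructor
    · rintro h ⟨ξ, h1, h2⟩
      exact h ξ h1.1 ⟨h1.2, h2.2⟩
    · exact fun h ξ hξ h' => h ⟨ξ, ⟨hξ, h'.1⟩, ⟨hξ, h'.2⟩⟩

/-- A missed club or a pair of sets that do not reflect together is played as a position with two
sections. It is good because its sections really are `η'`-stationary in `α`. -/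
theorem DecidesStationary.exists_move {γ : Ordinal.{u}} {A : Set (VDom α)}
    (hA : DecidesStationary γ A) (hα : Order.IsSuccLimit α) {U : Set (VDom α)}
    {η η' : Ordinal.{u}} (hη : η < α) (hU : HasRank U (VDom.ofOrd hη)) (hunb : SecsUnbounded U)
    (hηγ : η ≤ γ) (hη' : η' < η) {B D : Set Ordinal.{u}} (hB : B ⊆ Iio α) (hD : D ⊆ Iio α)
    (hBs : IsStationary η' α B) (hDs : IsStationary η' α D)
    (h : ((∀ β < α, IsStationary η' β B → β ∈ B) ∧
        ∃ i, (sec U i).Nonempty ∧ ¬ (sec U i ∩ B).Nonempty) ∨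
      ∀ β < α, ¬ (IsStationary η' β B ∧ IsStationary η' β D)) :
    ∃ W, StatMove A U W ∧ StatGood α W := by
  have hsec : ∀ i, (sec (statPosition α η' B D) i).Nonempty →
      IsStationary η' α (sec (statPosition α η' B D) i) := by
    intro i hi
    rcases sec_statPosition_eq hα hB hD hi with h | h <;> rw [h] <;> assumption
  refine ⟨statPosition α η' B D, ⟨hunb, secsUnbounded_iff.2 fun i hi => (hsec i hi).unboundedIn,
    VDom.ofOrd hη, VDom.ofOrd (hη'.trans hη), hU, hasRank_statPosition _ _ _,
    Ordinal.toZFSet_mem_toZFSet_iff.2 hη', ?_⟩, ?_⟩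
  · rw [hA.secsRefute_iff _ (hη'.trans_le hηγ)]
    refine ⟨VDom.ofOrd hα.bot_lt, VDom.ofOrd (Ordinal.one_lt_of_isSuccLimit hα), ?_⟩
    rw [sec_statPosition_zero hα η' D hB, sec_statPosition_one hα η' B hD]
    obtain ⟨x, hx, -⟩ := hBs.nonempty
    obtain ⟨y, hy, -⟩ := hDs.nonempty
    exact ⟨⟨x, hx⟩, ⟨y, hy⟩, h⟩
  · intro ζ hζ hr _
    obtain rfl : ζ = η' := by
      rw [← hr.statRank_eq, (hasRank_statPosition (hη'.trans hη) B D).statRank_eq]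
    exact ⟨fun ζ' hζ' => hBs.isReflecting hζ', hsec⟩

/-- The recursive definition of stationarity read as a game: a failure of order `η` is witnessed by
sets stationary of some order `η' < η`, and a move claiming such witnesses succeeds exactly if the
claim is true. -/
theorem DecidesStationary.statGood_iff {γ : Ordinal.{u}} {A : Set (VDom α)}
    (hA : DecidesStationary γ A) (hα : Order.IsSuccLimit α) {U : Set (VDom α)}
    (hU : statRank U ≤ γ) : StatGood α U ↔ ∀ W, StatMove A U W → ¬ StatGood α W := by
  constructor
  · rintro hg W ⟨hunb, hunbW, h, h', hh, hh', hlt, href⟩ hgW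
    obtain ⟨η, hη, rfl⟩ := hh.exists_ofOrd
    obtain ⟨η', hη', rfl⟩ := hh'.exists_ofOrd
    have hlt' : η' < η := Ordinal.toZFSet_mem_toZFSet_iff.1 hlt
    rw [hh.statRank_eq] at hU
    rw [hA.secsRefute_iff hη' (hlt'.trans_le hU)] at href
    obtain ⟨hr, hs⟩ := hg η hη hh hunb
    obtain ⟨-, hsW⟩ := hgW η' hη' hh' hunbW
    obtain ⟨j, k, hj, hk, ⟨hcl, i, hi, hdisj⟩ | hrefl⟩ := href
    · exact hdisj ((hs i hi).inter_nonempty hlt' ⟨sec_subset _ _, hsW j hj, hcl⟩)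
    · obtain ⟨β, hβ, h1, h2⟩ := hr η' hlt' _ (sec_subset W j) _ (sec_subset W k)
        (hsW j hj) (hsW k hk)
      exact hrefl β hβ ⟨h1, h2⟩
  · intro hW η hη hh hunb
    rw [hh.statRank_eq] at hU
    have hr : ∀ η' < η, IsReflecting η' α := by
      intro η' hη'
      by_contra hcon
      simp only [IsReflecting, ReflectsFor, not_forall] at hcon
      obtain ⟨B, hB, D, hD, hBs, hDs, hno⟩ := hcon
      obtain ⟨W, hmv, hg⟩ := hA.exists_move hα hη hh hunb hU hη' hB hD hBs hDs
        (Or.inr fun β hβ h => hno ⟨β, hβ, h.1, h.2⟩)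
      exact hW W hmv hg
    refine ⟨hr, fun i hi => isStationary_iff.2 ⟨hα, fun _ => secsUnbounded_iff.1 hunb i hi,
      fun η' hη' => ⟨hr η' hη', fun C hC => ?_⟩⟩⟩
    by_contra hdisj
    obtain ⟨W, hmv, hg⟩ := hA.exists_move hα hη hh hunb hU hη' hC.1 hC.1 hC.2.1 hC.2.1
      (Or.inl ⟨hC.2.2, i, hi, hdisj⟩)
    exact hW W hmv hg

end Semantics

section Game

variable {κ γ δ l : Ordinal.{u}} {C : Ordinal.{u} → Set Ordinal.{u}} {α : Ordinal.{u}}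

/-- The parameter of the stationarity game: it codes the initial position with rank `γ` and sections
`C i` for `i < l`, the `η`-stationary sets in `β` for `η < γ` and `β < κ`, and the ordinal `δ`. -/
def statParam (κ γ δ l : Ordinal.{u}) (C : Ordinal.{u} → Set Ordinal.{u}) : Set ZFSet.{u} :=
  {x | x = γ.toZFSet ∨ (∃ i < l, ∃ ξ ∈ C i, x = ZFSet.pair i.toZFSet ξ.toZFSet) ∨
    (∃ η < γ, ∃ β < κ, ∃ S, IsStationary η β S ∧
      x = ZFSet.pair η.toZFSet (ZFSet.pair β.toZFSet (segment S β))) ∨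
    x = ZFSet.pair δ.toZFSet (ZFSet.pair ∅ ∅)}

theorem statParam_mem (hκ : Order.IsSuccLimit κ) (hγ : γ ≤ δ) (hδ : δ < κ) (hl : l ≤ δ)
    (hC : ∀ i < l, C i ⊆ Iio κ) :
    ∀ x ∈ statParam κ γ δ l C, x ∈ ZFSet.vonNeumann κ := by
  intro x hx
  rw [ZFSet.mem_vonNeumann]
  rcases hx with rfl | ⟨i, hi, ξ, hξ, rfl⟩ | ⟨η, hη, β, hβ, S, -, rfl⟩ | rfl
  · simpa using hγ.trans_lt hδ
  · exact rank_pair_lt hκ (by simpa using (hi.trans_le hl).trans hδ) (by simpa using hC i hi hξ)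
  · exact rank_pair_lt hκ (by simpa using (hη.trans_le hγ).trans hδ)
      (rank_pair_lt hκ (by simpa using hβ) ((rank_segment_le _ _).trans_lt hβ))
  · have h0 : (∅ : ZFSet.{u}).rank < κ := by simpa using hκ.bot_lt
    exact rank_pair_lt hκ (by simpa using hδ) (rank_pair_lt hκ h0 h0)

theorem mem_sec_statParam (hα : Order.IsSuccLimit α) {i : VDom α} {ξ : Ordinal.{u}} :
    ξ ∈ sec (restrict (statParam κ γ δ l C) α) i ↔
      ξ < α ∧ ∃ i' < l, i.1 = i'.toZFSet ∧ ξ ∈ C i' := by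
  constructor
  · rintro ⟨h, p, hp, hpi⟩
    refine ⟨h, ?_⟩
    have hno : ∀ x y : ZFSet.{u}, ξ.toZFSet ≠ ZFSet.pair x y := fun x y he =>
      not_isOrdinal_pair x y (he ▸ ZFSet.isOrdinal_toZFSet ξ)
    rcases hp with hp | ⟨i', hi', ζ, hζ, hp⟩ | ⟨η, -, β, -, S, -, hp⟩ | hp
    · exact absurd (ZFSet.isOrdinal_toZFSet γ)
        (by rw [← hp, hpi]; exact not_isOrdinal_pair _ _)
    · obtain ⟨h1, h2⟩ := ZFSet.pair_inj.1 (hpi.symm.trans hp)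
      obtain rfl := Ordinal.toZFSet_injective h2
      exact ⟨i', hi', h1, hζ⟩
    all_goals exact absurd (ZFSet.pair_inj.1 (hpi.symm.trans hp)).2 (hno _ _)
  · rintro ⟨h, i', hi', hi, hξ⟩
    exact ⟨h, VDom.pair hα i (VDom.ofOrd h),
      Or.inr (Or.inl ⟨i', hi', ξ, hξ, by rw [← hi]; rfl⟩), rfl⟩

theorem inTriple_statParam_iff (hα : Order.IsSuccLimit α) {d b s : VDom α} :
    InTriple (restrict (statParam κ γ δ l C) α) d b s ↔
      (∃ η < γ, ∃ β < κ, ∃ S, IsStationary η β S ∧ d.1 = η.toZFSet ∧ b.1 = β.toZFSet ∧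
        s.1 = segment S β) ∨ (d.1 = δ.toZFSet ∧ b.1 = ∅ ∧ s.1 = ∅) := by
  constructor
  · rintro ⟨q, hq, p, hp, hpd⟩
    rcases hp with hp | ⟨i', hi', ζ, hζ, hp⟩ | ⟨η, hη, β, hβ, S, hS, hp⟩ | hp
    · exact absurd (ZFSet.isOrdinal_toZFSet γ)
        (by rw [← hp, hpd]; exact not_isOrdinal_pair _ _)
    · refine absurd (ZFSet.isOrdinal_toZFSet ζ) ?_
      rw [← (ZFSet.pair_inj.1 (hpd.symm.trans hp)).2, hq]
      exact not_isOrdinal_pair _ _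
    · obtain ⟨h1, h2⟩ := ZFSet.pair_inj.1 (hpd.symm.trans hp)
      obtain ⟨h3, h4⟩ := ZFSet.pair_inj.1 (hq.symm.trans h2)
      exact Or.inl ⟨η, hη, β, hβ, S, hS, h1, h3, h4⟩
    · obtain ⟨h1, h2⟩ := ZFSet.pair_inj.1 (hpd.symm.trans hp)
      obtain ⟨h3, h4⟩ := ZFSet.pair_inj.1 (hq.symm.trans h2)
      exact Or.inr ⟨h1, h3, h4⟩
  · intro h
    refine ⟨VDom.pair hα b s, rfl, VDom.pair hα d (VDom.pair hα b s), ?_, rfl⟩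
    rcases h with ⟨η, hη, β, hβ, S, hS, h1, h2, h3⟩ | ⟨h1, h2, h3⟩
    · refine Or.inr (Or.inr (Or.inl ⟨η, hη, β, hβ, S, hS, ?_⟩))
      rw [← h1, ← h2, ← h3]; rfl
    · refine Or.inr (Or.inr (Or.inr ?_))
      change ZFSet.pair d.1 (ZFSet.pair b.1 s.1) = _
      rw [h1, h2, h3]

theorem decidesStationary_statParam (hα : Order.IsSuccLimit α) (hακ : α ≤ κ) (hγ : γ ≤ δ) :
    DecidesStationary γ (restrict (statParam κ γ δ l C) α) := by
  intro η hη hηγ β hβ s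
  rw [inTriple_statParam_iff hα]
  constructor
  · rintro (⟨η', -, β', -, S, hS, h1, h2, h3⟩ | ⟨h1, -, -⟩)
    · obtain rfl := Ordinal.toZFSet_injective h1
      obtain rfl := Ordinal.toZFSet_injective h2
      exact ⟨S, hS, h3⟩
    · obtain rfl := Ordinal.toZFSet_injective h1
      exact absurd hηγ (not_lt.2 hγ)
  · rintro ⟨S, hS, hs⟩
    exact Or.inl ⟨η, hηγ, β, hβ.trans_le hακ, S, hS, rfl, rfl, hs⟩

theorem StatSide.lt (hα : Order.IsSuccLimit α)
    (h : StatSide (restrict (statParam κ γ δ l C) α)) : δ < α := by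
  obtain ⟨-, d, e, he, ht⟩ := h
  have he' : e.1 = ∅ := (ZFSet.eq_empty _).2 fun y hy => he ⟨y, e.mem_trans hy⟩ hy
  -- A triple with second entry `∅` cannot record stationarity, as `0` is not a limit; so it is the
  -- mark for `δ`.
  rcases (inTriple_statParam_iff hα).1 ht with ⟨η, -, β, -, S, hS, -, h2, -⟩ | ⟨h1, -⟩
  · rw [he', ← Ordinal.toZFSet_zero] at h2
    rw [← Ordinal.toZFSet_injective h2] at hS
    exact absurd hS.isSuccLimit.bot_lt (lt_irrefl _)
  · have := ZFSet.mem_vonNeumann.1 d.2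
    rwa [h1, Ordinal.rank_toZFSet] at this

theorem hasRank_statParam (hγ : γ < α) :
    HasRank (restrict (statParam κ γ δ l C) α) (VDom.ofOrd hγ) := by
  refine ⟨⟨Or.inl rfl, VDom.isOrdinal_ofOrd hγ⟩, ?_⟩
  rintro y (hy | ⟨_, -, _, -, hy⟩ | ⟨_, -, _, -, _, -, hy⟩ | hy) ho
  · exact Subtype.ext hy
  all_goals
    rw [hy] at ho
    exact absurd ho (not_isOrdinal_pair _ _)

/-- The game of refuting that the sets `C i`, `i < l`, are `γ`-stationary. -/
noncomputable def statGame (hκ : Order.IsSuccLimit κ) (hγ : γ ≤ δ) (hδ : δ < κ) (hl : l ≤ δ)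
    (hC : ∀ i < l, C i ⊆ Iio κ) : SetGame κ γ where
  R := statParam κ γ δ l C
  R_mem := statParam_mem hκ hγ hδ hl hC
  side _ A := StatSide A
  move _ A U W := StatMove A U W
  side_def _ _ hA := SetModels.Def.statSide hA
  move_def _ _ _ _ hA hU hW := SetModels.Def.statMove hA hU hW
  good := StatGood
  rank _ U := statRank U
  not_move_empty := by
    rintro α W ⟨-, -, h, _, hh, -⟩
    exact hh.1.1
  rank_empty α := dif_neg fun ⟨_, h⟩ => h.1.1
  rank_lt := by
    rintro α U W ⟨-, -, h, h', hh, hh', hlt, -⟩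
    obtain ⟨η, hη, rfl⟩ := hh.exists_ofOrd
    obtain ⟨η', hη', rfl⟩ := hh'.exists_ofOrd
    rw [hh.statRank_eq, hh'.statRank_eq]
    exact Ordinal.toZFSet_mem_toZFSet_iff.1 hlt
  rank_le := by
    intro α _ hα hs
    rw [(hasRank_statParam (hγ.trans_lt (hs.lt hα))).statRank_eq]
  good_iff := by
    intro α hακ hα _ U hU
    exact (decidesStationary_statParam hα hακ hγ).statGood_iff hα hU

end Game

/-! ### Simultaneous reflection, completeness and the conclusion. -/

/-- Fewer than `κ` many `γ`-stationary sets reflect simultaneously. -/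
theorem ReflectsGames.exists_isStationary {κ : Cardinal.{u}} {γ : Ordinal.{u}}
    (hκ : Order.IsSuccLimit κ.ord) (hbr : BranchProperty κ) (h : ReflectsGames γ κ.ord)
    (hγ : γ < κ.ord) (hr : ∀ η < γ, IsReflecting η κ.ord) {l : Ordinal.{u}} (hl : l < κ.ord)
    {C : Ordinal.{u} → Set Ordinal.{u}} (hCκ : ∀ i < l, C i ⊆ Iio κ.ord)
    (hC : ∀ i < l, IsStationary γ κ.ord (C i)) :
    ∃ α < κ.ord, ∀ i < l, IsStationary γ α (C i) := by
  have hmin : ∀ i, ∃ ξ, i < l → ξ ∈ C i ∧ ξ < κ.ord := by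
    intro i
    by_cases hi : i < l
    · obtain ⟨ξ, h1, h2⟩ := (hC i hi).nonempty
      exact ⟨ξ, fun _ => ⟨h1, h2⟩⟩
    · exact ⟨0, fun h => absurd h hi⟩
  choose f hf using hmin
  obtain ⟨δ₀, hδ₀, hfδ⟩ := hbr.exists_bound hl f fun i hi => (hf i hi).2
  -- The side condition forces `δ < α`. Then the rank `γ` and all indices `i < l` lie in `V_α`, and
  -- every `C i` has the element `f i` below `α`; empty sections would not be tested by the game.
  set δ := max (max γ l) δ₀
  have hδ : δ < κ.ord := max_lt (max_lt hγ hl) hδ₀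
  have hγδ : γ ≤ δ := (le_max_left _ _).trans (le_max_left _ _)
  have hlδ : l ≤ δ := (le_max_right _ _).trans (le_max_left _ _)
  have hst : ∀ i, (sec (restrict (statParam κ.ord γ δ l C) κ.ord) i).Nonempty →
      IsStationary γ κ.ord (sec (restrict (statParam κ.ord γ δ l C) κ.ord) i) := by
    rintro i ⟨ξ, hξ⟩
    obtain ⟨-, i', hi', he, -⟩ := (mem_sec_statParam hκ).1 hξ
    exact (hC i' hi').mono_set fun x hx hxκ => (mem_sec_statParam hκ).2 ⟨hxκ, i', hi', he, hx⟩
  obtain ⟨α, hακ, hα, hs, hg⟩ := h (statGame hκ hγδ hδ hlδ hCκ) ⟨hκ,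
    ⟨secsUnbounded_iff.2 fun i hi => (hst i hi).unboundedIn, VDom.ofOrd hδ,
      VDom.ofOrd hκ.bot_lt, fun y hy => by
        obtain ⟨ξ, hξ, -⟩ := VDom.mem_ofOrd_iff.1 hy
        exact absurd hξ not_lt_bot,
      (inTriple_statParam_iff hκ).2 (Or.inr ⟨rfl, Ordinal.toZFSet_zero, Ordinal.toZFSet_zero⟩)⟩,
    fun η hη hrk _ => by
      obtain rfl : η = γ := by
        rw [← hrk.statRank_eq]
        exact (hasRank_statParam hγ).statRank_eq
      exact ⟨hr, hst⟩⟩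
  have hδα : δ < α := StatSide.lt hα hs
  refine ⟨α, hακ, fun i hi => ?_⟩
  have hiα : i < α := (hi.trans_le hlδ).trans hδα
  have hg' := (hg γ (hγδ.trans_lt hδα) (hasRank_statParam _) hs.1).2 (VDom.ofOrd hiα)
    ⟨f i, (mem_sec_statParam hα).2
      ⟨((hfδ i hi).trans (le_max_right _ _)).trans_lt hδα, i, hi, rfl, (hf i hi).1⟩⟩
  refine hg'.mono_set fun x hx _ => ?_
  obtain ⟨-, i', -, he, hx'⟩ := (mem_sec_statParam hα).1 hx
  rwa [Ordinal.toZFSet_injective he]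

/-- For a club `E` of order below `γ`, the sets `C i ∩ E` are `γ`-stationary and reflect at a common
`α`, which lies in `E` and in every `C i` by closure. Intervals in place of `E` give unboundedness.
-/
theorem ReflectsGames.isComplete {κ : Cardinal.{u}} {γ : Ordinal.{u}}
    (hκ : Order.IsSuccLimit κ.ord) (hbr : BranchProperty κ) (h : ReflectsGames γ κ.ord)
    (hγ : γ < κ.ord) (hr : ∀ η < γ, IsReflecting η κ.ord) :
    IsComplete κ (clubFilter γ κ.ord) := by
  intro ι _ X hι hX
  choose hXκ C hC hCX using hX
  have hclub : IsGClub γ κ.ord (⋂ i, C i) := by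
    obtain ⟨i₀⟩ := ‹Nonempty ι›
    have hsub : ∀ i, ⋂ i, C i ⊆ C i := fun i => iInter_subset C i
    have hl : (Cardinal.mk ι).ord < κ.ord := Cardinal.ord_lt_ord.2 hι
    obtain ⟨e⟩ : Nonempty (ι ≃ (Cardinal.mk ι).ord.ToType) := Cardinal.eq.1 (by simp)
    have key : ∀ D : ι → Set Ordinal.{u}, (∀ i, D i ⊆ Iio κ.ord) →
        (∀ i, IsStationary γ κ.ord (D i)) → ∃ α < κ.ord, ∀ i, IsStationary γ α (D i) := by
      intro D hDκ hD
      let D' : Ordinal.{u} → Set Ordinal.{u} := fun ξ =>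
        ⋃ hξ : ξ < (Cardinal.mk ι).ord, D (e.symm (Ordinal.ToType.mk ⟨ξ, hξ⟩))
      have hD' : ∀ ξ, ∀ hξ : ξ < (Cardinal.mk ι).ord,
          D' ξ = D (e.symm (Ordinal.ToType.mk ⟨ξ, hξ⟩)) := fun ξ hξ => by
        simp only [D', hξ, iUnion_true]
      obtain ⟨α, hα, hst⟩ := h.exists_isStationary hκ hbr hγ hr hl (C := D')
        (fun ξ hξ => by rw [hD' ξ hξ]; exact hDκ _) (fun ξ hξ => by rw [hD' ξ hξ]; exact hD _)
      refine ⟨α, hα, fun i => ?_⟩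
      have hlt : (Ordinal.ToType.mk.symm (e i)).1 < (Cardinal.mk ι).ord :=
        (Ordinal.ToType.mk.symm (e i)).2
      have := hst (Ordinal.ToType.mk.symm (e i)).1 hlt
      rw [hD' _ hlt] at this
      change IsStationary γ α (D (e.symm (Ordinal.ToType.mk (Ordinal.ToType.mk.symm (e i)))))
        at this
      rwa [OrderIso.apply_symm_apply, Equiv.symm_apply_apply] at this
    refine ⟨(hsub i₀).trans (hC i₀).1, isStationary_iff.2 ⟨hκ, fun _ β hβ => ?_,
      fun η hη => ⟨hr η hη, fun E hE => ?_⟩⟩, fun α hα hs => mem_iInter.2 fun i =>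
        (hC i).2.2 α hα (hs.mono_set fun x hx _ => hsub i hx)⟩
    · have hD : ∀ i, IsStationary γ κ.ord (C i ∩ Ioo β κ.ord) := fun i => by
        rcases eq_or_ne γ 0 with rfl | h0
        · refine isStationary_zero.2 ⟨hκ, fun ε hε => ?_⟩
          obtain ⟨s, hs, h1, h2⟩ := (hC i).2.1.unboundedIn _ (max_lt hβ hε)
          exact ⟨s, ⟨hs, (le_max_left _ _).trans_lt h1, h2⟩, (le_max_right _ _).trans_lt h1, h2⟩
        · exact (hC i).2.1.inter_isGClub (pos_iff_ne_zero.2 h0) (isGClub_zero_Ioo hκ hβ)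
      obtain ⟨α, hα, hst⟩ := key _ (fun i x hx => (hC i).1 hx.1) hD
      refine ⟨α, mem_iInter.2 fun i => (hC i).2.2 α hα ((hst i).mono_set fun x hx _ => hx.1),
        ?_, hα⟩
      obtain ⟨x, hx, hxα⟩ := (hst i₀).nonempty
      exact hx.2.1.trans hxα
    · obtain ⟨α, hα, hst⟩ := key (fun i => C i ∩ E) (fun i x hx => (hC i).1 hx.1)
        fun i => (hC i).2.1.inter_isGClub hη hE
      exact ⟨α, mem_iInter.2 fun i => (hC i).2.2 α hα ((hst i).mono_set fun x hx _ => hx.1),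
        hE.2.2 α hα (((hst i₀).mono_set fun x hx _ => hx.2).mono hη.le)⟩
  obtain ⟨i₀⟩ := ‹Nonempty ι›
  exact ⟨(iInter_subset X i₀).trans (hXκ i₀), _, hclub, iInter_mono hCX⟩

theorem ReflectsGames.splits {κ : Cardinal.{u}} {γ : Ordinal.{u}} (h : ReflectsGames γ κ.ord)
    (hγ : 1 ≤ γ) {S : Set Ordinal.{u}} (hS : IsStationary (γ + 1) κ.ord S) :
    Splits (γ + 1) κ S := by
  have hbr := h.branchProperty hS.isSuccLimit hγ
  refine splits_of_branchProperty hbr (h.isComplete hS.isSuccLimit hbr hS.lt_ord fun η hη => ?_) hS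
  exact hS.isReflecting (hη.trans (Order.lt_add_one_iff.2 le_rfl))

end HigherStat

theorem mainTheorem6 (κ : Cardinal.{u}) :
    (∀ γ : Ordinal.{u}, HigherStat.IsWeaklyCompact κ →
      HigherStat.IsComplete κ (HigherStat.clubFilter γ κ.ord) →
      ∀ S ⊆ Set.Iio κ.ord, HigherStat.IsStationary (γ + 1) κ.ord S →
        HigherStat.Splits (γ + 1) κ S) ∧
    (∀ γ : Ordinal.{u}, 1 ≤ γ → HigherStat.IsIndescribable γ κ →
      ∀ S ⊆ Set.Iio κ.ord, HigherStat.IsStationary (γ + 1) κ.ord S →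
        HigherStat.Splits (γ + 1) κ S) ∧
    (∀ n : ℕ, 1 ≤ n → HigherStat.IsFinIndescribable n κ →
      ∀ S ⊆ Set.Iio κ.ord, HigherStat.IsStationary ((n : Ordinal.{u}) + 1) κ.ord S →
        HigherStat.Splits ((n : Ordinal.{u}) + 1) κ S) := by
  refine ⟨fun γ hκ hcomp S _ hS => ?_, fun γ hγ hκ S _ hS => ?_, fun n hn hκ S _ hS => ?_⟩
  · exact HigherStat.splits_of_branchProperty hκ.branchProperty hcomp hS
  · exact (hκ.reflectsGames hγ).splits hγ hS
  · exact hκ.reflectsGames.splits (by exact_mod_cast hn) hS
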